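/- Let $N^m$ be a smooth Riemannian manifold of constant sectional curvature with metric $h$ and Levi-Civita connection $\overline\nabla$, let $\Sigma^n$ be a closed (compact, without boundary) smooth manifold, and let $f:\Sigma\to N$ be a smooth immersion; give $\Sigma$ the induced metric. Let $A(X,Y)=-(\overline\nabla_X Y)^\perp$ be the normal-valued second fundamental form, and write $A_{ij}=A(e_i,e_j)$ for an orthonormal basis $e_1,\dots,e_n$ of $T_x\Sigma$. Let $\epsilon^{i_1\cdots i_r}_{j_1\cdots j_r}$ be the sign of the permutation taking $(i_1,\dots,i_r)$ to $(j_1,\dots,j_r)$ if the $i_k$ are distinct and such a permutation exists, and $0$ otherwise. For even $r$ define the function and the $(1,1)$-tensor $$H_r=\frac1{r!}\sum\epsilon^{i_1\cdots i_r}_{j_1\cdots j_r}\,h(A_{i_1j_1},A_{i_2j_2})\cdots h(A_{i_{r-1}j_{r-1}},A_{i_rj_r}),$$ $$(T^r)^i_j=\frac1{r!}\sum\epsilon^{i\,i_1\cdots i_r}_{j\,j_1\cdots j_r}\,h(A_{i_1j_1},A_{i_2j_2})\cdots h(A_{i_{r-1}j_{r-1}},A_{i_rj_r}),$$ and for odd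 $r$ define the normal vector field $H_r$ and the normal-valued $(1,1)$-tensor $T^r$ by the same formulas with the products replaced by $h(A_{i_1j_1},A_{i_2j_2})\cdots h(A_{i_{r-2}j_{r-2}},A_{i_{r-1}j_{r-1}})\,A_{i_rj_r}$. These do not depend on the choice of orthonormal basis. If $m=n+1$ and $\Sigma$ carries a continuous unit normal field $\nu$, then for every $r$ one may also use the scalar versions: with $k_1,\dots,k_n$ the principal curvatures (the eigenvalues of $h(A(\cdot,\cdot),\nu)$) and $e_1,\dots,e_n$ an orthonormal basis of principal directions, $$H_r=\sum_{i_1<\cdots<i_r}k_{i_1}\cdots k_{i_r},\qquad T^r(e_i)=\Big(\sum_{i_1<\cdots<i_r,\ i_l\ne i}k_{i_1}\cdots k_{i_r}\Big)e_i .$$ Let $r\in\{1,\dots,n-1\}$ and suppose that the traceless part of $T^r$ vanishes, i.e. $T^r=\frac{n-r}{n}H_r\,I$ on $\Sigma$. Then $H_r$ is parallel. Explicitly: 1. if $r$ is even, then $dH_r=0$, and the function $H_r$ is constant on each connected component of $\Sigma$; 2. if $r$ is odd, then $H_r$ is a differentiable normal vector field with $(\overline\nabla_X H_r)^\perp=0$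 for every tangent vector $X$ of $\Sigma$; 3. if $m=n+1$, $\Sigma$ carries a continuous unit normal field and $H_r$, $T^r$ are the scalar versions ($r$ of either parity), then $dH_r=0$, and $H_r$ is constant on each connected component of $\Sigma$. -/

import Mathlib

open scoped Manifold ContDiff

namespace ImmersedSubmanifold

noncomputable section

/-- The model space `ℝᵏ`. -/
abbrev E (k : ℕ) : Type := EuclideanSpace ℝ (Fin k)

/-! ### Riemannian geometry in a chart

Here `G : E m → (E m →L[ℝ] E m →L[ℝ] ℝ)` is the coordinate expression of a metric. -/

/-- The Christoffel symbols `Γ(y)(v, w)` of `G`, i.e. the solution of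
`G(Γ(v, w), z) = (∂_v G(w, z) + ∂_w G(v, z) - ∂_z G(v, w)) / 2` for all `z`. -/
def christoffel {m : ℕ} (G : E m → E m →L[ℝ] E m →L[ℝ] ℝ) (y v w : E m) : E m :=
  (G y).inverse ((1 / 2 : ℝ) •
    (fderiv ℝ G y v w + fderiv ℝ G y w v - ((fderiv ℝ G y).flip v).flip w))

/-- The curvature tensor `R(u, v) w = ∇_u ∇_v w - ∇_v ∇_u w` of `G` at `y`
(where `u`, `v`, `w` are extended to constant, hence commuting, coordinate fields). -/
def curvature {m : ℕ} (G : E m → E m →L[ℝ] E m →L[ℝ] ℝ) (y u v w : E m) : E m :=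
  fderiv ℝ (fun z => christoffel G z v w) y u - fderiv ℝ (fun z => christoffel G z u w) y v
    + christoffel G y u (christoffel G y v w) - christoffel G y v (christoffel G y u w)

/-! ### Ambient Riemannian manifold -/

section Ambient

variable {m : ℕ} {N : Type*} [TopologicalSpace N] [ChartedSpace (E m) N] [IsManifold (𝓡 m) ∞ N]

/-- Smooth Riemannian metrics on the `m`-dimensional manifold `N`. -/
abbrev Metric (m : ℕ) (N : Type*) [TopologicalSpace N] [ChartedSpace (E m) N]
    [IsManifold (𝓡 m) ∞ N] : Type _ :=
  Bundle.ContMDiffRiemannianMetric (𝓡 m) ∞ (E m) (fun q : N => TangentSpace (𝓡 m) q)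

/-- Differential at `q` of the chart of `N` around `p`: the coordinates of tangent vectors at `q`. -/
def toChart (m : ℕ) {N : Type*} [TopologicalSpace N] [ChartedSpace (E m) N]
    (p q : N) : TangentSpace (𝓡 m) q →L[ℝ] E m :=
  mfderiv (𝓡 m) 𝓘(ℝ, E m) (extChartAt (𝓡 m) p) q

/-- The metric in the chart around `p`: pull-back of `g` under the inverse of the chart. -/
def chartMetric (g : Metric m N) (p : N) (y : E m) : E m →L[ℝ] E m →L[ℝ] ℝ :=
  let D : E m →L[ℝ] TangentSpace (𝓡 m) ((extChartAt (𝓡 m) p).symm y) :=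
    mfderiv 𝓘(ℝ, E m) (𝓡 m) (extChartAt (𝓡 m) p).symm y
  (ContinuousLinearMap.precomp ℝ D).comp ((g.inner ((extChartAt (𝓡 m) p).symm y)).comp D)

/-- `(N, g)` has constant sectional curvature `c`:
`⟨R(u, v) v, u⟩ = c (|u|² |v|² - ⟨u, v⟩²)` at every point of every (preferred) chart. -/
def HasConstantCurvature (g : Metric m N) (c : ℝ) : Prop :=
  ∀ (p : N), ∀ y ∈ (extChartAt (𝓡 m) p).target, ∀ u v : E m,
    chartMetric g p y (curvature (chartMetric g p) y u v v) u =
      c * (chartMetric g p y u u * chartMetric g p y v v - chartMetric g p y u v ^ 2)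

end Ambient

/-! ### Maps into the ambient manifold -/

section Immersion

variable {n m : ℕ} {M : Type*} [TopologicalSpace M] [ChartedSpace (E n) M]
  {N : Type*} [TopologicalSpace N] [ChartedSpace (E m) N] [IsManifold (𝓡 m) ∞ N]

/-- Differential of `f : M → N` at `x`. -/
abbrev diff (n m : ℕ) {M : Type*} [TopologicalSpace M] [ChartedSpace (E n) M]
    {N : Type*} [TopologicalSpace N] [ChartedSpace (E m) N] (f : M → N) (x : M) :
    TangentSpace (𝓡 n) x →L[ℝ] TangentSpace (𝓡 m) (f x) :=
  mfderiv (𝓡 n) (𝓡 m) f x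

/-- `f` is a smooth immersion. -/
def IsSmoothImmersion (n m : ℕ) {M : Type*} [TopologicalSpace M] [ChartedSpace (E n) M]
    {N : Type*} [TopologicalSpace N] [ChartedSpace (E m) N] (f : M → N) : Prop :=
  ContMDiff (𝓡 n) (𝓡 m) ∞ f ∧ ∀ x, Function.Injective (diff n m f x)

/-- The induced metric (first fundamental form) `(u, v) ↦ g(df u, df v)` on `T_x M`. -/
def inducedForm (g : Metric m N) (f : M → N) (x : M) :
    TangentSpace (𝓡 n) x →L[ℝ] TangentSpace (𝓡 n) x →L[ℝ] ℝ :=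
  (ContinuousLinearMap.precomp ℝ (diff n m f x)).comp ((g.inner (f x)).comp (diff n m f x))

/-- Tangential part of `w ∈ T_{f x} N`: the vector `df a` such that
`g(df a, df u) = g(w, df u)` for all `u ∈ T_x M`. -/
def tangentialPart (g : Metric m N) (f : M → N) (x : M) (w : TangentSpace (𝓡 m) (f x)) :
    TangentSpace (𝓡 m) (f x) :=
  diff n m f x ((inducedForm g f x).inverse ((g.inner (f x) w).comp (diff n m f x)))

/-- Normal part `w^⊥` of `w ∈ T_{f x} N`. -/
def normalPart (g : Metric m N) (f : M → N) (x : M) (w : TangentSpace (𝓡 m) (f x)) :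
    TangentSpace (𝓡 m) (f x) :=
  w - tangentialPart (n := n) g f x w

/-- The (pull-back of the) Levi-Civita connection of `(N, g)` on vector fields along `f`:
`∇̄_u V` at `x`, which in the chart around `f x` reads `∂_u V + Γ(df u, V)`. -/
def covAlong (g : Metric m N) (f : M → N) (V : ∀ x : M, TangentSpace (𝓡 m) (f x)) (x : M)
    (u : TangentSpace (𝓡 n) x) : TangentSpace (𝓡 m) (f x) :=
  let dV : TangentSpace (𝓡 n) x →L[ℝ] E m :=
    mfderiv (𝓡 n) 𝓘(ℝ, E m) (fun x' => toChart m (f x) (f x') (V x')) x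
  (toChart m (f x) (f x)).inverse
    (dV u + christoffel (chartMetric g (f x)) (extChartAt (𝓡 m) (f x) (f x))
      (toChart m (f x) (f x) (diff n m f x u)) (toChart m (f x) (f x) (V x)))

/-- The second fundamental form `A(u, v) = -(∇̄_u (df Y))^⊥` at `x`, where `Y` is a local
extension of `v` to a vector field on `M` (the one which is constant in the chart around `x`). -/
def secondFundamentalForm [IsManifold (𝓡 n) ∞ M] (g : Metric m N) (f : M → N) (x : M)
    (u v : TangentSpace (𝓡 n) x) : TangentSpace (𝓡 m) (f x) :=
  -normalPart (n := n) g f x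
    (covAlong g f (fun x' => diff n m f x' (FiberBundle.extend (E n) v x')) x u)

/-- A vector field along `f` is normal and parallel for the normal connection `(∇̄ V)^⊥`. -/
def IsParallelNormalField (g : Metric m N) (f : M → N)
    (V : ∀ x : M, TangentSpace (𝓡 m) (f x)) : Prop :=
  (∀ x (u : TangentSpace (𝓡 n) x), g.inner (f x) (V x) (diff n m f x u) = 0) ∧
  MDifferentiable (𝓡 n) ((𝓡 m).prod 𝓘(ℝ, E m))
    (fun x => (⟨f x, V x⟩ : TangentBundle (𝓡 m) N)) ∧
  ∀ x (u : TangentSpace (𝓡 n) x), normalPart (n := n) g f x (covAlong g f V x u) = 0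

/-- `e` is an orthonormal frame of `T_x M` for the induced metric. -/
def IsOrthonormalFrame (g : Metric m N) (f : M → N) (x : M)
    (e : Fin n → TangentSpace (𝓡 n) x) : Prop :=
  ∀ i j, inducedForm g f x (e i) (e j) = if i = j then 1 else 0

/-- Orthonormal frames exist at every point of an immersed submanifold. -/
theorem exists_isOrthonormalFrame (g : Metric m N) (f : M → N) (x : M)
    (hf : Function.Injective (diff n m f x)) :
    ∃ e : Fin n → TangentSpace (𝓡 n) x, IsOrthonormalFrame g f x e := by
  let b : E n →L[ℝ] E n →L[ℝ] ℝ := inducedForm g f x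
  let B : LinearMap.BilinForm ℝ (E n) :=
    LinearMap.mk₂ ℝ (fun u v : E n => b u v)
      (by intros; simp) (by intros; simp) (by intros; simp) (by intros; simp)
  have hB : LinearMap.IsSymm B := ⟨fun u v => g.symm (f x) (diff n m f x u) (diff n m f x v)⟩
  have hpos : ∀ u : E n, u ≠ 0 → 0 < B u u := by
    intro u hu
    refine g.pos (f x) (diff n m f x u) fun h => hu (hf ?_)
    rw [h]
    exact (map_zero (diff n m f x)).symm
  obtain ⟨v, hv⟩ := LinearMap.BilinForm.exists_orthogonal_basis (K := ℝ) (V := E n) (B := B) hB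
  have hn : Module.finrank ℝ (E n) = n := by simp
  let w : Fin n → E n := fun i => v (Fin.cast hn.symm i)
  have hw0 : ∀ i, 0 < B (w i) (w i) := fun i => hpos _ (v.ne_zero _)
  refine ⟨fun i => ((Real.sqrt (B (w i) (w i)))⁻¹ • w i : E n), fun i j => ?_⟩
  change B ((Real.sqrt (B (w i) (w i)))⁻¹ • w i) ((Real.sqrt (B (w j) (w j)))⁻¹ • w j) = _
  rw [map_smul, map_smul, LinearMap.smul_apply]
  by_cases hij : i = j
  · subst hij
    have h1 := Real.mul_self_sqrt (hw0 i).le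
    have h2 := (Real.sqrt_pos.2 (hw0 i)).ne'
    simp only [smul_eq_mul, if_true]
    nth_rewrite 3 [← h1]
    field_simp
  · have h0 : B (w i) (w j) = 0 := hv (fun h => hij (Fin.cast_injective _ h))
    simp [h0, hij]

/-- A choice, at each point `x`, of an orthonormal frame of `T_x M` (with no continuity in `x`). -/
def orthoFrame (g : Metric m N) (f : M → N) (x : M) : Fin n → TangentSpace (𝓡 n) x :=
  Classical.epsilon (IsOrthonormalFrame g f x)

theorem orthoFrame_spec (g : Metric m N) (f : M → N) (x : M)
    (hf : Function.Injective (diff n m f x)) :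
    IsOrthonormalFrame g f x (orthoFrame (n := n) g f x) :=
  Classical.epsilon_spec (exists_isOrthonormalFrame g f x hf)

end Immersion

/-! ### The algebra of higher mean curvatures -/

section Algebra

variable {n : ℕ} {W : Type*} [AddCommGroup W] [Module ℝ W]

open Classical in
/-- The generalized Kronecker symbol `ε^{i_1 ⋯ i_r}_{j_1 ⋯ j_r}`: the sign of the permutation
taking `i` to `j` if the `i_k` are distinct and such a permutation exists, and zero otherwise. -/
def kronecker {r : ℕ} (i j : Fin r → Fin n) : ℝ :=
  if Function.Injective i then
    ∑ σ : Equiv.Perm (Fin r), if j = i ∘ σ then ((Equiv.Perm.sign σ : ℤ) : ℝ) else 0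
  else 0

/-- `h(a_{i_1 j_1}, a_{i_2 j_2}) ⋯ h(a_{i_{2q-1} j_{2q-1}}, a_{i_{2q} j_{2q}})`. -/
def pairProduct (h : W → W → ℝ) (a : Fin n → Fin n → W) {q : ℕ}
    (i j : Fin (2 * q) → Fin n) : ℝ :=
  ∏ k : Fin q,
    h (a (i ⟨2 * k, by omega⟩) (j ⟨2 * k, by omega⟩))
      (a (i ⟨2 * k + 1, by omega⟩) (j ⟨2 * k + 1, by omega⟩))

/-- `h(a_{i_1 j_1}, a_{i_2 j_2}) ⋯ h(a_{i_{2q-1} j_{2q-1}}, a_{i_{2q} j_{2q}}) a_{i_{2q+1} j_{2q+1}}`. -/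
def oddPairProduct (h : W → W → ℝ) (a : Fin n → Fin n → W) {q : ℕ}
    (i j : Fin (2 * q + 1) → Fin n) : W :=
  pairProduct h a (fun k => i k.castSucc) (fun k => j k.castSucc) •
    a (i (Fin.last (2 * q))) (j (Fin.last (2 * q)))

def evenH (h : W → W → ℝ) (a : Fin n → Fin n → W) (q : ℕ) : ℝ :=
  (1 / ((2 * q).factorial : ℝ)) *
    ∑ i : Fin (2 * q) → Fin n, ∑ j : Fin (2 * q) → Fin n, kronecker i j * pairProduct h a i j

def oddH (h : W → W → ℝ) (a : Fin n → Fin n → W) (q : ℕ) : W :=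
  (1 / ((2 * q + 1).factorial : ℝ)) •
    ∑ i : Fin (2 * q + 1) → Fin n, ∑ j : Fin (2 * q + 1) → Fin n,
      kronecker i j • oddPairProduct h a i j

/-- The component with upper index `s` and lower index `t`. -/
def evenT (h : W → W → ℝ) (a : Fin n → Fin n → W) (q : ℕ) (s t : Fin n) : ℝ :=
  (1 / ((2 * q).factorial : ℝ)) *
    ∑ i : Fin (2 * q) → Fin n, ∑ j : Fin (2 * q) → Fin n,
      kronecker (Fin.cons s i : Fin (2 * q + 1) → Fin n) (Fin.cons t j) * pairProduct h a i j

/-- The component with upper index `s` and lower index `t`. -/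
def oddT (h : W → W → ℝ) (a : Fin n → Fin n → W) (q : ℕ) (s t : Fin n) : W :=
  (1 / ((2 * q + 1).factorial : ℝ)) •
    ∑ i : Fin (2 * q + 1) → Fin n, ∑ j : Fin (2 * q + 1) → Fin n,
      kronecker (Fin.cons s i : Fin (2 * q + 1 + 1) → Fin n) (Fin.cons t j) •
        oddPairProduct h a i j

/-- `∑_{i_1 < ⋯ < i_r} k_{i_1} ⋯ k_{i_r}`. -/
def hyperH (k : Fin n → ℝ) (r : ℕ) : ℝ :=
  ∑ s ∈ Finset.powersetCard r Finset.univ, ∏ i ∈ s, k i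

/-- `∑ k_{i_1} ⋯ k_{i_r}` over `i_1 < ⋯ < i_r` all different from `i`. -/
def hyperT (k : Fin n → ℝ) (r : ℕ) (i : Fin n) : ℝ :=
  ∑ s ∈ Finset.powersetCard r (Finset.univ.erase i), ∏ l ∈ s, k l

end Algebra

/-! ### Higher mean curvatures and Newton transformations of an immersion -/

section Mean

variable {n m : ℕ} {M : Type*} [TopologicalSpace M] [ChartedSpace (E n) M]
  [IsManifold (𝓡 n) ∞ M]
  {N : Type*} [TopologicalSpace N] [ChartedSpace (E m) N] [IsManifold (𝓡 m) ∞ N]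

/-- The components `A_{ij} = A(e_i, e_j)` in an orthonormal frame at `x`. -/
def secondFormComponents (g : Metric m N) (f : M → N) (x : M) (i j : Fin n) :
    TangentSpace (𝓡 m) (f x) :=
  secondFundamentalForm g f x (orthoFrame g f x i) (orthoFrame g f x j)

/-- The `r`-th mean curvature for `r = 2q` even, a function. -/
def evenMeanCurvature (g : Metric m N) (f : M → N) (q : ℕ) (x : M) : ℝ :=
  evenH (fun v w => g.inner (f x) v w) (secondFormComponents (n := n) g f x) q

/-- The `r`-th mean curvature for `r = 2q + 1` odd, a normal vector field. -/
def oddMeanCurvature (g : Metric m N) (f : M → N) (q : ℕ) (x : M) :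
    TangentSpace (𝓡 m) (f x) :=
  oddH (fun v w => g.inner (f x) v w) (secondFormComponents (n := n) g f x) q

/-- The components in an orthonormal frame of the `r`-th Newton transformation, `r = 2q` even. -/
def evenNewton (g : Metric m N) (f : M → N) (q : ℕ) (x : M) (s t : Fin n) : ℝ :=
  evenT (fun v w => g.inner (f x) v w) (secondFormComponents (n := n) g f x) q s t

/-- The components in an orthonormal frame of the `r`-th Newton transformation, `r = 2q + 1` odd. -/
def oddNewton (g : Metric m N) (f : M → N) (q : ℕ) (x : M) (s t : Fin n) :
    TangentSpace (𝓡 m) (f x) :=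
  oddT (fun v w => g.inner (f x) v w) (secondFormComponents (n := n) g f x) q s t

/-- `ν` is a (continuous, globally defined) unit normal field along `f`. -/
def IsUnitNormalField (n : ℕ) {M : Type*} [TopologicalSpace M] [ChartedSpace (E n) M]
    (g : Metric m N) (f : M → N) (ν : ∀ x : M, TangentSpace (𝓡 m) (f x)) : Prop :=
  Continuous (fun x => (⟨f x, ν x⟩ : TangentBundle (𝓡 m) N)) ∧
  (∀ x, g.inner (f x) (ν x) (ν x) = 1) ∧
  ∀ x (u : TangentSpace (𝓡 n) x), g.inner (f x) (ν x) (diff n m f x u) = 0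

/-- `e` is an orthonormal frame at `x` of eigenvectors of the scalar second fundamental form
`g(A, ν)` and `k` are the corresponding eigenvalues (the principal curvatures). -/
def IsPrincipalFrame (g : Metric m N) (f : M → N) (ν : ∀ x : M, TangentSpace (𝓡 m) (f x))
    (x : M) (e : Fin n → TangentSpace (𝓡 n) x) (k : Fin n → ℝ) : Prop :=
  IsOrthonormalFrame g f x e ∧
  ∀ i j, g.inner (f x) (secondFundamentalForm g f x (e i) (e j)) (ν x) = if i = j then k i else 0

/-- A real function on `M` is parallel (its differential exists and vanishes), and hence takes one
value on each connected component of `M`. -/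
def IsParallelFunction (n : ℕ) {M : Type*} [TopologicalSpace M] [ChartedSpace (E n) M]
    (H : M → ℝ) : Prop :=
  (∀ x, HasMFDerivAt (𝓡 n) 𝓘(ℝ, ℝ) H x 0) ∧ ∀ x, ∀ y ∈ connectedComponent x, H x = H y

end Mean

end

end ImmersedSubmanifold

open ImmersedSubmanifold

/-!
The reason why `H_r` is parallel is that the Newton transformation `T^r` is divergence free when the
ambient curvature is constant. In components with respect to a frame that is parallel at a point,
the divergence of `T^r` is a sum of terms
`ε^{s i_1 ⋯ i_r}_{t j_1 ⋯ j_r} ⋯ (∇_s A)_{i_p j_p} ⋯`.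
The Codazzi equation makes `(∇_s A)_{i j}` symmetric in `s` and `i`, while `ε` is antisymmetric in
its upper indices, so each term cancels (`divergence_contractT`). If now `T^r = κ H I` with a
constant `κ ≠ 0`, the divergence of `T^r` is `κ ∇H`, so that `∇H = 0`. For `T^r = (n - r) / n H_r I`
the constant is not zero because `r < n`. That `H` is itself a contraction of `A` plays no role:
`T^r = κ H I` determines `H` and makes it differentiable.

The computation is done in charts, for an immersion `F` between normed spaces and a variable metric
`G` on the target (`IsImmersedOn`). The Codazzi equation (`IsImmersedOn.codazzi`) is the normal part
of the Ricci identity for the covariant Hessian `∇ dF`; the curvature term drops out because in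
constant curvature `R(u, v) w` is orthogonal to every vector orthogonal to `u` and `v`
(`IsMetricOn.curvature_orthogonal`), which follows by polarization from the hypothesis on sectional
curvatures. Instead of an orthonormal frame that is parallel at a point, a pair of dual frames is
used (`IsImmersedOn.exists_dual_frames`): the identity tensor has the components `δ` in it too
(`contractT_dual_frames`), and it is simpler to construct. Even and odd orders are then
`IsImmersedOn.hasFDerivAt_zero_of_even` and `IsImmersedOn.nor_covD_eq_zero_of_odd`; they differ only
in the multilinear map (`pairMap` or `oddPairMap`) applied to the components of `A`. The connection
and the second fundamental form of an immersed manifold agree with their expressions in any pair of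
charts (`toChart_covAlong`, `toChart_secondFundamentalForm`), which gives
`isParallelFunction_of_contractT_eq` and `isParallelNormalField_of_contractT_eq`.

For a hypersurface with unit normal `ν` one has `A = h(A, ν) ν`, which is diagonal in a principal
frame, and the contractions become elementary symmetric functions (`contractT_diagonal`). For even
`r` this is the even case above. For odd `r` the odd case shows that `H_r ν` is parallel, so its
length is locally constant; as `H_r` is continuous, it is locally constant
(`isParallelFunction_of_smul`).
-/

namespace ImmersedSubmanifold

open scoped Topology

set_option maxSynthPendingDepth 3

set_option linter.unusedSectionVars false

/-! ### The generalized Kronecker symbol and its contractions -/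

/-- The generalized Kronecker symbol is the determinant of the matrix `(δ_{i_p j_q})`. -/
theorem kronecker_eq_det {n r : ℕ} (i j : Fin r → Fin n) :
    kronecker i j = Matrix.det (Matrix.of fun p q => if j q = i p then (1 : ℝ) else 0) := by
  classical
  have key : Matrix.det (Matrix.of fun p q => if j q = i p then (1 : ℝ) else 0) =
      ∑ σ : Equiv.Perm (Fin r), if j = i ∘ σ then ((Equiv.Perm.sign σ : ℤ) : ℝ) else 0 := by
    rw [Matrix.det_apply']
    refine Finset.sum_congr rfl fun σ _ => ?_
    simp only [Matrix.of_apply, Finset.prod_ite_zero, Finset.prod_const_one, funext_iff,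
      Function.comp_apply, Finset.mem_univ, true_imp_iff, mul_ite, mul_one, mul_zero]
  unfold kronecker
  split_ifs with h
  · rw [key]
  · obtain ⟨p, q, hpq, hne⟩ : ∃ p q, i p = i q ∧ p ≠ q := by
      simpa [Function.Injective] using h
    rw [Matrix.det_zero_of_row_eq hne]
    ext k
    simp [hpq]

theorem kronecker_eq_sum {n r : ℕ} (i j : Fin r → Fin n) :
    kronecker i j = ∑ σ : Equiv.Perm (Fin r),
      ((Equiv.Perm.sign σ : ℤ) : ℝ) * ∏ p, if j p = i (σ p) then (1 : ℝ) else 0 := by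
  rw [kronecker_eq_det, Matrix.det_apply']
  rfl

theorem kronecker_comp_swap {n r : ℕ} (i j : Fin r → Fin n) {p q : Fin r} (h : p ≠ q) :
    kronecker (i ∘ Equiv.swap p q) j = -kronecker i j := by
  rw [kronecker_eq_det, kronecker_eq_det]
  have := Matrix.det_permute (Equiv.swap p q)
    (Matrix.of fun p q => if j q = i p then (1 : ℝ) else 0)
  rw [Equiv.Perm.sign_swap h] at this
  simpa [Matrix.submatrix, Function.comp_def] using this

/-- Contracting the Kronecker symbol with a matrix `P` on the upper and `Q` on the lower indices
gives it back when `P Qᵀ = 1`. -/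
theorem sum_kronecker_mul_prod {n r : ℕ} (P Q : Fin n → Fin n → ℝ)
    (hPQ : ∀ k l, ∑ i, P k i * Q l i = if k = l then 1 else 0) (k l : Fin r → Fin n) :
    ∑ i : Fin r → Fin n, ∑ j : Fin r → Fin n,
      kronecker i j * ((∏ p, P (k p) (i p)) * ∏ p, Q (l p) (j p)) = kronecker k l := by
  classical
  have h1 : ∀ (i : Fin r → Fin n) (σ : Equiv.Perm (Fin r)),
      (∑ j : Fin r → Fin n, (∏ p, if j p = i (σ p) then (1 : ℝ) else 0) * ∏ p, Q (l p) (j p)) =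
        ∏ p, Q (l p) (i (σ p)) := by
    intro i σ
    simp only [← Finset.prod_mul_distrib]
    rw [← Fintype.piFinset_univ, ← Finset.prod_univ_sum (fun _ => Finset.univ)
      (fun p x => (if x = i (σ p) then (1 : ℝ) else 0) * Q (l p) x)]
    simp
  calc _ = ∑ σ : Equiv.Perm (Fin r), ((Equiv.Perm.sign σ : ℤ) : ℝ) *
        ∑ i : Fin r → Fin n, ∏ p, (P (k (σ p)) (i (σ p)) * Q (l p) (i (σ p))) := by
        simp only [Finset.mul_sum]
        rw [Finset.sum_comm (γ := Equiv.Perm (Fin r))]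
        refine Finset.sum_congr rfl fun i _ => ?_
        simp only [kronecker_eq_sum, Finset.sum_mul]
        rw [Finset.sum_comm]
        refine Finset.sum_congr rfl fun σ _ => ?_
        rw [Finset.prod_mul_distrib, ← h1, Equiv.prod_comp σ (fun p => P (k p) (i p))]
        rw [Finset.mul_sum, Finset.mul_sum]
        refine Finset.sum_congr rfl fun j _ => ?_
        ring
    _ = _ := by
        rw [kronecker_eq_sum]
        refine Finset.sum_congr rfl fun σ _ => ?_
        congr 1
        have h2 : ∀ i : Fin r → Fin n, ∏ p, (P (k (σ p)) (i (σ p)) * Q (l p) (i (σ p))) =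
            ∏ p, (P (k p) (i p) * Q (l (σ.symm p)) (i p)) := by
          intro i
          rw [← Equiv.prod_comp σ (fun p => P (k p) (i p) * Q (l (σ.symm p)) (i p))]
          simp
        simp only [h2]
        rw [← Fintype.piFinset_univ, ← Finset.prod_univ_sum (fun _ => Finset.univ)
          (fun p x => P (k p) x * Q (l (σ.symm p)) x), ← Equiv.prod_comp σ]
        simp only [hPQ, Equiv.symm_apply_apply]
        refine Finset.prod_congr rfl fun p _ => ?_
        simp only [eq_comm]

section Contraction

variable {n r : ℕ} {W Z : Type*} [AddCommGroup W] [Module ℝ W] [AddCommGroup Z] [Module ℝ Z]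

/-- The contraction `∑ ε^{s i_1 ⋯ i_r}_{t j_1 ⋯ j_r} Φ(a_{i_1 j_1}, …, a_{i_r j_r})` with the index
`s` and the index `t` left free: up to a factor `r!`, the Newton transformation of `a` when `Φ` is
`pairMap` or `oddPairMap`. -/
noncomputable def contractT (Φ : MultilinearMap ℝ (fun _ : Fin r => W) Z)
    (a : Fin n → Fin n → W) (s t : Fin n) : Z :=
  ∑ i : Fin r → Fin n, ∑ j : Fin r → Fin n,
    kronecker (Fin.cons s i : Fin (r + 1) → Fin n) (Fin.cons t j) • Φ fun p => a (i p) (j p)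

theorem multilinear_sum_smul (Φ : MultilinearMap ℝ (fun _ : Fin r => W) Z)
    (a : Fin n → Fin n → W) (x y : Fin r → Fin n → ℝ) :
    (Φ fun p => ∑ i, ∑ j, (x p i * y p j) • a i j) =
      ∑ i : Fin r → Fin n, ∑ j : Fin r → Fin n,
        ((∏ p, x p (i p)) * ∏ p, y p (j p)) • Φ fun p => a (i p) (j p) := by
  classical
  rw [Φ.map_sum]
  refine Finset.sum_congr rfl fun i _ => ?_
  rw [Φ.map_sum]
  refine Finset.sum_congr rfl fun j _ => ?_
  rw [Φ.map_smul_univ, Finset.prod_mul_distrib]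

/-- Invariance of the contraction under a change of frame: the lower indices of `a` transform with
`P` and `Q`, the free indices of `contractT` with the inverse, which is again given by `P` and `Q`
because `P Qᵀ = 1`. -/
theorem contractT_change (Φ : MultilinearMap ℝ (fun _ : Fin r => W) Z)
    (a a' : Fin n → Fin n → W) (P Q : Fin n → Fin n → ℝ)
    (hPQ : ∀ k l, ∑ i, P k i * Q l i = if k = l then 1 else 0)
    (ha : ∀ i j, a i j = ∑ k, ∑ l, (P k i * Q l j) • a' k l) (u v : Fin n) :
    contractT Φ a' u v = ∑ s, ∑ t, (P u s * Q v t) • contractT Φ a s t := by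
  unfold contractT
  have hrw : ∀ (s t : Fin n) (i j : Fin r → Fin n),
      (P u s * Q v t) • (kronecker (Fin.cons s i : Fin (r + 1) → Fin n) (Fin.cons t j) •
        Φ fun p => a (i p) (j p)) =
      ∑ k : Fin r → Fin n, ∑ l : Fin r → Fin n,
        (kronecker (Fin.cons s i : Fin (r + 1) → Fin n) (Fin.cons t j) *
          ((∏ p, P ((Fin.cons u k : Fin (r + 1) → Fin n) p)
              ((Fin.cons s i : Fin (r + 1) → Fin n) p)) *
            ∏ p, Q ((Fin.cons v l : Fin (r + 1) → Fin n) p)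
              ((Fin.cons t j : Fin (r + 1) → Fin n) p))) •
          Φ fun p => a' (k p) (l p) := by
    intro s t i j
    simp only [ha]
    rw [multilinear_sum_smul Φ a' (fun p k => P k (i p)) (fun p l => Q l (j p))]
    simp only [Finset.smul_sum, smul_smul]
    refine Finset.sum_congr rfl fun k _ => Finset.sum_congr rfl fun l _ => ?_
    congr 1
    rw [Fin.prod_univ_succ, Fin.prod_univ_succ]
    simp only [Fin.cons_zero, Fin.cons_succ]
    ring
  simp only [Finset.smul_sum, hrw]
  symm
  calc _ = ∑ k : Fin r → Fin n, ∑ l : Fin r → Fin n,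
        (∑ I : Fin (r + 1) → Fin n, ∑ J : Fin (r + 1) → Fin n,
          kronecker I J * ((∏ p, P ((Fin.cons u k : Fin (r + 1) → Fin n) p) (I p)) *
            ∏ p, Q ((Fin.cons v l : Fin (r + 1) → Fin n) p) (J p))) •
            Φ fun p => a' (k p) (l p) := by
        have e := fun (f : (Fin (r + 1) → Fin n) → Z) =>
          (Equiv.sum_comp (Fin.consEquiv fun _ : Fin (r + 1) => Fin n) f).symm.trans
            (Fintype.sum_prod_type _)
        have e' : ∀ f : (Fin (r + 1) → Fin n) → Z,
            ∑ I, f I = ∑ s : Fin n, ∑ i : Fin r → Fin n, f (Fin.cons s i) := e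
        have e2 : ∀ g : (Fin (r + 1) → Fin n) → (Fin (r + 1) → Fin n) → Z,
            ∑ I, ∑ J, g I J = ∑ s : Fin n, ∑ t : Fin n, ∑ i : Fin r → Fin n, ∑ j : Fin r → Fin n,
              g (Fin.cons s i) (Fin.cons t j) := by
          intro g
          simp only [e']
          exact Finset.sum_congr rfl fun s _ => Finset.sum_comm
        rw [← e2 fun I J => ∑ k : Fin r → Fin n, ∑ l : Fin r → Fin n,
          (kronecker I J * ((∏ p, P ((Fin.cons u k : Fin (r + 1) → Fin n) p) (I p)) *
            ∏ p, Q ((Fin.cons v l : Fin (r + 1) → Fin n) p) (J p))) • Φ fun p => a' (k p) (l p)]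
        simp only [Finset.sum_smul]
        rw [Finset.sum_comm_cycle]
        refine Finset.sum_congr rfl fun k _ => ?_
        rw [Finset.sum_comm_cycle]
    _ = _ := by
        refine Finset.sum_congr rfl fun k _ => Finset.sum_congr rfl fun l _ => ?_
        rw [sum_kronecker_mul_prod P Q hPQ]

/-- A divergence built from the Kronecker symbol vanishes: if the derivatives `b s i j` of the
components `a i j` in direction `s` are symmetric in `s` and `i`, then exchanging the free index
`s` with the index `i_p` of the differentiated factor changes the sign of each term. -/
theorem divergence_contractT (Φ : MultilinearMap ℝ (fun _ : Fin r => W) Z)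
    (a : Fin n → Fin n → W) (b : Fin n → Fin n → Fin n → W)
    (hb : ∀ s i j, b s i j = b i s j) (t : Fin n) :
    ∑ s : Fin n, ∑ i : Fin r → Fin n, ∑ j : Fin r → Fin n,
      kronecker (Fin.cons s i : Fin (r + 1) → Fin n) (Fin.cons t j) •
        ∑ p : Fin r, Φ (Function.update (fun q => a (i q) (j q)) p (b s (i p) (j p))) = 0 := by
  classical
  have e : ∀ f : (Fin (r + 1) → Fin n) → Z,
      ∑ I, f I = ∑ s : Fin n, ∑ i : Fin r → Fin n, f (Fin.cons s i) := fun f =>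
    (Equiv.sum_comp (Fin.consEquiv fun _ : Fin (r + 1) => Fin n) f).symm.trans
      (Fintype.sum_prod_type _)
  let f : Fin r → (Fin r → Fin n) → (Fin (r + 1) → Fin n) → Z := fun p j I =>
    kronecker I (Fin.cons t j) •
      Φ (Function.update (fun q => a (I q.succ) (j q)) p (b (I 0) (I p.succ) (j p)))
  have hf : ∀ p j, ∑ I, f p j I = 0 := by
    intro p j
    have hswap : ∀ I, f p j (I ∘ Equiv.swap 0 p.succ) = -f p j I := by
      intro I
      simp only [f]
      rw [kronecker_comp_swap I _ (Fin.succ_ne_zero p).symm, neg_smul]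
      congr 3
      funext q
      by_cases hq : q = p
      · subst hq
        simp [hb (I 0)]
      · have : Equiv.swap 0 p.succ q.succ = q.succ :=
          Equiv.swap_apply_of_ne_of_ne (Fin.succ_ne_zero q) (fun h => hq (Fin.succ_injective _ h))
        simp [hq, this]
    have h2 : ∑ I, f p j I = -∑ I, f p j I := by
      rw [← Finset.sum_neg_distrib]
      simp only [← hswap]
      exact (Equiv.sum_comp (Equiv.arrowCongr (Equiv.swap 0 p.succ) (Equiv.refl (Fin n)))
        (f p j)).symm
    have h3 : (2 : ℝ) • ∑ I, f p j I = 0 := by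
      rw [two_smul]
      exact eq_neg_iff_add_eq_zero.1 h2
    exact (smul_eq_zero.1 h3).resolve_left two_ne_zero
  calc _ = ∑ p, ∑ j, ∑ I, f p j I := by
        simp only [e, f, Fin.cons_zero, Fin.cons_succ, Finset.smul_sum]
        refine (Finset.sum_congr rfl fun s _ => Finset.sum_congr rfl fun i _ =>
          Finset.sum_comm).trans ?_
        rw [Finset.sum_comm_cycle]
        refine Finset.sum_congr rfl fun p _ => ?_
        rw [Finset.sum_comm_cycle]
    _ = 0 := by simp [hf]

end Contraction

/-! ### Products of pairings as multilinear maps -/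

section PairMap

variable {W : Type*} [AddCommGroup W] [Module ℝ W]

/-- The multilinear map `(w_1, …, w_{2q}) ↦ h(w_1, w_2) ⋯ h(w_{2q-1}, w_{2q})`. -/
noncomputable def pairMap (h : W →ₗ[ℝ] W →ₗ[ℝ] ℝ) (q : ℕ) :
    MultilinearMap ℝ (fun _ : Fin (2 * q) => W) ℝ where
  toFun w := ∏ k : Fin q, h (w ⟨2 * k, by omega⟩) (w ⟨2 * k + 1, by omega⟩)
  map_update_add' := by
    intro inst w p x y
    obtain rfl : inst = instDecidableEqFin (2 * q) := Subsingleton.elim _ _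
    have hk : (p : ℕ) / 2 < q := by omega
    -- Only the factor with index `p / 2` involves `w p`.
    simp only [Fintype.prod_eq_mul_prod_compl (⟨p / 2, hk⟩ : Fin q)]
    have hrest : ∀ z : W, ∀ k ∈ ({⟨p / 2, hk⟩} : Finset (Fin q))ᶜ,
        h (Function.update w p z ⟨2 * k, by omega⟩) (Function.update w p z ⟨2 * k + 1, by omega⟩) =
          h (w ⟨2 * k, by omega⟩) (w ⟨2 * k + 1, by omega⟩) := by
      intro z k hkp
      have : (k : ℕ) ≠ p / 2 := by simpa [Fin.ext_iff] using hkp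
      rw [Function.update_of_ne (by simp only [ne_eq, Fin.ext_iff]; omega),
        Function.update_of_ne (by simp only [ne_eq, Fin.ext_iff]; omega)]
    rw [Finset.prod_congr rfl (hrest _), Finset.prod_congr rfl (hrest _),
      Finset.prod_congr rfl (hrest _), ← add_mul]
    congr 1
    rcases Nat.mod_two_eq_zero_or_one p with h0 | h1
    · have e1 : (⟨2 * (p / 2), by omega⟩ : Fin (2 * q)) = p := Fin.ext (by dsimp only; omega)
      have e2 : (⟨2 * (p / 2) + 1, by omega⟩ : Fin (2 * q)) ≠ p := by
        simp only [ne_eq, Fin.ext_iff]; omega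
      simp only [e1, Function.update_self, Function.update_of_ne e2, map_add, LinearMap.add_apply]
    · have e1 : (⟨2 * (p / 2) + 1, by omega⟩ : Fin (2 * q)) = p := Fin.ext (by dsimp only; omega)
      have e2 : (⟨2 * (p / 2), by omega⟩ : Fin (2 * q)) ≠ p := by
        simp only [ne_eq, Fin.ext_iff]; omega
      simp only [e1, Function.update_self, Function.update_of_ne e2, map_add]
  map_update_smul' := by
    intro inst w p c x
    obtain rfl : inst = instDecidableEqFin (2 * q) := Subsingleton.elim _ _
    have hk : (p : ℕ) / 2 < q := by omega
    simp only [Fintype.prod_eq_mul_prod_compl (⟨p / 2, hk⟩ : Fin q)]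
    have hrest : ∀ z : W, ∀ k ∈ ({⟨p / 2, hk⟩} : Finset (Fin q))ᶜ,
        h (Function.update w p z ⟨2 * k, by omega⟩) (Function.update w p z ⟨2 * k + 1, by omega⟩) =
          h (w ⟨2 * k, by omega⟩) (w ⟨2 * k + 1, by omega⟩) := by
      intro z k hkp
      have : (k : ℕ) ≠ p / 2 := by simpa [Fin.ext_iff] using hkp
      rw [Function.update_of_ne (by simp only [ne_eq, Fin.ext_iff]; omega),
        Function.update_of_ne (by simp only [ne_eq, Fin.ext_iff]; omega)]
    rw [Finset.prod_congr rfl (hrest _), Finset.prod_congr rfl (hrest _), smul_eq_mul, ← mul_assoc]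
    congr 1
    rcases Nat.mod_two_eq_zero_or_one p with h0 | h1
    · have e1 : (⟨2 * (p / 2), by omega⟩ : Fin (2 * q)) = p := Fin.ext (by dsimp only; omega)
      have e2 : (⟨2 * (p / 2) + 1, by omega⟩ : Fin (2 * q)) ≠ p := by
        simp only [ne_eq, Fin.ext_iff]; omega
      simp only [e1, Function.update_self, Function.update_of_ne e2, map_smul,
        LinearMap.smul_apply, smul_eq_mul]
    · have e1 : (⟨2 * (p / 2) + 1, by omega⟩ : Fin (2 * q)) = p := Fin.ext (by dsimp only; omega)
      have e2 : (⟨2 * (p / 2), by omega⟩ : Fin (2 * q)) ≠ p := by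
        simp only [ne_eq, Fin.ext_iff]; omega
      simp only [e1, Function.update_self, Function.update_of_ne e2, map_smul, smul_eq_mul]

theorem pairMap_apply (h : W →ₗ[ℝ] W →ₗ[ℝ] ℝ) (q : ℕ) (w : Fin (2 * q) → W) :
    pairMap h q w = ∏ k : Fin q, h (w ⟨2 * k, by omega⟩) (w ⟨2 * k + 1, by omega⟩) := rfl

/-- The multilinear map `(w_1, …, w_{2q+1}) ↦ h(w_1, w_2) ⋯ h(w_{2q-1}, w_{2q}) w_{2q+1}`. -/
noncomputable def oddPairMap (h : W →ₗ[ℝ] W →ₗ[ℝ] ℝ) (q : ℕ) :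
    MultilinearMap ℝ (fun _ : Fin (2 * q + 1) => W) W where
  toFun w := pairMap h q (fun p => w p.castSucc) • w (Fin.last (2 * q))
  map_update_add' := by
    intro inst w p x y
    obtain rfl : inst = instDecidableEqFin (2 * q + 1) := Subsingleton.elim _ _
    have hinit : ∀ (p : Fin (2 * q)) (z : W),
        (fun p' : Fin (2 * q) => Function.update w p.castSucc z p'.castSucc) =
          Function.update (fun p' => w p'.castSucc) p z := fun p z =>
      Function.update_comp_eq_of_injective w (Fin.castSucc_injective _) p z
    induction p using Fin.lastCases with
    | last => simp
    | cast p =>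
      simp only [hinit, MultilinearMap.map_update_add, add_smul,
        Function.update_of_ne (Fin.castSucc_lt_last p).ne']
  map_update_smul' := by
    intro inst w p c x
    obtain rfl : inst = instDecidableEqFin (2 * q + 1) := Subsingleton.elim _ _
    have hinit : ∀ (p : Fin (2 * q)) (z : W),
        (fun p' : Fin (2 * q) => Function.update w p.castSucc z p'.castSucc) =
          Function.update (fun p' => w p'.castSucc) p z := fun p z =>
      Function.update_comp_eq_of_injective w (Fin.castSucc_injective _) p z
    induction p using Fin.lastCases with
    | last => simp [smul_comm c]
    | cast p =>
      simp only [hinit, MultilinearMap.map_update_smul, smul_assoc,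
        Function.update_of_ne (Fin.castSucc_lt_last p).ne']

theorem oddPairMap_apply (h : W →ₗ[ℝ] W →ₗ[ℝ] ℝ) (q : ℕ) (w : Fin (2 * q + 1) → W) :
    oddPairMap h q w = pairMap h q (fun p => w p.castSucc) • w (Fin.last (2 * q)) := rfl

theorem sum_fin_two_mul {q : ℕ} (f : Fin (2 * q) → ℝ) :
    ∑ p, f p = ∑ k : Fin q, (f ⟨2 * k, by omega⟩ + f ⟨2 * k + 1, by omega⟩) := by
  rw [← Equiv.sum_comp (finProdFinEquiv.trans (finCongr (mul_comm q 2))) f,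
    Fintype.sum_prod_type]
  refine Finset.sum_congr rfl fun k _ => ?_
  rw [Fin.sum_univ_two]
  congr 2
  · simp [Fin.ext_iff]
  · simp [Fin.ext_iff, add_comm]

/-- The derivative of a product of pairings, arranged by pairs. -/
theorem sum_pairMap_update (h : W →ₗ[ℝ] W →ₗ[ℝ] ℝ) (q : ℕ) (w c : Fin (2 * q) → W) :
    ∑ p, pairMap h q (Function.update w p (c p)) =
      ∑ k : Fin q,
        (∏ l ∈ Finset.univ.erase k, h (w ⟨2 * l, by omega⟩) (w ⟨2 * l + 1, by omega⟩)) *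
          (h (c ⟨2 * k, by omega⟩) (w ⟨2 * k + 1, by omega⟩) +
            h (w ⟨2 * k, by omega⟩) (c ⟨2 * k + 1, by omega⟩)) := by
  rw [sum_fin_two_mul]
  refine Finset.sum_congr rfl fun k _ => ?_
  have hrest : ∀ (p : Fin (2 * q)) (z : W), (p : ℕ) / 2 = k → ∀ l ∈ Finset.univ.erase k,
      h (Function.update w p z ⟨2 * l, by omega⟩) (Function.update w p z ⟨2 * l + 1, by omega⟩) =
        h (w ⟨2 * l, by omega⟩) (w ⟨2 * l + 1, by omega⟩) := by
    intro p z hp l hl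
    have : (l : ℕ) ≠ k := by simpa [Fin.ext_iff] using hl
    rw [Function.update_of_ne (by simp only [ne_eq, Fin.ext_iff]; omega),
      Function.update_of_ne (by simp only [ne_eq, Fin.ext_iff]; omega)]
  rw [pairMap_apply, pairMap_apply, ← Finset.prod_erase_mul _ _ (Finset.mem_univ k),
    ← Finset.prod_erase_mul _ _ (Finset.mem_univ k),
    Finset.prod_congr rfl (hrest _ _ (by dsimp only; omega)),
    Finset.prod_congr rfl (hrest _ _ (by dsimp only; omega)), ← mul_add]
  congr 2
  · rw [Function.update_self, Function.update_of_ne (by simp [Fin.ext_iff])]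
  · rw [Function.update_self, Function.update_of_ne (by simp [Fin.ext_iff])]

theorem sum_oddPairMap_update (h : W →ₗ[ℝ] W →ₗ[ℝ] ℝ) (q : ℕ) (w c : Fin (2 * q + 1) → W) :
    ∑ p, oddPairMap h q (Function.update w p (c p)) =
      (∑ p : Fin (2 * q), pairMap h q (Function.update (fun p => w p.castSucc) p (c p.castSucc))) •
        w (Fin.last (2 * q)) +
      pairMap h q (fun p => w p.castSucc) • c (Fin.last (2 * q)) := by
  rw [Fin.sum_univ_castSucc, Finset.sum_smul]
  congr 1
  · refine Finset.sum_congr rfl fun p _ => ?_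
    rw [oddPairMap_apply, Function.update_of_ne (Fin.castSucc_lt_last p).ne']
    congr 2
    exact Function.update_comp_eq_of_injective w (Fin.castSucc_injective _) p _
  · rw [oddPairMap_apply, Function.update_self]
    congr 2
    funext p
    rw [Function.update_of_ne (Fin.castSucc_lt_last p).ne]

end PairMap

/-! ### Diagonal second fundamental forms -/

section Diagonal

theorem kronecker_self {n r : ℕ} (i : Fin r → Fin n) [Decidable (Function.Injective i)] :
    kronecker i i = if Function.Injective i then 1 else 0 := by
  split_ifs with h
  · rw [kronecker_eq_det, ← Matrix.det_one (n := Fin r)]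
    congr 1
    ext p q
    simp [Matrix.one_apply, h.eq_iff, eq_comm]
  · simp [kronecker, h]

theorem kronecker_cons_cons_of_ne {n r : ℕ} (i : Fin r → Fin n) {s t : Fin n} (hst : s ≠ t) :
    kronecker (Fin.cons s i : Fin (r + 1) → Fin n) (Fin.cons t i) = 0 := by
  unfold kronecker
  split_ifs with h
  · refine Finset.sum_eq_zero fun σ _ => if_neg fun hσ => ?_
    have hJ : Function.Injective (Fin.cons t i : Fin (r + 1) → Fin n) := by
      rw [hσ]
      exact h.comp σ.injective
    have h0 := congrFun hσ 0
    rcases Fin.eq_zero_or_eq_succ (σ 0) with h1 | ⟨p, h1⟩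
    · simp only [Function.comp_apply, h1, Fin.cons_zero] at h0
      exact hst h0.symm
    · simp only [Function.comp_apply, h1, Fin.cons_zero, Fin.cons_succ] at h0
      exact Fin.succ_ne_zero p (hJ (a₁ := p.succ) (a₂ := 0) (by simp [h0]))
  · rfl

open Classical in
/-- Each `r`-element subset of `S` is the image of `r!` injective sequences. -/
theorem sum_injective_prod {n : ℕ} (r : ℕ) (k : Fin n → ℝ) (S : Finset (Fin n)) :
    (∑ i : Fin r → Fin n, if Function.Injective i ∧ ∀ p, i p ∈ S then ∏ p, k (i p) else 0) =
      (r.factorial : ℝ) * ∑ s ∈ Finset.powersetCard r S, ∏ l ∈ s, k l := by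
  rw [← Finset.sum_filter, Finset.mul_sum]
  rw [← Finset.sum_fiberwise_of_maps_to (t := Finset.powersetCard r S)
    (g := fun i : Fin r → Fin n => Finset.univ.image i)]
  · refine Finset.sum_congr rfl fun s hs => ?_
    rw [Finset.mem_powersetCard] at hs
    rw [Finset.sum_congr rfl (g := fun _ => ∏ l ∈ s, k l), Finset.sum_const, nsmul_eq_mul]
    · congr 2
      have hcard : Fintype.card (Fin r ≃ s) = r.factorial := by
        rw [Fintype.card_equiv (Finset.equivFinOfCardEq hs.2).symm, Fintype.card_fin]
      rw [← hcard, ← Finset.card_univ]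
      symm
      refine Finset.card_bij (fun σ _ p => (σ p : Fin n)) ?_ ?_ ?_
      · intro σ _
        simp only [Finset.mem_filter, Finset.mem_univ, true_and]
        refine ⟨⟨Subtype.val_injective.comp σ.injective, fun p => hs.1 (σ p).2⟩, ?_⟩
        ext x
        simp only [Finset.mem_image, Finset.mem_univ, true_and]
        exact ⟨fun ⟨p, hp⟩ => hp ▸ (σ p).2, fun hx => ⟨σ.symm ⟨x, hx⟩, by simp⟩⟩
      · intro σ _ τ _ h
        ext p
        exact congrArg Fin.val (congrFun h p)
      · intro i hi
        simp only [Finset.mem_filter, Finset.mem_univ, true_and] at hi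
        have hmem : ∀ p, i p ∈ s := fun p => hi.2 ▸ Finset.mem_image_of_mem i (Finset.mem_univ p)
        have hbij : Function.Bijective fun p => (⟨i p, hmem p⟩ : s) := by
          refine ⟨fun p p' h => hi.1.1 (congrArg Subtype.val h), fun x => ?_⟩
          have hx : (x : Fin n) ∈ Finset.univ.image i := by
            rw [hi.2]
            exact x.2
          obtain ⟨p, _, hp⟩ := Finset.mem_image.1 hx
          exact ⟨p, Subtype.ext hp⟩
        exact ⟨Equiv.ofBijective _ hbij, Finset.mem_univ _, rfl⟩
    · intro i hi
      simp only [Finset.mem_filter, Finset.mem_univ, true_and] at hi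
      rw [← hi.2, Finset.prod_image hi.1.1.injOn]
  · intro i hi
    simp only [Finset.mem_filter, Finset.mem_univ, true_and] at hi
    rw [Finset.mem_powersetCard]
    refine ⟨fun x hx => ?_, ?_⟩
    · obtain ⟨p, _, rfl⟩ := Finset.mem_image.1 hx
      exact hi.2 p
    · rw [Finset.card_image_of_injective _ hi.1, Finset.card_univ, Fintype.card_fin]

variable {n r : ℕ} {W Z : Type*} [AddCommGroup W] [Module ℝ W] [AddCommGroup Z] [Module ℝ Z]

theorem contractT_diagonal (Φ : MultilinearMap ℝ (fun _ : Fin r => W) Z) (k : Fin n → ℝ) (ν : W)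
    (s t : Fin n) :
    contractT Φ (fun i j => (if i = j then k i else 0) • ν) s t =
      ((if s = t then 1 else 0) * ((r.factorial : ℝ) * hyperT k r s)) • Φ fun _ => ν := by
  classical
  rw [hyperT, ← sum_injective_prod, Finset.mul_sum, Finset.sum_smul]
  unfold contractT
  refine Finset.sum_congr rfl fun i _ => ?_
  simp only [Φ.map_smul_univ]
  rw [Finset.sum_eq_single i]
  · by_cases hst : s = t
    · subst hst
      simp [kronecker_self, smul_smul, Fin.cons_injective_iff, eq_comm, and_comm]
    · simp [hst, kronecker_cons_cons_of_ne i hst]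
  · intro j _ hj
    obtain ⟨p, hp⟩ := Function.ne_iff.1 hj
    rw [Finset.prod_eq_zero (Finset.mem_univ p) (if_neg hp.symm), zero_smul, smul_zero]
  · simp

end Diagonal

/-! ### Riemannian metrics on open subsets of a vector space -/

section Metric

variable {X : Type*} [NormedAddCommGroup X] [NormedSpace ℝ X]

/-- A positive definite form on a finite-dimensional space is non-degenerate. -/
theorem isInvertible_of_pos [FiniteDimensional ℝ X] {b : X →L[ℝ] X →L[ℝ] ℝ}
    (hb : ∀ v, v ≠ 0 → 0 < b v v) : b.IsInvertible := by
  have hinj : Function.Injective (b : X →ₗ[ℝ] (X →L[ℝ] ℝ)) := by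
    rw [← LinearMap.ker_eq_bot, LinearMap.ker_eq_bot']
    intro v hv
    by_contra hne
    have h1 := hb v hne
    have h2 : b v = 0 := hv
    simp [h2] at h1
  have hdim : Module.finrank ℝ X = Module.finrank ℝ (X →L[ℝ] ℝ) := by
    rw [← LinearEquiv.finrank_eq
      (LinearMap.toContinuousLinearMap : (X →ₗ[ℝ] ℝ) ≃ₗ[ℝ] (X →L[ℝ] ℝ))]
    exact (Subspace.dual_finrank_eq (K := ℝ) (V := X)).symm
  exact ⟨(LinearEquiv.ofInjectiveOfFinrankEq (b : X →ₗ[ℝ] (X →L[ℝ] ℝ)) hinj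
    hdim).toContinuousLinearEquiv, rfl⟩

/-- `G` is a smooth Riemannian metric on the open set `V ⊆ X`. -/
structure IsMetricOn (G : X → X →L[ℝ] X →L[ℝ] ℝ) (V : Set X) : Prop where
  isOpen : IsOpen V
  contDiffOn : ContDiffOn ℝ ∞ G V
  symm : ∀ z ∈ V, ∀ v w, G z v w = G z w v
  pos : ∀ z ∈ V, ∀ v, v ≠ 0 → 0 < G z v v

/-- The Christoffel symbols at `z` as a bilinear map. -/
noncomputable def christoffelL (G : X → X →L[ℝ] X →L[ℝ] ℝ) (z : X) : X →L[ℝ] X →L[ℝ] X :=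
  (1 / 2 : ℝ) • (ContinuousLinearMap.compL ℝ X (X →L[ℝ] ℝ) X (G z).inverse).comp
    (fderiv ℝ G z + (fderiv ℝ G z).flip -
      ((ContinuousLinearMap.flipₗᵢ ℝ X X ℝ).toContinuousLinearEquiv.toContinuousLinearMap).comp
        (fderiv ℝ G z).flip)

theorem christoffelL_apply (G : X → X →L[ℝ] X →L[ℝ] ℝ) (z v w : X) :
    christoffelL G z v w = (G z).inverse ((1 / 2 : ℝ) •
      (fderiv ℝ G z v w + fderiv ℝ G z w v - ((fderiv ℝ G z).flip v).flip w)) := by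
  rw [map_smul]
  rfl

theorem christoffel_eq {m : ℕ} (G : E m → E m →L[ℝ] E m →L[ℝ] ℝ) (z v w : E m) :
    christoffel G z v w = christoffelL G z v w := (christoffelL_apply G z v w).symm

/-- The curvature tensor of the metric `G` on a normed space, in terms of `christoffelL`. -/
noncomputable def curvatureL (G : X → X →L[ℝ] X →L[ℝ] ℝ) (z u v w : X) : X :=
  fderiv ℝ (christoffelL G) z u v w - fderiv ℝ (christoffelL G) z v u w
    + christoffelL G z u (christoffelL G z v w) - christoffelL G z v (christoffelL G z u w)

theorem curvatureL_antisymm (G : X → X →L[ℝ] X →L[ℝ] ℝ) (z u v w : X) :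
    curvatureL G z u v w = -curvatureL G z v u w := by
  simp only [curvatureL]
  abel

variable {G : X → X →L[ℝ] X →L[ℝ] ℝ} {V : Set X}

namespace IsMetricOn

theorem contDiffAt (hG : IsMetricOn G V) {z : X} (hz : z ∈ V) : ContDiffAt ℝ ∞ G z :=
  hG.contDiffOn.contDiffAt (hG.isOpen.mem_nhds hz)

theorem differentiableAt (hG : IsMetricOn G V) {z : X} (hz : z ∈ V) :
    DifferentiableAt ℝ G z :=
  (hG.contDiffAt hz).differentiableAt (by simp)

theorem fderiv_symm (hG : IsMetricOn G V) {z : X} (hz : z ∈ V) (u v w : X) :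
    fderiv ℝ G z u v w = fderiv ℝ G z u w v := by
  have h1 : ∀ a b : X, HasFDerivAt (fun z => G z a b)
      (((fderiv ℝ G z).flip a).flip b) z := by
    intro a b
    have := ((hG.differentiableAt hz).hasFDerivAt.clm_apply (hasFDerivAt_const a z)).clm_apply
      (hasFDerivAt_const b z)
    simpa using this
  have h2 : (fun z => G z v w) =ᶠ[nhds z] fun z => G z w v := by
    filter_upwards [hG.isOpen.mem_nhds hz] with z' hz' using hG.symm z' hz' v w
  exact congrArg (fun L => L u) ((h1 v w).unique ((h1 w v).congr_of_eventuallyEq h2))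

variable [FiniteDimensional ℝ X]

theorem isInvertible (hG : IsMetricOn G V) {z : X} (hz : z ∈ V) : (G z).IsInvertible :=
  isInvertible_of_pos (hG.pos z hz)

theorem ext (hG : IsMetricOn G V) {z : X} (hz : z ∈ V) {v w : X}
    (h : ∀ x, G z v x = G z w x) : v = w :=
  (hG.isInvertible hz).injective (ContinuousLinearMap.ext h)

theorem christoffel_spec (hG : IsMetricOn G V) {z : X} (hz : z ∈ V) (v w x : X) :
    G z (christoffelL G z v w) x =
      (1 / 2 : ℝ) * (fderiv ℝ G z v w x + fderiv ℝ G z w v x - fderiv ℝ G z x v w) := by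
  rw [christoffelL_apply, (hG.isInvertible hz).self_apply_inverse]
  rfl

theorem christoffelL_symm (hG : IsMetricOn G V) {z : X} (hz : z ∈ V) (v w : X) :
    christoffelL G z v w = christoffelL G z w v := by
  refine hG.ext hz fun x => ?_
  rw [hG.christoffel_spec hz, hG.christoffel_spec hz, hG.fderiv_symm hz x]
  ring

/-- The Levi-Civita connection is metric. -/
theorem fderiv_eq (hG : IsMetricOn G V) {z : X} (hz : z ∈ V) (u v w : X) :
    fderiv ℝ G z u v w = G z (christoffelL G z u v) w + G z v (christoffelL G z u w) := by
  rw [hG.symm z hz v, hG.christoffel_spec hz, hG.christoffel_spec hz, hG.fderiv_symm hz u w v]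
  ring

theorem contDiffOn_christoffelL (hG : IsMetricOn G V) : ContDiffOn ℝ ∞ (christoffelL G) V := by
  have hD : ContDiffOn ℝ ∞ (fderiv ℝ G) V :=
    hG.contDiffOn.fderiv_of_isOpen hG.isOpen (by simp)
  have hinv : ContDiffOn ℝ ∞ (fun z => (G z).inverse) V := by
    intro z hz
    exact (((hG.isInvertible hz).contDiffAt_map_inverse).comp z (hG.contDiffAt hz)).contDiffWithinAt
  have hflip : ContDiffOn ℝ ∞ (fun z => (fderiv ℝ G z).flip) V :=
    (ContinuousLinearMap.flipₗᵢ ℝ X X (X →L[ℝ] ℝ)).contDiff.comp_contDiffOn hD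
  have hA : ContDiffOn ℝ ∞ (fun z =>
      ContinuousLinearMap.compL ℝ X (X →L[ℝ] ℝ) X (G z).inverse) V :=
    (ContinuousLinearMap.compL ℝ X (X →L[ℝ] ℝ) X).contDiff.comp_contDiffOn hinv
  have hB : ContDiffOn ℝ ∞ (fun z =>
      ((ContinuousLinearMap.flipₗᵢ ℝ X X ℝ).toContinuousLinearEquiv.toContinuousLinearMap).comp
        (fderiv ℝ G z).flip) V :=
    (ContinuousLinearMap.compL ℝ X (X →L[ℝ] X →L[ℝ] ℝ) (X →L[ℝ] X →L[ℝ] ℝ)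
      (ContinuousLinearMap.flipₗᵢ ℝ X X ℝ).toContinuousLinearEquiv.toContinuousLinearMap
        ).contDiff.comp_contDiffOn hflip
  exact ContDiffOn.const_smul (1 / 2 : ℝ) (hA.clm_comp ((hD.add hflip).sub hB))

theorem differentiableAt_christoffelL (hG : IsMetricOn G V) {z : X} (hz : z ∈ V) :
    DifferentiableAt ℝ (christoffelL G) z :=
  (hG.contDiffOn_christoffelL.contDiffAt (hG.isOpen.mem_nhds hz)).differentiableAt (by simp)

theorem fderiv_christoffelL_symm (hG : IsMetricOn G V) {z : X} (hz : z ∈ V) (u v w : X) :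
    fderiv ℝ (christoffelL G) z u v w = fderiv ℝ (christoffelL G) z u w v := by
  have h1 : ∀ a b : X, fderiv ℝ (fun z => christoffelL G z a b) z u =
      fderiv ℝ (christoffelL G) z u a b := by
    intro a b
    rw [(((hG.differentiableAt_christoffelL hz).hasFDerivAt.clm_apply
      (hasFDerivAt_const a z)).clm_apply (hasFDerivAt_const b z)).fderiv]
    simp
  rw [← h1, ← h1]
  refine congrArg (fun L : X →L[ℝ] X => L u) (Filter.EventuallyEq.fderiv_eq ?_)
  filter_upwards [hG.isOpen.mem_nhds hz] with z' hz' using hG.christoffelL_symm hz' v w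

/-- The first Bianchi identity. -/
theorem curvature_bianchi (hG : IsMetricOn G V) {z : X} (hz : z ∈ V) (u v w : X) :
    curvatureL G z u v w + curvatureL G z v w u + curvatureL G z w u v = 0 := by
  simp only [curvatureL]
  rw [hG.fderiv_christoffelL_symm hz u w v, hG.fderiv_christoffelL_symm hz v u w,
    hG.fderiv_christoffelL_symm hz w v u, hG.christoffelL_symm hz w v,
    hG.christoffelL_symm hz w u, hG.christoffelL_symm hz v u]
  abel

/-- `⟨R(u, v) w, w⟩ = 0`, from the symmetry of the second derivative of `z ↦ G z w w`. -/
theorem curvature_skew (hG : IsMetricOn G V) {z : X} (hz : z ∈ V) (u v w : X) :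
    G z (curvatureL G z u v w) w = 0 := by
  let φ : X → ℝ := fun z => G z w w
  have hφ : ContDiffAt ℝ ∞ φ z := ((hG.contDiffAt hz).clm_apply contDiffAt_const).clm_apply
    contDiffAt_const
  have h1 : ∀ z' ∈ V, ∀ a, fderiv ℝ φ z' a = 2 * G z' (christoffelL G z' a w) w := by
    intro z' hz' a
    have := (((hG.differentiableAt hz').hasFDerivAt.clm_apply
      (hasFDerivAt_const w z')).clm_apply (hasFDerivAt_const w z')).fderiv
    change fderiv ℝ φ z' = _ at this
    rw [this]
    simp only [add_apply, ContinuousLinearMap.comp_apply,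
      ContinuousLinearMap.flip_apply, zero_apply, map_zero, zero_add]
    rw [hG.fderiv_eq hz', hG.symm z' hz' w]
    ring
  have h2 : ∀ a b, fderiv ℝ (fderiv ℝ φ) z b a =
      2 * (fderiv ℝ G z b (christoffelL G z a w) w +
        G z (fderiv ℝ (christoffelL G) z b a w) w) := by
    intro a b
    have e1 : HasFDerivAt (fun z' => fderiv ℝ φ z' a) ((fderiv ℝ (fderiv ℝ φ) z).flip a) z := by
      have hd : DifferentiableAt ℝ (fderiv ℝ φ) z :=
        (hφ.fderiv_right (m := 1) (by norm_cast)).differentiableAt (by simp)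
      have := hd.hasFDerivAt.clm_apply (hasFDerivAt_const a z)
      simpa using this
    have e2 := ((hG.differentiableAt hz).hasFDerivAt.clm_apply
      (((hG.differentiableAt_christoffelL hz).hasFDerivAt.clm_apply
        (hasFDerivAt_const a z)).clm_apply (hasFDerivAt_const w z))).clm_apply
          (hasFDerivAt_const w z)
    have e3 := e1.unique ((e2.const_mul 2).congr_of_eventuallyEq (by
      filter_upwards [hG.isOpen.mem_nhds hz] with z' hz' using h1 z' hz' a))
    have e4 := congrArg (fun L => L b) e3
    simp only [ContinuousLinearMap.flip_apply] at e4
    rw [e4]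
    simp
    ring
  have hsymm := (hφ.isSymmSndFDerivAt (by simp; norm_cast)).eq u v
  rw [h2, h2] at hsymm
  unfold curvatureL
  rw [hG.fderiv_eq hz, hG.fderiv_eq hz] at hsymm
  simp only [map_add, map_sub, add_apply, sub_apply]
  rw [hG.symm z hz (christoffelL G z u w)] at hsymm
  linarith

end IsMetricOn

theorem IsMetricOn.curvature_eq {m : ℕ} {G : E m → E m →L[ℝ] E m →L[ℝ] ℝ} {V : Set (E m)}
    (hG : IsMetricOn G V) {z : E m} (hz : z ∈ V) (u v w : E m) :
    curvature G z u v w = curvatureL G z u v w := by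
  have h1 : ∀ a b c : E m, fderiv ℝ (fun z => christoffelL G z a b) z c =
      fderiv ℝ (christoffelL G) z c a b := by
    intro a b c
    rw [(((hG.differentiableAt_christoffelL hz).hasFDerivAt.clm_apply
      (hasFDerivAt_const a z)).clm_apply (hasFDerivAt_const b z)).fderiv]
    simp
  simp only [curvature, christoffel_eq, h1]
  rfl

/-- A four-linear form with the symmetries of a curvature tensor whose sectional curvatures vanish
is zero. -/
theorem eq_zero_of_sectional_eq_zero {X : Type*} [AddCommGroup X] (Q : X → X → X → X → ℝ)
    (add₁ : ∀ u u' v w z, Q (u + u') v w z = Q u v w z + Q u' v w z)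
    (add₃ : ∀ u v w w' z, Q u v (w + w') z = Q u v w z + Q u v w' z)
    (add₄ : ∀ u v w z z', Q u v w (z + z') = Q u v w z + Q u v w z')
    (anti : ∀ u v w z, Q u v w z = -Q v u w z) (skew : ∀ u v w, Q u v w w = 0)
    (bianchi : ∀ u v w z, Q u v w z + Q v w u z + Q w u v z = 0)
    (sec : ∀ u v, Q u v v u = 0) (u v w z : X) : Q u v w z = 0 := by
  have skew' : ∀ u v w z, Q u v w z = -Q u v z w := by
    intro u v w z
    have := skew u v (w + z)
    rw [add₃, add₄, add₄, skew, skew] at this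
    linarith
  have pair : ∀ u v w z, Q u v w z = Q w z u v := by
    intro u v w z
    linarith [bianchi u v w z, bianchi v w z u, bianchi w z u v, bianchi z u v w,
      anti u v w z, anti w u v z, skew' v w u z, skew' w u v z, skew' u v w z, skew' v z w u,
      skew' w z u v, skew' z u v w, anti w z u v, anti v z w u, anti z v w u, skew' u v z w,
      skew' w z v u, anti u w v z, anti u w z v, skew' u w v z, anti z u v w, anti z u w v,
      skew' z v w u, anti v w z u, anti v w u z, skew' v w z u]
  have h1 : ∀ u v u', Q u v v u' = 0 := by
    intro u v u'
    have := sec (u + u') v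
    rw [add₁, add₄, add₄, sec, sec] at this
    have e : Q u' v v u = Q u v v u' := by
      rw [pair u' v v u, anti, skew', neg_neg]
    linarith
  have add₂ : ∀ u v v' w z, Q u (v + v') w z = Q u v w z + Q u v' w z := by
    intro u v v' w z
    rw [anti, add₁, anti v, anti v']
    ring
  have h2 : ∀ u v w z, Q u v w z = -Q u w v z := by
    intro u v w z
    have := h1 u (v + w) z
    rw [add₂, add₃, add₃, h1, h1] at this
    linarith
  have b := bianchi u v w z
  linarith [h2 u v w z, anti u w v z, h2 v w u z, anti v u w z, anti u v w z]

/-- In constant sectional curvature, `R(u, v) w` is orthogonal to every vector orthogonal to `u`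
and `v`. -/
theorem IsMetricOn.curvature_orthogonal [FiniteDimensional ℝ X] (hG : IsMetricOn G V)
    {z : X} (hz : z ∈ V) {c : ℝ}
    (hc : ∀ u v, G z (curvatureL G z u v v) u = c * (G z u u * G z v v - G z u v ^ 2))
    {u v w ξ : X} (hu : G z u ξ = 0) (hv : G z v ξ = 0) :
    G z (curvatureL G z u v w) ξ = 0 := by
  -- The difference to the curvature tensor of a space form has vanishing sectional curvatures.
  have key := eq_zero_of_sectional_eq_zero (fun u v w x =>
      G z (curvatureL G z u v w) x - c * (G z v w * G z u x - G z u w * G z v x))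
    (by intros; simp only [curvatureL, map_add, map_sub, add_apply,
          sub_apply]; ring)
    (by intros; simp only [curvatureL, map_add, map_sub, add_apply,
          sub_apply]; ring)
    (by intros; simp only [map_add]; ring)
    (by
      intro u v w x
      rw [curvatureL_antisymm G z u v w]
      simp only [map_neg, neg_apply]
      ring)
    (by
      intro u v w
      rw [hG.curvature_skew hz]
      ring)
    (by
      intro u v w x
      have := congrArg (fun y => G z y x) (hG.curvature_bianchi hz u v w)
      simp only [map_add, add_apply, map_zero,
        zero_apply] at this
      have e := hG.symm z hz
      rw [e w u, e w v, e v u]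
      linarith)
    (by
      intro u v
      rw [hc, hG.symm z hz v u]
      ring)
    u v w ξ
  simpa [hu, hv] using key

end Metric

/-! ### Immersions of open subsets of a vector space -/

section LocalImmersion

variable {X Y Z : Type*} [NormedAddCommGroup X] [NormedSpace ℝ X]
  [NormedAddCommGroup Y] [NormedSpace ℝ Y] [NormedAddCommGroup Z] [NormedSpace ℝ Z]

/-- The bilinear map `(u, v) ↦ B(D u, D v)`. -/
noncomputable def pullbackForm (B : X →L[ℝ] X →L[ℝ] Z) (D : Y →L[ℝ] X) : Y →L[ℝ] Y →L[ℝ] Z :=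
  (ContinuousLinearMap.precomp Z D).comp (B.comp D)

@[simp] theorem pullbackForm_apply (B : X →L[ℝ] X →L[ℝ] Z) (D : Y →L[ℝ] X) (u v : Y) :
    pullbackForm B D u v = B (D u) (D v) := rfl

theorem differentiableAt_precomp {D : Y → Y →L[ℝ] X} {y : Y} (hD : DifferentiableAt ℝ D y) :
    DifferentiableAt ℝ
      (fun y => (ContinuousLinearMap.precomp Z (D y) : (X →L[ℝ] Z) →L[ℝ] Y →L[ℝ] Z)) y :=
  ((ContinuousLinearMap.compL ℝ Y X Z).flip.differentiableAt (x := D y)).comp y hD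

theorem differentiableAt_pullbackForm {B : Y → X →L[ℝ] X →L[ℝ] Z} {D : Y → Y →L[ℝ] X} {y : Y}
    (hB : DifferentiableAt ℝ B y) (hD : DifferentiableAt ℝ D y) :
    DifferentiableAt ℝ (fun y => pullbackForm (B y) (D y)) y :=
  (differentiableAt_precomp hD).clm_comp (hB.clm_comp hD)

theorem differentiableAt_inverse [CompleteSpace X] {L : Y → X →L[ℝ] Z} {y : Y}
    (hL : DifferentiableAt ℝ L y) (hinv : (L y).IsInvertible) :
    DifferentiableAt ℝ (fun y => (L y).inverse) y :=
  (hinv.contDiffAt_map_inverse (n := 1)).differentiableAt (by simp) |>.comp y hL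

/-- The covariant derivative `u ↦ ∂_u V + Γ(∂_u F, V)` of a vector field `V` along `F`. -/
noncomputable def covD (G : X → X →L[ℝ] X →L[ℝ] ℝ) (F V : Y → X) (y : Y) : Y →L[ℝ] X :=
  fderiv ℝ V y + ((christoffelL G (F y)).flip (V y)).comp (fderiv ℝ F y)

theorem covD_apply (G : X → X →L[ℝ] X →L[ℝ] ℝ) (F V : Y → X) (y u : Y) :
    covD G F V y u = fderiv ℝ V y u + christoffelL G (F y) (fderiv ℝ F y u) (V y) := rfl

/-- The first fundamental form of `F`. -/
noncomputable def firstForm (G : X → X →L[ℝ] X →L[ℝ] ℝ) (F : Y → X) (y : Y) : Y →L[ℝ] Y →L[ℝ] ℝ :=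
  pullbackForm (G (F y)) (fderiv ℝ F y)

/-- The preimage under the differential of `F` of the tangential part of a vector. -/
noncomputable def tanCoeff (G : X → X →L[ℝ] X →L[ℝ] ℝ) (F : Y → X) (y : Y) : X →L[ℝ] Y :=
  (firstForm G F y).inverse.comp
    ((ContinuousLinearMap.precomp ℝ (fderiv ℝ F y)).comp (G (F y)))

/-- The orthogonal projection onto the normal space of `F`. -/
noncomputable def nor (G : X → X →L[ℝ] X →L[ℝ] ℝ) (F : Y → X) (y : Y) : X →L[ℝ] X :=
  ContinuousLinearMap.id ℝ X - (fderiv ℝ F y).comp (tanCoeff G F y)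

theorem nor_apply (G : X → X →L[ℝ] X →L[ℝ] ℝ) (F : Y → X) (y : Y) (w : X) :
    nor G F y w = w - fderiv ℝ F y (tanCoeff G F y w) := rfl

/-- The covariant Hessian `∇_u (dF v)`, for constant `v`. -/
noncomputable def covHess (G : X → X →L[ℝ] X →L[ℝ] ℝ) (F : Y → X) (y : Y) : Y →L[ℝ] Y →L[ℝ] X :=
  fderiv ℝ (fderiv ℝ F) y + pullbackForm (christoffelL G (F y)) (fderiv ℝ F y)

theorem covHess_apply (G : X → X →L[ℝ] X →L[ℝ] ℝ) (F : Y → X) (y u v : Y) :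
    covHess G F y u v = fderiv ℝ (fderiv ℝ F) y u v +
      christoffelL G (F y) (fderiv ℝ F y u) (fderiv ℝ F y v) := rfl

/-- The second fundamental form `A(u, v) = -(∇_u (dF v))^⊥` of `F`. -/
noncomputable def secondForm (G : X → X →L[ℝ] X →L[ℝ] ℝ) (F : Y → X) (y : Y) :
    Y →L[ℝ] Y →L[ℝ] X :=
  -(ContinuousLinearMap.compL ℝ Y X X (nor G F y)).comp (covHess G F y)

theorem secondForm_apply (G : X → X →L[ℝ] X →L[ℝ] ℝ) (F : Y → X) (y u v : Y) :
    secondForm G F y u v = -nor G F y (covHess G F y u v) := rfl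

/-- The Christoffel symbols of the induced metric: the tangential part of the covariant Hessian. -/
noncomputable def inducedChristoffel (G : X → X →L[ℝ] X →L[ℝ] ℝ) (F : Y → X) (y : Y) :
    Y →L[ℝ] Y →L[ℝ] Y :=
  (ContinuousLinearMap.compL ℝ Y X Y (tanCoeff G F y)).comp (covHess G F y)

theorem inducedChristoffel_apply (G : X → X →L[ℝ] X →L[ℝ] ℝ) (F : Y → X) (y u v : Y) :
    inducedChristoffel G F y u v = tanCoeff G F y (covHess G F y u v) := rfl

/-- The Gauss formula. -/
theorem covHess_eq (G : X → X →L[ℝ] X →L[ℝ] ℝ) (F : Y → X) (y u v : Y) :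
    covHess G F y u v =
      -secondForm G F y u v + fderiv ℝ F y (inducedChristoffel G F y u v) := by
  rw [secondForm_apply, inducedChristoffel_apply, nor_apply]
  abel

/-- `F` is an immersion of the open set `U` into the open set `V` with Riemannian metric `G`. -/
structure IsImmersedOn (G : X → X →L[ℝ] X →L[ℝ] ℝ) (V : Set X) (F : Y → X) (U : Set Y) :
    Prop where
  metric : IsMetricOn G V
  isOpen : IsOpen U
  contDiffOn : ContDiffOn ℝ ∞ F U
  mapsTo : Set.MapsTo F U V
  injective : ∀ y ∈ U, Function.Injective (fderiv ℝ F y)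

namespace IsImmersedOn

variable {G : X → X →L[ℝ] X →L[ℝ] ℝ} {V : Set X} {F : Y → X} {U : Set Y}

theorem contDiffAt (h : IsImmersedOn G V F U) {y : Y} (hy : y ∈ U) : ContDiffAt ℝ ∞ F y :=
  h.contDiffOn.contDiffAt (h.isOpen.mem_nhds hy)

theorem differentiableAt (h : IsImmersedOn G V F U) {y : Y} (hy : y ∈ U) :
    DifferentiableAt ℝ F y :=
  (h.contDiffAt hy).differentiableAt (by simp)

theorem contDiffAt_fderiv (h : IsImmersedOn G V F U) {y : Y} (hy : y ∈ U) :
    ContDiffAt ℝ ∞ (fderiv ℝ F) y :=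
  (h.contDiffAt hy).fderiv_right (by simp)

theorem differentiableAt_fderiv (h : IsImmersedOn G V F U) {y : Y} (hy : y ∈ U) :
    DifferentiableAt ℝ (fderiv ℝ F) y :=
  (h.contDiffAt_fderiv hy).differentiableAt (by simp)

theorem differentiableAt_fderiv_fderiv (h : IsImmersedOn G V F U) {y : Y} (hy : y ∈ U) :
    DifferentiableAt ℝ (fderiv ℝ (fderiv ℝ F)) y :=
  ((h.contDiffAt_fderiv hy).fderiv_right (m := ∞) (by simp)).differentiableAt (by simp)

theorem differentiableAt_metric (h : IsImmersedOn G V F U) {y : Y} (hy : y ∈ U) :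
    DifferentiableAt ℝ (fun y => G (F y)) y :=
  (h.metric.differentiableAt (h.mapsTo hy)).comp y (h.differentiableAt hy)

theorem symm (h : IsImmersedOn G V F U) {y : Y} (hy : y ∈ U) (v w : X) :
    G (F y) v w = G (F y) w v := h.metric.symm _ (h.mapsTo hy) v w

theorem firstForm_pos (h : IsImmersedOn G V F U) {y : Y} (hy : y ∈ U) (v : Y) (hv : v ≠ 0) :
    0 < firstForm G F y v v :=
  h.metric.pos _ (h.mapsTo hy) _ fun h0 => hv (h.injective y hy (h0.trans (map_zero _).symm))

theorem fderiv_fderiv_symm (h : IsImmersedOn G V F U) {y : Y} (hy : y ∈ U) (u v : Y) :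
    fderiv ℝ (fderiv ℝ F) y u v = fderiv ℝ (fderiv ℝ F) y v u :=
  ((h.contDiffAt hy).isSymmSndFDerivAt (by simp; norm_cast)).eq u v

theorem fderiv_fderiv_fderiv_symm (h : IsImmersedOn G V F U) {y : Y} (hy : y ∈ U) (u v : Y) :
    fderiv ℝ (fderiv ℝ (fderiv ℝ F)) y u v = fderiv ℝ (fderiv ℝ (fderiv ℝ F)) y v u :=
  ((h.contDiffAt_fderiv hy).isSymmSndFDerivAt (by simp; norm_cast)).eq u v

variable [FiniteDimensional ℝ X]

theorem covHess_symm (h : IsImmersedOn G V F U) {y : Y} (hy : y ∈ U) (u v : Y) :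
    covHess G F y u v = covHess G F y v u := by
  rw [covHess_apply, covHess_apply, h.fderiv_fderiv_symm hy,
    h.metric.christoffelL_symm (h.mapsTo hy)]

theorem inducedChristoffel_symm (h : IsImmersedOn G V F U) {y : Y} (hy : y ∈ U) (u v : Y) :
    inducedChristoffel G F y u v = inducedChristoffel G F y v u := by
  rw [inducedChristoffel_apply, inducedChristoffel_apply, h.covHess_symm hy]

theorem differentiableAt_christoffelL (h : IsImmersedOn G V F U) {y : Y} (hy : y ∈ U) :
    DifferentiableAt ℝ (fun y => christoffelL G (F y)) y :=
  (h.metric.differentiableAt_christoffelL (h.mapsTo hy)).comp y (h.differentiableAt hy)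

theorem differentiableAt_covHess (h : IsImmersedOn G V F U) {y : Y} (hy : y ∈ U) :
    DifferentiableAt ℝ (covHess G F) y :=
  (h.differentiableAt_fderiv_fderiv hy).add
    (differentiableAt_pullbackForm (h.differentiableAt_christoffelL hy)
      (h.differentiableAt_fderiv hy))

/-- The Levi-Civita connection is metric, for vector fields along `F`. -/
theorem hasFDerivAt_metric (h : IsImmersedOn G V F U) {y : Y} (hy : y ∈ U) {v w : Y → X}
    (hv : DifferentiableAt ℝ v y) (hw : DifferentiableAt ℝ w y) :
    HasFDerivAt (fun y => G (F y) (v y) (w y))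
      (((G (F y)).flip (w y)).comp (covD G F v y) + (G (F y) (v y)).comp (covD G F w y)) y := by
  have h1 := (((h.metric.differentiableAt (h.mapsTo hy)).hasFDerivAt.comp y
    (h.differentiableAt hy).hasFDerivAt).clm_apply hv.hasFDerivAt).clm_apply hw.hasFDerivAt
  refine h1.congr_fderiv ?_
  ext u
  simp only [add_apply, ContinuousLinearMap.comp_apply, ContinuousLinearMap.flip_apply,
    Function.comp_apply, covD_apply, map_add, h.metric.fderiv_eq (h.mapsTo hy)]
  ring

/-- The covariant derivative of a tangent vector field. -/
theorem covD_tangent (h : IsImmersedOn G V F U) {y : Y} (hy : y ∈ U) {θ : Y → Y}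
    (hθ : DifferentiableAt ℝ θ y) (u : Y) :
    covD G F (fun y => fderiv ℝ F y (θ y)) y u =
      fderiv ℝ F y (fderiv ℝ θ y u) + covHess G F y u (θ y) := by
  rw [covD_apply, ((h.differentiableAt_fderiv hy).hasFDerivAt.clm_apply hθ.hasFDerivAt).fderiv,
    covHess_apply]
  simp only [add_apply, ContinuousLinearMap.comp_apply, ContinuousLinearMap.flip_apply]
  abel

/-- The Ricci identity `∇_u ∇_v (dF w) - ∇_v ∇_u (dF w) = R(dF u, dF v) dF w`. -/
theorem covD_covHess_sub (h : IsImmersedOn G V F U) {y : Y} (hy : y ∈ U) (u v w : Y) :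
    covD G F (fun y => covHess G F y v w) y u - covD G F (fun y => covHess G F y u w) y v =
      curvatureL G (F y) (fderiv ℝ F y u) (fderiv ℝ F y v) (fderiv ℝ F y w) := by
  have key : ∀ a b : Y, fderiv ℝ (fun y => covHess G F y b w) y a =
      fderiv ℝ (fderiv ℝ (fderiv ℝ F)) y a b w +
      (fderiv ℝ (christoffelL G) (F y) (fderiv ℝ F y a) (fderiv ℝ F y b) (fderiv ℝ F y w) +
        christoffelL G (F y) (fderiv ℝ (fderiv ℝ F) y a b) (fderiv ℝ F y w) +
        christoffelL G (F y) (fderiv ℝ F y b) (fderiv ℝ (fderiv ℝ F) y a w)) := by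
    intro a b
    have hF := (h.differentiableAt_fderiv hy).hasFDerivAt
    have hc : ∀ c : Y, HasFDerivAt (fun y => fderiv ℝ F y c)
        ((fderiv ℝ (fderiv ℝ F) y).flip c) y := by
      intro c
      simpa using hF.clm_apply (hasFDerivAt_const c y)
    have h1 := ((h.differentiableAt_fderiv_fderiv hy).hasFDerivAt.clm_apply
      (hasFDerivAt_const b y)).clm_apply (hasFDerivAt_const w y)
    have h2 := (((h.metric.differentiableAt_christoffelL (h.mapsTo hy)).hasFDerivAt.comp y
      (h.differentiableAt hy).hasFDerivAt).clm_apply (hc b)).clm_apply (hc w)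
    have h3 := (h1.add h2).fderiv
    have h4 : (fun y => covHess G F y b w) = ((fun y => fderiv ℝ (fderiv ℝ F) y b w) +
        fun y => (christoffelL G ∘ F) y (fderiv ℝ F y b) (fderiv ℝ F y w)) := rfl
    rw [h4, h3]
    simp
    abel
  rw [covD_apply, covD_apply, key, key, h.fderiv_fderiv_fderiv_symm hy u v,
    h.fderiv_fderiv_symm hy u v]
  unfold curvatureL
  simp only [covHess_apply, map_add]
  abel

variable [FiniteDimensional ℝ Y]

theorem firstForm_isInvertible (h : IsImmersedOn G V F U) {y : Y} (hy : y ∈ U) :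
    (firstForm G F y).IsInvertible :=
  isInvertible_of_pos (h.firstForm_pos hy)

theorem tanCoeff_spec (h : IsImmersedOn G V F U) {y : Y} (hy : y ∈ U) (w : X) (u : Y) :
    G (F y) (fderiv ℝ F y (tanCoeff G F y w)) (fderiv ℝ F y u) = G (F y) w (fderiv ℝ F y u) := by
  change firstForm G F y ((firstForm G F y).inverse _) u = _
  rw [(h.firstForm_isInvertible hy).self_apply_inverse]
  rfl

theorem nor_orth (h : IsImmersedOn G V F U) {y : Y} (hy : y ∈ U) (w : X) (u : Y) :
    G (F y) (nor G F y w) (fderiv ℝ F y u) = 0 := by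
  rw [nor_apply, map_sub, sub_apply, h.tanCoeff_spec hy, sub_self]

theorem nor_tangent (h : IsImmersedOn G V F U) {y : Y} (hy : y ∈ U) (u : Y) :
    nor G F y (fderiv ℝ F y u) = 0 := by
  have : tanCoeff G F y (fderiv ℝ F y u) = u := by
    change (firstForm G F y).inverse (firstForm G F y u) = u
    exact (h.firstForm_isInvertible hy).inverse_apply_self u
  rw [nor_apply, this, sub_self]

theorem nor_of_orth (h : IsImmersedOn G V F U) {y : Y} (hy : y ∈ U) {w : X}
    (hw : ∀ u, G (F y) w (fderiv ℝ F y u) = 0) : nor G F y w = w := by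
  have h1 := h.tanCoeff_spec hy w (tanCoeff G F y w)
  rw [hw] at h1
  have h2 : fderiv ℝ F y (tanCoeff G F y w) = 0 := by
    by_contra hne
    exact (h.metric.pos _ (h.mapsTo hy) _ hne).ne' h1
  rw [nor_apply, h2, sub_zero]

theorem nor_pair (h : IsImmersedOn G V F U) {y : Y} (hy : y ∈ U) (w : X) {ξ : X}
    (hξ : ∀ u, G (F y) ξ (fderiv ℝ F y u) = 0) : G (F y) (nor G F y w) ξ = G (F y) w ξ := by
  rw [nor_apply, map_sub, sub_apply, h.symm hy (fderiv ℝ F y _), hξ, sub_zero]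

theorem nor_nor (h : IsImmersedOn G V F U) {y : Y} (hy : y ∈ U) (w : X) :
    nor G F y (nor G F y w) = nor G F y w :=
  h.nor_of_orth hy (h.nor_orth hy w)

theorem nor_secondForm (h : IsImmersedOn G V F U) {y : Y} (hy : y ∈ U) (u v : Y) :
    nor G F y (secondForm G F y u v) = secondForm G F y u v := by
  rw [secondForm_apply, map_neg, h.nor_nor hy]

theorem differentiableAt_firstForm (h : IsImmersedOn G V F U) {y : Y} (hy : y ∈ U) :
    DifferentiableAt ℝ (firstForm G F) y :=
  differentiableAt_pullbackForm (h.differentiableAt_metric hy) (h.differentiableAt_fderiv hy)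

theorem differentiableAt_tanCoeff (h : IsImmersedOn G V F U) {y : Y} (hy : y ∈ U) :
    DifferentiableAt ℝ (tanCoeff G F) y :=
  have := FiniteDimensional.complete ℝ Y
  (differentiableAt_inverse (h.differentiableAt_firstForm hy)
    (h.firstForm_isInvertible hy)).clm_comp
    ((differentiableAt_precomp (h.differentiableAt_fderiv hy)).clm_comp
      (h.differentiableAt_metric hy))

theorem differentiableAt_nor (h : IsImmersedOn G V F U) {y : Y} (hy : y ∈ U) :
    DifferentiableAt ℝ (nor G F) y :=
  (differentiableAt_const _).sub
    ((h.differentiableAt_fderiv hy).clm_comp (h.differentiableAt_tanCoeff hy))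

theorem differentiableAt_secondForm (h : IsImmersedOn G V F U) {y : Y} (hy : y ∈ U) :
    DifferentiableAt ℝ (secondForm G F) y :=
  (((ContinuousLinearMap.compL ℝ Y X X).differentiableAt.comp y
    (h.differentiableAt_nor hy)).clm_comp (h.differentiableAt_covHess hy)).neg

theorem differentiableAt_inducedChristoffel (h : IsImmersedOn G V F U) {y : Y} (hy : y ∈ U) :
    DifferentiableAt ℝ (inducedChristoffel G F) y :=
  ((ContinuousLinearMap.compL ℝ Y X Y).differentiableAt.comp y
    (h.differentiableAt_tanCoeff hy)).clm_comp (h.differentiableAt_covHess hy)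

/-- The curvature term of the Codazzi equation vanishes in constant curvature. -/
theorem nor_curvature (h : IsImmersedOn G V F U) {y : Y} (hy : y ∈ U) {c : ℝ}
    (hc : ∀ u v, G (F y) (curvatureL G (F y) u v v) u =
      c * (G (F y) u u * G (F y) v v - G (F y) u v ^ 2)) (u v w : Y) :
    nor G F y (curvatureL G (F y) (fderiv ℝ F y u) (fderiv ℝ F y v) (fderiv ℝ F y w)) = 0 := by
  set R := curvatureL G (F y) (fderiv ℝ F y u) (fderiv ℝ F y v) (fderiv ℝ F y w) with hR
  have ho : ∀ u, G (F y) (fderiv ℝ F y u) (nor G F y R) = 0 := fun u => by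
    rw [h.symm hy, h.nor_orth hy]
  have h1 : G (F y) R (nor G F y R) = 0 :=
    h.metric.curvature_orthogonal (h.mapsTo hy) hc (ho u) (ho v)
  rw [← h.nor_pair hy R (h.nor_orth hy R)] at h1
  by_contra hne
  exact (h.metric.pos _ (h.mapsTo hy) _ hne).ne' h1

/-- The Codazzi equation in constant curvature: `(∇_u A(v, w))^⊥ + A(u, ∇_v w)` is symmetric in `u`
and `v`, for constant `u`, `v`, `w`. -/
theorem codazzi (h : IsImmersedOn G V F U) {y : Y} (hy : y ∈ U) {c : ℝ}
    (hc : ∀ u v, G (F y) (curvatureL G (F y) u v v) u =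
      c * (G (F y) u u * G (F y) v v - G (F y) u v ^ 2)) (u v w : Y) :
    nor G F y (covD G F (fun y => secondForm G F y v w) y u) +
        secondForm G F y u (inducedChristoffel G F y v w) =
      nor G F y (covD G F (fun y => secondForm G F y u w) y v) +
        secondForm G F y v (inducedChristoffel G F y u w) := by
  have key : ∀ a b : Y, nor G F y (covD G F (fun y => secondForm G F y b w) y a) +
      secondForm G F y a (inducedChristoffel G F y b w) =
        -nor G F y (covD G F (fun y => covHess G F y b w) y a) := by
    intro a b
    have dB : DifferentiableAt ℝ (fun y => secondForm G F y b w) y :=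
      ((h.differentiableAt_secondForm hy).clm_apply (differentiableAt_const b)).clm_apply
        (differentiableAt_const w)
    have dθ : DifferentiableAt ℝ (fun y => inducedChristoffel G F y b w) y :=
      ((h.differentiableAt_inducedChristoffel hy).clm_apply (differentiableAt_const b)).clm_apply
        (differentiableAt_const w)
    have dT : DifferentiableAt ℝ (fun y => fderiv ℝ F y (inducedChristoffel G F y b w)) y :=
      (h.differentiableAt_fderiv hy).clm_apply dθ
    have e1 : covD G F (fun y => covHess G F y b w) y a =
        -covD G F (fun y => secondForm G F y b w) y a +
          covD G F (fun y => fderiv ℝ F y (inducedChristoffel G F y b w)) y a := by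
      simp only [covD_apply]
      have e2 : fderiv ℝ (fun y => covHess G F y b w) y =
          -fderiv ℝ (fun y => secondForm G F y b w) y +
            fderiv ℝ (fun y => fderiv ℝ F y (inducedChristoffel G F y b w)) y := by
        rw [← (dB.hasFDerivAt.neg.add dT.hasFDerivAt).fderiv]
        congr 1
        funext y
        exact covHess_eq G F y b w
      rw [e2, covHess_eq]
      simp only [add_apply, neg_apply, map_add, map_neg]
      abel
    rw [e1, h.covD_tangent hy dθ, map_add, map_add, h.nor_tangent hy, map_neg, secondForm_apply]
    abel
  have hR := congrArg (nor G F y) (h.covD_covHess_sub hy u v w)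
  rw [map_sub, h.nor_curvature hy hc, sub_eq_zero] at hR
  rw [key, key, hR]

end IsImmersedOn

end LocalImmersion

/-! ### Frames that are parallel at a point -/

section AdaptedFrame

variable {X Y : Type*} [NormedAddCommGroup X] [NormedSpace ℝ X] [FiniteDimensional ℝ X]
  [NormedAddCommGroup Y] [NormedSpace ℝ Y] [FiniteDimensional ℝ Y]
  {G : X → X →L[ℝ] X →L[ℝ] ℝ} {V : Set X} {F : Y → X} {U : Set Y}

/-- Near `y₀` there are two fields of linear maps `P` and `R` which are the identity and parallel at
`y₀` and such that `firstForm` pairs `P u` and `R v` to a constant. Applied to an orthonormal basis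
at `y₀` they give dual frames. Two fields are used since a single orthonormal frame would have to be
extracted from the Gram matrix of `P` by a square root, while `R` only needs its inverse. -/
theorem IsImmersedOn.exists_dual_frames (h : IsImmersedOn G V F U) {y₀ : Y} (hy₀ : y₀ ∈ U) :
    ∃ P R : Y → Y →L[ℝ] Y, DifferentiableAt ℝ P y₀ ∧ DifferentiableAt ℝ R y₀ ∧
      P y₀ = ContinuousLinearMap.id ℝ Y ∧ R y₀ = ContinuousLinearMap.id ℝ Y ∧
      (∀ u v, fderiv ℝ P y₀ u v = -inducedChristoffel G F y₀ u v) ∧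
      (∀ u v, fderiv ℝ R y₀ u v = -inducedChristoffel G F y₀ u v) ∧
      ∀ᶠ y in 𝓝 y₀, ∀ u v, firstForm G F y (P y u) (R y v) = firstForm G F y₀ u v := by
  have := FiniteDimensional.complete ℝ Y
  set θ := inducedChristoffel G F y₀ with hθ
  let P : Y → Y →L[ℝ] Y := fun y => ContinuousLinearMap.id ℝ Y - θ (y - y₀)
  have hP0 : P y₀ = ContinuousLinearMap.id ℝ Y := by simp [P]
  have hP : HasFDerivAt P (-θ) y₀ := by
    have h1 : HasFDerivAt (fun y => θ (y - y₀)) θ y₀ := by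
      have h2 : HasFDerivAt (fun y => y - y₀) (ContinuousLinearMap.id ℝ Y) y₀ :=
        (hasFDerivAt_id y₀).sub_const y₀
      exact (θ.hasFDerivAt.comp y₀ h2).congr_fderiv θ.comp_id
    exact ((hasFDerivAt_const (ContinuousLinearMap.id ℝ Y) y₀).sub h1).congr_fderiv (zero_sub θ)
  let J : Y → Y →L[ℝ] Y →L[ℝ] ℝ := fun y => pullbackForm (firstForm G F y) (P y)
  have hJ0 : J y₀ = firstForm G F y₀ := by
    ext u v
    simp [J, hP0]
  have hJd : DifferentiableAt ℝ J y₀ :=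
    differentiableAt_pullbackForm (h.differentiableAt_firstForm hy₀) hP.differentiableAt
  -- The frame `P` is parallel at `y₀`, so its Gram matrix is stationary there.
  have hJ' : HasFDerivAt (𝕜 := ℝ) J 0 y₀ := by
    have hcov : ∀ u a, covD G F (fun y => fderiv ℝ F y (P y u)) y₀ a =
        -secondForm G F y₀ a u := by
      intro u a
      have hPu : HasFDerivAt (fun y => P y u) ((-θ).flip u) y₀ := by
        simpa using hP.clm_apply (hasFDerivAt_const u y₀)
      rw [h.covD_tangent hy₀ hPu.differentiableAt, hPu.fderiv, hP0, covHess_eq]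
      simp [hθ]
    have h0 : fderiv ℝ J y₀ = 0 := by
      ext a u v
      have h1 : HasFDerivAt (fun y => J y u v) (((fderiv ℝ J y₀).flip u).flip v) y₀ := by
        simpa using (hJd.hasFDerivAt.clm_apply (hasFDerivAt_const u y₀)).clm_apply
          (hasFDerivAt_const v y₀)
      have hd : ∀ u, DifferentiableAt ℝ (fun y => fderiv ℝ F y (P y u)) y₀ := fun u =>
        (h.differentiableAt_fderiv hy₀).clm_apply
          (hP.differentiableAt.clm_apply (differentiableAt_const u))
      have h2 := h.hasFDerivAt_metric hy₀ (hd u) (hd v)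
      have h3 := congrArg (fun L : Y →L[ℝ] ℝ => L a) (h1.unique h2)
      simp only [ContinuousLinearMap.flip_apply, add_apply, ContinuousLinearMap.comp_apply, hcov,
        map_neg, hP0, ContinuousLinearMap.id_apply] at h3
      rw [h3, h.symm hy₀ (fderiv ℝ F y₀ u)]
      simp only [secondForm_apply, map_neg, neg_apply, h.nor_orth hy₀]
      simp
    rw [← h0]
    exact hJd.hasFDerivAt
  have hJinv : (J y₀).IsInvertible := hJ0 ▸ h.firstForm_isInvertible hy₀
  let K : Y → Y →L[ℝ] Y := fun y => (J y).inverse.comp (J y₀)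
  have hK0 : K y₀ = ContinuousLinearMap.id ℝ Y := hJinv.inverse_comp_self
  have hK : HasFDerivAt (𝕜 := ℝ) K 0 y₀ := by
    have h1 : HasFDerivAt (𝕜 := ℝ) (fun y => (J y).inverse) 0 y₀ := by
      have h2 := (hJinv.contDiffAt_map_inverse (n := 1)).differentiableAt (by simp)
      exact (h2.hasFDerivAt.comp y₀ hJ').congr_fderiv (ContinuousLinearMap.comp_zero _)
    simpa using h1.clm_comp (hasFDerivAt_const (J y₀) y₀)
  have hR : HasFDerivAt (fun y => (P y).comp (K y)) (-θ) y₀ := by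
    refine (hP.clm_comp hK).congr_fderiv ?_
    ext u v
    simp [hK0]
  refine ⟨P, fun y => (P y).comp (K y), hP.differentiableAt, hR.differentiableAt, hP0, ?_, ?_, ?_,
    ?_⟩
  · change (P y₀).comp (K y₀) = _
    rw [hP0, hK0]
    rfl
  · intro u v
    rw [hP.fderiv]
    rfl
  · intro u v
    rw [hR.fderiv]
    rfl
  · have hinv : ∀ᶠ y in 𝓝 y₀, (J y).IsInvertible := by
      obtain ⟨e, he⟩ := hJinv
      have := hJd.continuousAt.eventually_mem (he ▸ e.nhds)
      filter_upwards [this] with y hy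
      exact hy
    filter_upwards [hinv, h.isOpen.mem_nhds hy₀] with y hy hyU u v
    have h1 : J y (K y v) u = J y₀ v u := by
      change J y ((J y).inverse (J y₀ v)) u = _
      rw [hy.self_apply_inverse]
    rw [hJ0] at h1
    change G (F y) _ _ = G (F y₀) _ _
    rw [h.symm hyU, h.symm hy₀]
    exact h1

/-! ### Leibniz rules for products of pairings -/

theorem IsImmersedOn.pairMap_leibniz (h : IsImmersedOn G V F U) {y : Y} (hy : y ∈ U) {q : ℕ}
    (w : Fin (2 * q) → Y → X) (hw : ∀ p, DifferentiableAt ℝ (w p) y)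
    (hn : ∀ p, nor G F y (w p y) = w p y) :
    DifferentiableAt ℝ (fun y => pairMap (G (F y)).toLinearMap₁₂ q fun p => w p y) y ∧
    ∀ u, fderiv ℝ (fun y => pairMap (G (F y)).toLinearMap₁₂ q fun p => w p y) y u =
      ∑ p, pairMap (G (F y)).toLinearMap₁₂ q
        (Function.update (fun p => w p y) p (nor G F y (covD G F (w p) y u))) := by
  have hpair := fun k : Fin q => h.hasFDerivAt_metric hy (hw ⟨2 * k, by omega⟩)
    (hw ⟨2 * k + 1, by omega⟩)
  have hprod := HasFDerivAt.finsetProd (u := Finset.univ) fun k _ => hpair k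
  refine ⟨hprod.differentiableAt, fun u => ?_⟩
  have e : (fun y => pairMap (G (F y)).toLinearMap₁₂ q fun p => w p y) = fun y => ∏ k : Fin q,
      G (F y) (w ⟨2 * k, by omega⟩ y) (w ⟨2 * k + 1, by omega⟩ y) := rfl
  have horth : ∀ p u, G (F y) (w p y) (fderiv ℝ F y u) = 0 := fun p u => by
    rw [← hn p, h.nor_orth hy]
  rw [e, hprod.fderiv, sum_pairMap_update _ _ _ fun p => nor G F y (covD G F (w p) y u)]
  simp only [sum_apply, smul_apply, smul_eq_mul, add_apply, ContinuousLinearMap.comp_apply,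
    ContinuousLinearMap.flip_apply, ContinuousLinearMap.toLinearMap₁₂_apply_apply_apply]
  refine Finset.sum_congr rfl fun k _ => ?_
  rw [h.nor_pair hy _ (horth _), h.symm hy _ (nor G F y _), h.nor_pair hy _ (horth _),
    h.symm hy (covD G F _ y u) (w ⟨2 * k, _⟩ y)]

theorem IsImmersedOn.oddPairMap_leibniz (h : IsImmersedOn G V F U) {y : Y} (hy : y ∈ U) {q : ℕ}
    (w : Fin (2 * q + 1) → Y → X) (hw : ∀ p, DifferentiableAt ℝ (w p) y)
    (hn : ∀ p, nor G F y (w p y) = w p y) :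
    DifferentiableAt ℝ (fun y => oddPairMap (G (F y)).toLinearMap₁₂ q fun p => w p y) y ∧
    ∀ u, nor G F y
        (covD G F (fun y => oddPairMap (G (F y)).toLinearMap₁₂ q fun p => w p y) y u) =
      ∑ p, oddPairMap (G (F y)).toLinearMap₁₂ q
        (Function.update (fun p => w p y) p (nor G F y (covD G F (w p) y u))) := by
  obtain ⟨h1, h2⟩ := h.pairMap_leibniz hy (fun p => w p.castSucc) (fun p => hw _) (fun p => hn _)
  have h3 := h1.hasFDerivAt.smul (hw (Fin.last _)).hasFDerivAt
  refine ⟨h3.differentiableAt, fun u => ?_⟩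
  have e : (fun y => oddPairMap (G (F y)).toLinearMap₁₂ q fun p => w p y) =
      fun y => (pairMap (G (F y)).toLinearMap₁₂ q fun p => w p.castSucc y) •
        w (Fin.last _) y := rfl
  rw [sum_oddPairMap_update _ _ _ fun p => nor G F y (covD G F (w p) y u), ← h2 u, covD_apply, e]
  have h4 := h3.fderiv
  simp only [Pi.smul_def'] at h4
  rw [h4]
  simp only [add_apply, smul_apply, ContinuousLinearMap.smulRight_apply, map_add, map_smul,
    covD_apply, hn, smul_add, oddPairMap_apply]
  abel

end AdaptedFrame

/-! ### The divergence of the Newton transformations -/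

section Frames

variable {X Y : Type*} [NormedAddCommGroup X] [NormedSpace ℝ X]
  [NormedAddCommGroup Y] [NormedSpace ℝ Y] [FiniteDimensional ℝ Y]

theorem eq_sum_of_orthonormal {n : ℕ} (hn : Module.finrank ℝ Y = n) (β : Y →L[ℝ] Y →L[ℝ] ℝ)
    {o : Fin n → Y} (ho : ∀ i j, β (o i) (o j) = if i = j then 1 else 0) (v : Y) :
    v = ∑ k, β v (o k) • o k := by
  have hcoef : ∀ (c : Fin n → ℝ) (l : Fin n), β (∑ k, c k • o k) (o l) = c l := by
    intro c l
    simp [ho]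
  have hli : LinearIndependent ℝ o := by
    rw [Fintype.linearIndependent_iff]
    intro c hc l
    rw [← hcoef c l, hc]
    simp
  have hspan := hli.span_eq_top_of_card_eq_finrank' (by rw [hn, Fintype.card_fin])
  have hv : v ∈ Submodule.span ℝ (Set.range o) := hspan ▸ Submodule.mem_top
  obtain ⟨c, rfl⟩ := (Submodule.mem_span_range_iff_exists_fun ℝ).1 hv
  simp only [hcoef]

/-- If the tensor `T` of the form `B` is a multiple of the identity in an orthonormal frame, then
it is the same multiple of the identity in every pair of dual frames. -/
theorem contractT_dual_frames {n r : ℕ} {Z : Type*} [AddCommGroup Z] [Module ℝ Z]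
    (hn : Module.finrank ℝ Y = n) (β : Y →L[ℝ] Y →L[ℝ] ℝ)
    (B : Y →L[ℝ] Y →L[ℝ] X) (Φ : MultilinearMap ℝ (fun _ : Fin r => X) Z) (z : Z)
    {o e e' : Fin n → Y} (ho : ∀ i j, β (o i) (o j) = if i = j then 1 else 0)
    (he : ∀ i j, β (e i) (e' j) = if i = j then 1 else 0)
    (hT : ∀ s t, contractT Φ (fun i j => B (o i) (o j)) s t = if s = t then z else 0)
    (s t : Fin n) :
    contractT Φ (fun i j => B (e i) (e' j)) s t = if s = t then z else 0 := by
  have hdual : ∀ i j, ∑ k, β (e i) (o k) * β (e' j) (o k) = if i = j then 1 else 0 := by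
    intro i j
    rw [← he i j]
    conv_rhs => rw [eq_sum_of_orthonormal hn β ho (e' j)]
    simp [mul_comm]
  have hdual' : ∀ k l, ∑ i, β (e i) (o k) * β (e' i) (o l) = if k = l then 1 else 0 := by
    let P : Matrix (Fin n) (Fin n) ℝ := Matrix.of fun i k => β (e i) (o k)
    let Q : Matrix (Fin n) (Fin n) ℝ := Matrix.of fun k j => β (e' j) (o k)
    have h1 : P * Q = 1 := by
      ext i j
      simp [P, Q, Matrix.mul_apply, hdual, Matrix.one_apply]
    have h2 : Q * P = 1 := mul_eq_one_comm.1 h1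
    intro k l
    have h3 := congrFun (congrFun h2 l) k
    simp only [P, Q, Matrix.mul_apply, Matrix.of_apply, Matrix.one_apply] at h3
    refine (Finset.sum_congr rfl fun i _ => mul_comm _ _).trans (h3.trans ?_)
    simp only [eq_comm]
  have hoe : ∀ k, o k = ∑ i, β (e' i) (o k) • e i := by
    intro k
    have h1 : ∀ i, e i = ∑ l, β (e i) (o l) • o l := fun i => eq_sum_of_orthonormal hn β ho _
    conv_rhs =>
      enter [2, i]
      rw [h1 i, Finset.smul_sum]
    rw [Finset.sum_comm]
    simp only [smul_smul, ← Finset.sum_smul]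
    simp only [mul_comm, hdual']
    simp
  have hoe' : ∀ k, o k = ∑ i, β (e i) (o k) • e' i := by
    intro k
    have h1 : ∀ i, e' i = ∑ l, β (e' i) (o l) • o l := fun i => eq_sum_of_orthonormal hn β ho _
    conv_rhs =>
      enter [2, i]
      rw [h1 i, Finset.smul_sum]
    rw [Finset.sum_comm]
    simp only [smul_smul, ← Finset.sum_smul, hdual']
    simp
  rw [contractT_change Φ (fun k l => B (o k) (o l)) (fun i j => B (e i) (e' j))
    (fun i k => β (e' i) (o k)) (fun j l => β (e j) (o l))]
  · simp only [hT, smul_ite, smul_zero, Finset.sum_ite_eq, Finset.mem_univ, if_true,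
      ← Finset.sum_smul]
    simp only [mul_comm, hdual, ite_smul, one_smul, zero_smul, eq_comm]
  · intro i j
    simp only [mul_comm, hdual, eq_comm]
  · intro k l
    conv_lhs => rw [hoe k, hoe' l]
    simp only [map_sum, map_smul, sum_apply, smul_apply, Finset.smul_sum, smul_smul]
    rw [Finset.sum_comm]
    simp only [mul_comm]

end Frames

section LocalDivergence

variable {X Y : Type*} [NormedAddCommGroup X] [NormedSpace ℝ X] [FiniteDimensional ℝ X]
  [NormedAddCommGroup Y] [NormedSpace ℝ Y] [FiniteDimensional ℝ Y]
  {G : X → X →L[ℝ] X →L[ℝ] ℝ} {V : Set X} {F : Y → X} {U : Set Y}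

/-- Around each point there are components `a i j` of the second fundamental form, in a pair of
dual frames, whose normal derivatives in the directions of the frame satisfy the Codazzi equation
without correction terms. -/
theorem IsImmersedOn.exists_codazzi_components (h : IsImmersedOn G V F U) {y₀ : Y} (hy₀ : y₀ ∈ U)
    {n : ℕ} {c : ℝ}
    (hc : ∀ u v, G (F y₀) (curvatureL G (F y₀) u v v) u =
      c * (G (F y₀) u u * G (F y₀) v v - G (F y₀) u v ^ 2))
    {o : Fin n → Y} (ho : ∀ i j, firstForm G F y₀ (o i) (o j) = if i = j then 1 else 0) :
    ∃ e e' : Y → Fin n → Y,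
      (∀ i j, DifferentiableAt ℝ (fun y => secondForm G F y (e y i) (e' y j)) y₀) ∧
      (∀ s i j, nor G F y₀ (covD G F (fun y => secondForm G F y (e y i) (e' y j)) y₀ (o s)) =
        nor G F y₀ (covD G F (fun y => secondForm G F y (e y s) (e' y j)) y₀ (o i))) ∧
      ∀ᶠ y in 𝓝 y₀, ∀ i j, firstForm G F y (e y i) (e' y j) = if i = j then 1 else 0 := by
  obtain ⟨P, R, hP, hR, hP0, hR0, hP', hR', hPR⟩ := h.exists_dual_frames hy₀
  have dB := h.differentiableAt_secondForm hy₀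
  have dP : ∀ v, HasFDerivAt (fun y => P y v) ((fderiv ℝ P y₀).flip v) y₀ := fun v => by
    simpa using hP.hasFDerivAt.clm_apply (hasFDerivAt_const v y₀)
  have dR : ∀ v, HasFDerivAt (fun y => R y v) ((fderiv ℝ R y₀).flip v) y₀ := fun v => by
    simpa using hR.hasFDerivAt.clm_apply (hasFDerivAt_const v y₀)
  refine ⟨fun y i => P y (o i), fun y j => R y (o j), fun i j => ?_, fun s i j => ?_, ?_⟩
  · exact (dB.clm_apply (dP _).differentiableAt).clm_apply (dR _).differentiableAt
  · have key : ∀ s i, nor G F y₀ (covD G F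
        (fun y => secondForm G F y (P y (o i)) (R y (o j))) y₀ (o s)) =
        (nor G F y₀ (covD G F (fun y => secondForm G F y (o i) (o j)) y₀ (o s)) +
          secondForm G F y₀ (o s) (inducedChristoffel G F y₀ (o i) (o j))) -
        secondForm G F y₀ (o s) (inducedChristoffel G F y₀ (o i) (o j)) -
        secondForm G F y₀ (inducedChristoffel G F y₀ (o s) (o i)) (o j) -
        secondForm G F y₀ (o i) (inducedChristoffel G F y₀ (o s) (o j)) := by
      intro s i
      have h1 := ((dB.hasFDerivAt.clm_apply (dP (o i))).clm_apply (dR (o j))).fderiv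
      have h2 := ((dB.hasFDerivAt.clm_apply (hasFDerivAt_const (o i) y₀)).clm_apply
        (hasFDerivAt_const (o j) y₀)).fderiv
      rw [covD_apply, covD_apply, h1, h2]
      simp only [add_apply, ContinuousLinearMap.comp_apply, ContinuousLinearMap.flip_apply, hP0,
        hR0, hP', hR', ContinuousLinearMap.id_apply, map_add, map_neg, neg_apply,
        h.nor_secondForm hy₀, zero_apply, map_zero]
      abel
    rw [key, key, h.codazzi hy₀ hc, h.inducedChristoffel_symm hy₀ (o i) (o s)]
    abel
  · filter_upwards [hPR] with y hy i j
    rw [hy, ho]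

/-- A function `H` such that `κ H` times the identity is a Newton transformation of even order is
stationary: the divergence of the Newton transformation vanishes. -/
theorem IsImmersedOn.hasFDerivAt_zero_of_even (h : IsImmersedOn G V F U) {y₀ : Y} (hy₀ : y₀ ∈ U)
    {n : ℕ} (hn : Module.finrank ℝ Y = n) (hn0 : 0 < n) {c : ℝ}
    (hc : ∀ u v, G (F y₀) (curvatureL G (F y₀) u v v) u =
      c * (G (F y₀) u u * G (F y₀) v v - G (F y₀) u v ^ 2))
    {q : ℕ} {κ : ℝ} (hκ : κ ≠ 0) {H : Y → ℝ}
    (hH : ∀ᶠ y in 𝓝 y₀, ∃ o : Fin n → Y,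
      (∀ i j, firstForm G F y (o i) (o j) = if i = j then 1 else 0) ∧
      ∀ s t, contractT (pairMap (G (F y)).toLinearMap₁₂ q)
        (fun i j => secondForm G F y (o i) (o j)) s t = if s = t then κ • H y else 0) :
    HasFDerivAt H (0 : Y →L[ℝ] ℝ) y₀ := by
  obtain ⟨o, ho, -⟩ := hH.self_of_nhds
  obtain ⟨e, e', da, ca, he⟩ := h.exists_codazzi_components hy₀ hc ho
  let a : Fin n → Fin n → Y → X := fun i j y => secondForm G F y (e y i) (e' y j)
  have na : ∀ i j, nor G F y₀ (a i j y₀) = a i j y₀ := fun i j => h.nor_secondForm hy₀ _ _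
  -- In the dual frames the Newton transformation is `κ H` times the identity as well.
  have hT' : ∀ s t, (fun y => contractT (pairMap (G (F y)).toLinearMap₁₂ q)
      (fun i j => a i j y) s t) =ᶠ[𝓝 y₀] fun y => if s = t then κ • H y else 0 := by
    intro s t
    filter_upwards [he, hH] with y hy ⟨o', ho', hoT⟩
    exact contractT_dual_frames hn (firstForm G F y) (secondForm G F y) _ _ ho' hy hoT s t
  have hterm := fun i j : Fin (2 * q) → Fin n => h.pairMap_leibniz hy₀
    (fun p => a (i p) (j p)) (fun p => da _ _) (fun p => na _ _)
  have hD : ∀ s t, HasFDerivAt (fun y => contractT (pairMap (G (F y)).toLinearMap₁₂ q)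
      (fun i j => a i j y) s t)
      (∑ i : Fin (2 * q) → Fin n, ∑ j : Fin (2 * q) → Fin n,
        kronecker (Fin.cons s i : Fin (2 * q + 1) → Fin n) (Fin.cons t j) •
          fderiv ℝ (fun y => pairMap (G (F y)).toLinearMap₁₂ q fun p => a (i p) (j p) y) y₀) y₀ :=
    fun s t => HasFDerivAt.fun_sum fun i _ => HasFDerivAt.fun_sum fun j _ =>
      (hterm i j).1.hasFDerivAt.fun_const_smul _
  -- The divergence vanishes.
  have hdiv : ∀ t, ∑ s, fderiv ℝ (fun y => contractT (pairMap (G (F y)).toLinearMap₁₂ q)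
      (fun i j => a i j y) s t) y₀ (o s) = 0 := by
    intro t
    rw [← divergence_contractT (pairMap (G (F y₀)).toLinearMap₁₂ q) (fun i j => a i j y₀)
      (fun s i j => nor G F y₀ (covD G F (a i j) y₀ (o s))) ca t]
    refine Finset.sum_congr rfl fun s _ => ?_
    rw [(hD s t).fderiv]
    simp only [sum_apply, smul_apply, (hterm _ _).2]
  have hHd : DifferentiableAt ℝ H y₀ := by
    have h1 : DifferentiableAt ℝ (fun y => κ • H y) y₀ := by
      refine (hD ⟨0, hn0⟩ ⟨0, hn0⟩).differentiableAt.congr_of_eventuallyEq ?_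
      filter_upwards [hT' ⟨0, hn0⟩ ⟨0, hn0⟩] with y hy
      simpa using hy.symm
    have h2 := h1.const_smul κ⁻¹
    refine h2.congr_of_eventuallyEq (Filter.Eventually.of_forall fun y => ?_)
    simp [hκ]
  have hzero : ∀ t, fderiv ℝ H y₀ (o t) = 0 := by
    intro t
    have h1 := hdiv t
    rw [Finset.sum_eq_single t] at h1
    · rw [(hT' t t).fderiv_eq] at h1
      simp only [if_true] at h1
      rw [fderiv_fun_const_smul hHd, smul_apply, smul_eq_mul] at h1
      exact (mul_eq_zero.1 h1).resolve_left hκ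
    · intro s _ hs
      rw [(hT' s t).fderiv_eq]
      simp [hs]
    · simp
  have : fderiv ℝ H y₀ = 0 := by
    ext u
    rw [eq_sum_of_orthonormal hn (firstForm G F y₀) ho u]
    simp [hzero]
  rw [← this]
  exact hHd.hasFDerivAt

theorem covD_congr {v w : Y → X} {y : Y} (hvw : v =ᶠ[𝓝 y] w) : covD G F v y = covD G F w y := by
  unfold covD
  rw [hvw.fderiv_eq, hvw.self_of_nhds]

theorem covD_smul (κ : ℝ) {v : Y → X} {y : Y} (hv : DifferentiableAt ℝ v y) :
    covD G F (fun y => κ • v y) y = κ • covD G F v y := by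
  unfold covD
  rw [fderiv_fun_const_smul hv, map_smul, ContinuousLinearMap.smul_comp, smul_add]

theorem covD_sum {ι : Type*} (S : Finset ι) {v : ι → Y → X} {y : Y}
    (hv : ∀ i ∈ S, DifferentiableAt ℝ (v i) y) :
    covD G F (fun y => ∑ i ∈ S, v i y) y = ∑ i ∈ S, covD G F (v i) y := by
  unfold covD
  rw [fderiv_fun_sum hv, map_sum, Finset.sum_add_distrib]
  congr 1
  ext u
  simp

/-- A vector field `H` along `F` such that `κ H` times the identity is a Newton transformation of
odd order is differentiable and parallel for the normal connection. -/
theorem IsImmersedOn.nor_covD_eq_zero_of_odd (h : IsImmersedOn G V F U) {y₀ : Y} (hy₀ : y₀ ∈ U)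
    {n : ℕ} (hn : Module.finrank ℝ Y = n) (hn0 : 0 < n) {c : ℝ}
    (hc : ∀ u v, G (F y₀) (curvatureL G (F y₀) u v v) u =
      c * (G (F y₀) u u * G (F y₀) v v - G (F y₀) u v ^ 2))
    {q : ℕ} {κ : ℝ} (hκ : κ ≠ 0) {H : Y → X}
    (hH : ∀ᶠ y in 𝓝 y₀, ∃ o : Fin n → Y,
      (∀ i j, firstForm G F y (o i) (o j) = if i = j then 1 else 0) ∧
      ∀ s t, contractT (oddPairMap (G (F y)).toLinearMap₁₂ q)
        (fun i j => secondForm G F y (o i) (o j)) s t = if s = t then κ • H y else 0) :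
    DifferentiableAt ℝ H y₀ ∧ ∀ u, nor G F y₀ (covD G F H y₀ u) = 0 := by
  obtain ⟨o, ho, -⟩ := hH.self_of_nhds
  obtain ⟨e, e', da, ca, he⟩ := h.exists_codazzi_components hy₀ hc ho
  let a : Fin n → Fin n → Y → X := fun i j y => secondForm G F y (e y i) (e' y j)
  have na : ∀ i j, nor G F y₀ (a i j y₀) = a i j y₀ := fun i j => h.nor_secondForm hy₀ _ _
  -- In the dual frames the Newton transformation is `κ H` times the identity as well.
  have hT' : ∀ s t, (fun y => contractT (oddPairMap (G (F y)).toLinearMap₁₂ q)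
      (fun i j => a i j y) s t) =ᶠ[𝓝 y₀] fun y => if s = t then κ • H y else 0 := by
    intro s t
    filter_upwards [he, hH] with y hy ⟨o', ho', hoT⟩
    exact contractT_dual_frames hn (firstForm G F y) (secondForm G F y) _ _ ho' hy hoT s t
  have hterm := fun i j : Fin (2 * q + 1) → Fin n => h.oddPairMap_leibniz hy₀
    (fun p => a (i p) (j p)) (fun p => da _ _) (fun p => na _ _)
  have hd : ∀ s t, DifferentiableAt ℝ (fun y => contractT (oddPairMap (G (F y)).toLinearMap₁₂ q)
      (fun i j => a i j y) s t) y₀ :=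
    fun s t => DifferentiableAt.fun_sum fun i _ => DifferentiableAt.fun_sum fun j _ =>
      (hterm i j).1.fun_const_smul _
  have hD : ∀ s t, covD G F (fun y => contractT (oddPairMap (G (F y)).toLinearMap₁₂ q)
      (fun i j => a i j y) s t) y₀ =
      ∑ i : Fin (2 * q + 1) → Fin n, ∑ j : Fin (2 * q + 1) → Fin n,
        kronecker (Fin.cons s i : Fin (2 * q + 1 + 1) → Fin n) (Fin.cons t j) •
          covD G F (fun y => oddPairMap (G (F y)).toLinearMap₁₂ q fun p => a (i p) (j p) y) y₀ := by
    intro s t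
    unfold contractT
    rw [covD_sum _ fun i _ => DifferentiableAt.fun_sum fun j _ => (hterm i j).1.fun_const_smul _]
    refine Finset.sum_congr rfl fun i _ => ?_
    rw [covD_sum _ fun j _ => (hterm i j).1.fun_const_smul _]
    exact Finset.sum_congr rfl fun j _ => covD_smul _ (hterm i j).1
  -- The divergence vanishes.
  have hdiv : ∀ t, ∑ s, nor G F y₀ (covD G F
      (fun y => contractT (oddPairMap (G (F y)).toLinearMap₁₂ q)
        (fun i j => a i j y) s t) y₀ (o s)) = 0 := by
    intro t
    rw [← divergence_contractT (oddPairMap (G (F y₀)).toLinearMap₁₂ q) (fun i j => a i j y₀)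
      (fun s i j => nor G F y₀ (covD G F (a i j) y₀ (o s))) ca t]
    refine Finset.sum_congr rfl fun s _ => ?_
    rw [hD s t]
    simp only [sum_apply, smul_apply, map_sum, map_smul, (hterm _ _).2]
  have hHd : DifferentiableAt ℝ H y₀ := by
    have h1 : DifferentiableAt ℝ (fun y => κ • H y) y₀ := by
      refine (hd ⟨0, hn0⟩ ⟨0, hn0⟩).congr_of_eventuallyEq ?_
      filter_upwards [hT' ⟨0, hn0⟩ ⟨0, hn0⟩] with y hy
      simpa using hy.symm
    have h2 := h1.const_smul κ⁻¹
    refine h2.congr_of_eventuallyEq (Filter.Eventually.of_forall fun y => ?_)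
    simp [hκ]
  have hzero : ∀ t, nor G F y₀ (covD G F H y₀ (o t)) = 0 := by
    intro t
    have h1 := hdiv t
    rw [Finset.sum_eq_single t] at h1
    · rw [covD_congr (hT' t t)] at h1
      simp only [if_true] at h1
      rw [covD_smul _ hHd, smul_apply, map_smul] at h1
      exact (smul_eq_zero.1 h1).resolve_left hκ
    · intro s _ hs
      rw [covD_congr (hT' s t)]
      simp [hs, covD_apply]
    · simp
  refine ⟨hHd, fun u => ?_⟩
  rw [eq_sum_of_orthonormal hn (firstForm G F y₀) ho u]
  simp [hzero]

end LocalDivergence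

/-! ### Change of coordinates for the Levi-Civita connection -/

section Coordinates

variable {X Y : Type*} [NormedAddCommGroup X] [NormedSpace ℝ X] [FiniteDimensional ℝ X]
  [NormedAddCommGroup Y] [NormedSpace ℝ Y]
  {G G' : X → X →L[ℝ] X →L[ℝ] ℝ} {V V' : Set X} {τ : X → X}

/-- The transformation law of the Christoffel symbols. -/
theorem IsMetricOn.christoffelL_change (hG : IsMetricOn G V) (hG' : IsMetricOn G' V') {z : X}
    (hz' : z ∈ V') (hz : τ z ∈ V) (hτ : ContDiffAt ℝ ∞ τ z)
    (hsurj : Function.Surjective (fderiv ℝ τ z))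
    (hGG : G' =ᶠ[𝓝 z] fun z => pullbackForm (G (τ z)) (fderiv ℝ τ z)) (v w : X) :
    fderiv ℝ τ z (christoffelL G' z v w) =
      christoffelL G (τ z) (fderiv ℝ τ z v) (fderiv ℝ τ z w) + fderiv ℝ (fderiv ℝ τ) z v w := by
  have dτ : HasFDerivAt τ (fderiv ℝ τ z) z := (hτ.differentiableAt (by simp)).hasFDerivAt
  have dDτ : HasFDerivAt (fderiv ℝ τ) (fderiv ℝ (fderiv ℝ τ) z) z :=
    ((hτ.fderiv_right (m := ∞) (by simp)).differentiableAt (by simp)).hasFDerivAt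
  have hsymm : ∀ a b, fderiv ℝ (fderiv ℝ τ) z a b = fderiv ℝ (fderiv ℝ τ) z b a :=
    (hτ.isSymmSndFDerivAt (by simp; norm_cast)).eq
  have key : ∀ a b c, fderiv ℝ G' z a b c =
      fderiv ℝ G (τ z) (fderiv ℝ τ z a) (fderiv ℝ τ z b) (fderiv ℝ τ z c) +
      G (τ z) (fderiv ℝ (fderiv ℝ τ) z a b) (fderiv ℝ τ z c) +
      G (τ z) (fderiv ℝ τ z b) (fderiv ℝ (fderiv ℝ τ) z a c) := by
    intro a b c
    have hc : ∀ b, HasFDerivAt (fun z => fderiv ℝ τ z b) ((fderiv ℝ (fderiv ℝ τ) z).flip b) z := by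
      intro b
      simpa using dDτ.clm_apply (hasFDerivAt_const b z)
    have h1 : HasFDerivAt (fun z => G' z b c) (((fderiv ℝ G' z).flip b).flip c) z := by
      simpa using ((hG'.differentiableAt hz').hasFDerivAt.clm_apply
        (hasFDerivAt_const b z)).clm_apply (hasFDerivAt_const c z)
    have h2 := (((hG.differentiableAt hz).hasFDerivAt.comp z dτ).clm_apply (hc b)).clm_apply (hc c)
    have h3 : (fun z => G' z b c) =ᶠ[𝓝 z] fun z => (G ∘ τ) z (fderiv ℝ τ z b) (fderiv ℝ τ z c) := by
      filter_upwards [hGG] with z' hz'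
      rw [hz']
      rfl
    have h4 := congrArg (fun L : X →L[ℝ] ℝ => L a) (h1.unique (h2.congr_of_eventuallyEq h3))
    simp only [ContinuousLinearMap.flip_apply, add_apply, ContinuousLinearMap.comp_apply,
      Function.comp_apply] at h4
    rw [h4]
    ring
  refine hG.ext hz fun x => ?_
  obtain ⟨x, rfl⟩ := hsurj x
  have h1 : G (τ z) (fderiv ℝ τ z (christoffelL G' z v w)) (fderiv ℝ τ z x) =
      G' z (christoffelL G' z v w) x := by
    rw [hGG.self_of_nhds]
    rfl
  rw [h1, hG'.christoffel_spec hz', map_add, add_apply, hG.christoffel_spec hz, key, key, key,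
    hsymm w v, hsymm x v, hsymm x w, hG.symm _ hz (fderiv ℝ τ z w) (fderiv ℝ (fderiv ℝ τ) z v x)]
  ring

/-- The covariant derivative of a vector field along a map does not depend on coordinates. -/
theorem IsMetricOn.covD_change (hG : IsMetricOn G V) (hG' : IsMetricOn G' V') {F F' W W' : Y → X}
    {y : Y} (hy' : F' y ∈ V') (hy : τ (F' y) ∈ V) (hτ : ContDiffAt ℝ ∞ τ (F' y))
    (hsurj : Function.Surjective (fderiv ℝ τ (F' y)))
    (hGG : G' =ᶠ[𝓝 (F' y)] fun z => pullbackForm (G (τ z)) (fderiv ℝ τ z))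
    (hF' : DifferentiableAt ℝ F' y) (hW' : DifferentiableAt ℝ W' y)
    (hF : F =ᶠ[𝓝 y] fun y => τ (F' y)) (hW : W =ᶠ[𝓝 y] fun y => fderiv ℝ τ (F' y) (W' y)) (u : Y) :
    covD G F W y u = fderiv ℝ τ (F' y) (covD G' F' W' y u) := by
  have dτ : HasFDerivAt τ (fderiv ℝ τ (F' y)) (F' y) :=
    (hτ.differentiableAt (by simp)).hasFDerivAt
  have dDτ : HasFDerivAt (fderiv ℝ τ) (fderiv ℝ (fderiv ℝ τ) (F' y)) (F' y) :=
    ((hτ.fderiv_right (m := ∞) (by simp)).differentiableAt (by simp)).hasFDerivAt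
  have h1 := ((dτ.comp y hF'.hasFDerivAt).congr_of_eventuallyEq hF).fderiv
  have h2 := (((dDτ.comp y hF'.hasFDerivAt).clm_apply hW'.hasFDerivAt).congr_of_eventuallyEq
    hW).fderiv
  rw [covD_apply, covD_apply, h1, h2, hF.self_of_nhds, hW.self_of_nhds, map_add,
    hG.christoffelL_change hG' hy' hy hτ hsurj hGG]
  simp only [add_apply, ContinuousLinearMap.comp_apply, ContinuousLinearMap.flip_apply,
    Function.comp_apply]
  abel

end Coordinates

/-! ### Charts -/

section Charts

variable {k : ℕ} {N : Type*} [TopologicalSpace N] [ChartedSpace (E k) N] [IsManifold (𝓡 k) ∞ N]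

theorem toChart_isInvertible {p q : N} (hq : q ∈ (extChartAt (𝓡 k) p).source) :
    (toChart k p q).IsInvertible :=
  have := IsManifold.of_le (I := 𝓡 k) (M := N) (m := 1) (n := ∞) (by simp)
  isInvertible_mfderiv_extChartAt hq

theorem toChart_mfderiv_symm {p : N} {y : E k} (hy : y ∈ (extChartAt (𝓡 k) p).target) (v : E k) :
    toChart k p ((extChartAt (𝓡 k) p).symm y)
      (mfderiv 𝓘(ℝ, E k) (𝓡 k) (extChartAt (𝓡 k) p).symm y v) = v := by
  have := IsManifold.of_le (I := 𝓡 k) (M := N) (m := 1) (n := ∞) (by simp)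
  have h := mfderiv_extChartAt_comp_mfderivWithin_extChartAt_symm (I := 𝓡 k) hy
  rw [ModelWithCorners.range_eq_univ, mfderivWithin_univ] at h
  exact congrArg (fun L => L v) h

theorem mfderiv_symm_toChart {p : N} {y : E k} (hy : y ∈ (extChartAt (𝓡 k) p).target)
    (v : TangentSpace (𝓡 k) ((extChartAt (𝓡 k) p).symm y)) :
    mfderiv 𝓘(ℝ, E k) (𝓡 k) (extChartAt (𝓡 k) p).symm y
      (toChart k p ((extChartAt (𝓡 k) p).symm y) v) = v := by
  have := IsManifold.of_le (I := 𝓡 k) (M := N) (m := 1) (n := ∞) (by simp)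
  have h := mfderivWithin_extChartAt_symm_comp_mfderiv_extChartAt (I := 𝓡 k) hy
  rw [ModelWithCorners.range_eq_univ, mfderivWithin_univ] at h
  exact congrArg (fun L => L v) h

/-- In the trivialization of the tangent bundle around `p` the tangent vectors have the coordinates
given by the chart around `p`. -/
theorem trivializationAt_eq_toChart {p q : N} (hq : q ∈ (extChartAt (𝓡 k) p).source)
    (v : TangentSpace (𝓡 k) q) :
    (trivializationAt (E k) (TangentSpace (𝓡 k) : N → Type _) p ⟨q, v⟩).2 = toChart k p q v := by
  have := IsManifold.of_le (I := 𝓡 k) (M := N) (m := 1) (n := ∞) (by simp)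
  have hq' : q ∈ (chartAt (E k) p).source := by simpa using hq
  have h1 := TangentBundle.continuousLinearMapAt_trivializationAt (𝕜 := ℝ) (I := 𝓡 k) hq'
  have h2 := congrFun ((trivializationAt (E k) (TangentSpace (𝓡 k) : N → Type _) p
    ).coe_linearMapAt_of_mem (R := ℝ) (b := q) hq') v
  exact h2.symm.trans (congrArg (fun L => L v) h1)

theorem chartMetric_toChart (g : Metric k N) {p q : N} (hq : q ∈ (extChartAt (𝓡 k) p).source)
    (v w : TangentSpace (𝓡 k) q) :
    chartMetric g p (extChartAt (𝓡 k) p q) (toChart k p q v) (toChart k p q w) =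
      g.inner q v w := by
  obtain ⟨y, hy, rfl⟩ : ∃ y ∈ (extChartAt (𝓡 k) p).target, (extChartAt (𝓡 k) p).symm y = q :=
    ⟨_, (extChartAt (𝓡 k) p).map_source hq, (extChartAt (𝓡 k) p).left_inv hq⟩
  rw [(extChartAt (𝓡 k) p).right_inv hy]
  change g.inner _ (mfderiv 𝓘(ℝ, E k) (𝓡 k) (extChartAt (𝓡 k) p).symm y _)
    (mfderiv 𝓘(ℝ, E k) (𝓡 k) (extChartAt (𝓡 k) p).symm y _) = _
  rw [mfderiv_symm_toChart hy, mfderiv_symm_toChart hy]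

theorem isMetricOn_chartMetric (g : Metric k N) (p : N) :
    IsMetricOn (chartMetric g p) (extChartAt (𝓡 k) p).target where
  isOpen := isOpen_extChartAt_target p
  symm z hz v w := g.symm _ _ _
  pos z hz v hv := by
    refine g.pos _ _ fun h0 => hv ?_
    refine (toChart_mfderiv_symm hz v).symm.trans ?_
    exact (congrArg (toChart k p ((extChartAt (𝓡 k) p).symm z)) h0).trans (map_zero _)
  contDiffOn := by
    have := IsManifold.of_le (I := 𝓡 k) (M := N) (m := 1) (n := ∞) (by simp)
    rw [contDiffOn_clm_apply]
    intro v
    rw [contDiffOn_clm_apply]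
    intro w
    rw [← contMDiffOn_iff_contDiffOn]
    have hsec : ∀ v : E k, ContMDiffOn 𝓘(ℝ, E k) ((𝓡 k).prod 𝓘(ℝ, E k)) ∞
        (fun y => (⟨(extChartAt (𝓡 k) p).symm y,
          mfderiv 𝓘(ℝ, E k) (𝓡 k) (extChartAt (𝓡 k) p).symm y v⟩ : TangentBundle (𝓡 k) N))
        (extChartAt (𝓡 k) p).target := by
      intro v y hy
      let e := trivializationAt (E k) (TangentSpace (𝓡 k) : N → Type _) p
      have hmem : ∀ y ∈ (extChartAt (𝓡 k) p).target,
          (extChartAt (𝓡 k) p).symm y ∈ (chartAt (E k) p).source := fun y hy => by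
        simpa using (extChartAt (𝓡 k) p).map_target hy
      have hsrc : (⟨(extChartAt (𝓡 k) p).symm y,
          mfderiv 𝓘(ℝ, E k) (𝓡 k) (extChartAt (𝓡 k) p).symm y v⟩ : TangentBundle (𝓡 k) N) ∈
            e.source := by
        rw [e.mem_source]
        exact hmem y hy
      refine (e.contMDiffWithinAt_iff (f := fun y => (⟨(extChartAt (𝓡 k) p).symm y,
          mfderiv 𝓘(ℝ, E k) (𝓡 k) (extChartAt (𝓡 k) p).symm y v⟩ : TangentBundle (𝓡 k) N))
            hsrc).2 ⟨contMDiffOn_extChartAt_symm p y hy, ?_⟩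
      refine (contMDiffWithinAt_const (c := v)).congr_of_mem (fun y hy => ?_) hy
      exact (trivializationAt_eq_toChart ((extChartAt (𝓡 k) p).map_target hy) _).trans
        (toChart_mfderiv_symm hy v)
    have hg : ContMDiffOn 𝓘(ℝ, E k) ((𝓡 k).prod 𝓘(ℝ, E k →L[ℝ] E k →L[ℝ] ℝ)) ∞
        (fun y => Bundle.TotalSpace.mk' (E k →L[ℝ] E k →L[ℝ] ℝ)
          (E := fun q : N => TangentSpace (𝓡 k) q →L[ℝ] TangentSpace (𝓡 k) q →L[ℝ] ℝ)
          ((extChartAt (𝓡 k) p).symm y) (g.inner ((extChartAt (𝓡 k) p).symm y)))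
        (extChartAt (𝓡 k) p).target :=
      g.contMDiff.comp_contMDiffOn (contMDiffOn_extChartAt_symm p)
    have h := ContMDiffOn.clm_bundle_apply₂ (F₁ := E k) (F₂ := E k) (F₃ := ℝ)
      (E₃ := Bundle.Trivial N ℝ) hg (hsec v) (hsec w)
    intro y hy
    have hy' := h y hy
    simp only [Bundle.contMDiffWithinAt_totalSpace] at hy'
    exact hy'.2

end Charts

/-! ### Coordinate expressions of maps and vector fields -/

section ChartDerivative

variable {n k : ℕ} {M : Type*} [TopologicalSpace M] [ChartedSpace (E n) M] [IsManifold (𝓡 n) ∞ M]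

theorem contMDiffAt_extChartAt_symm_apply {x₀ x : M} (hx : x ∈ (extChartAt (𝓡 n) x₀).source) :
    ContMDiffAt 𝓘(ℝ, E n) (𝓡 n) ∞ (extChartAt (𝓡 n) x₀).symm (extChartAt (𝓡 n) x₀ x) :=
  (contMDiffOn_extChartAt_symm x₀).contMDiffAt
    ((isOpen_extChartAt_target x₀).mem_nhds ((extChartAt (𝓡 n) x₀).map_source hx))

theorem hasMFDerivAt_of_chart {x₀ x : M} (hx : x ∈ (extChartAt (𝓡 n) x₀).source) {Z : Type*}
    [NormedAddCommGroup Z] [NormedSpace ℝ Z] {h : M → Z}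
    {L : E n →L[ℝ] Z} (hh : HasFDerivAt (fun y => h ((extChartAt (𝓡 n) x₀).symm y)) L
      (extChartAt (𝓡 n) x₀ x)) :
    HasMFDerivAt (𝓡 n) 𝓘(ℝ, Z) h x (L.comp (toChart n x₀ x)) := by
  have := IsManifold.of_le (I := 𝓡 n) (M := M) (m := 1) (n := ∞) (by simp)
  have hx' : x ∈ (chartAt (E n) x₀).source := by simpa using hx
  have h1 : HasMFDerivAt (𝓡 n) 𝓘(ℝ, E n) (extChartAt (𝓡 n) x₀) x (toChart n x₀ x) :=
    (mdifferentiableAt_extChartAt hx').hasMFDerivAt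
  refine (HasMFDerivAt.comp x hh.hasMFDerivAt h1).congr_of_eventuallyEq ?_
  filter_upwards [(isOpen_extChartAt_source (I := 𝓡 n) x₀).mem_nhds hx] with x' hx'
  simp only [Function.comp_apply, (extChartAt (𝓡 n) x₀).left_inv hx']

theorem differentiableAt_chart {x₀ x : M} (hx : x ∈ (extChartAt (𝓡 n) x₀).source) {Z : Type*}
    [NormedAddCommGroup Z] [NormedSpace ℝ Z] {h : M → Z}
    (hh : MDifferentiableAt (𝓡 n) 𝓘(ℝ, Z) h x) :
    DifferentiableAt ℝ (fun y => h ((extChartAt (𝓡 n) x₀).symm y)) (extChartAt (𝓡 n) x₀ x) :=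
  (MDifferentiableAt.comp_of_eq _ hh
    ((contMDiffAt_extChartAt_symm_apply hx).mdifferentiableAt (by simp))
    ((extChartAt (𝓡 n) x₀).left_inv hx)).differentiableAt

theorem mfderiv_eq_fderiv_chart {x₀ x : M} (hx : x ∈ (extChartAt (𝓡 n) x₀).source) {Z : Type*}
    [NormedAddCommGroup Z] [NormedSpace ℝ Z] {h : M → Z} (hh : MDifferentiableAt (𝓡 n) 𝓘(ℝ, Z) h x)
    (u : TangentSpace (𝓡 n) x) :
    mfderiv (𝓡 n) 𝓘(ℝ, Z) h x u =
      fderiv ℝ (fun y => h ((extChartAt (𝓡 n) x₀).symm y)) (extChartAt (𝓡 n) x₀ x)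
        (toChart n x₀ x u) := by
  rw [(hasMFDerivAt_of_chart hx (differentiableAt_chart hx hh).hasFDerivAt).mfderiv]
  rfl

/-- The change of charts from `p` to `p'` on tangent vectors. -/
theorem toChart_change {p p' q : M} (hq : q ∈ (extChartAt (𝓡 n) p).source)
    (hq' : q ∈ (extChartAt (𝓡 n) p').source) (v : TangentSpace (𝓡 n) q) :
    toChart n p' q v = fderiv ℝ (fun y => extChartAt (𝓡 n) p' ((extChartAt (𝓡 n) p).symm y))
      (extChartAt (𝓡 n) p q) (toChart n p q v) := by
  have := IsManifold.of_le (I := 𝓡 n) (M := M) (m := 1) (n := ∞) (by simp)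
  exact mfderiv_eq_fderiv_chart hq (mdifferentiableAt_extChartAt (by simpa using hq')) v

end ChartDerivative

section LocalRep

variable {n m : ℕ} {M : Type*} [TopologicalSpace M] [ChartedSpace (E n) M] [IsManifold (𝓡 n) ∞ M]
  {N : Type*} [TopologicalSpace N] [ChartedSpace (E m) N] [IsManifold (𝓡 m) ∞ N]

/-- The map `f` in the charts around `x₀` and `p`. -/
noncomputable def chartRep (n m : ℕ) {M : Type*} [TopologicalSpace M] [ChartedSpace (E n) M]
    {N : Type*} [TopologicalSpace N] [ChartedSpace (E m) N] (f : M → N) (x₀ : M) (p : N)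
    (y : E n) : E m :=
  extChartAt (𝓡 m) p (f ((extChartAt (𝓡 n) x₀).symm y))

/-- The vector field `V` along `f` in the charts around `x₀` and `p`. -/
noncomputable def fieldRep (n m : ℕ) {M : Type*} [TopologicalSpace M] [ChartedSpace (E n) M]
    {N : Type*} [TopologicalSpace N] [ChartedSpace (E m) N] (f : M → N)
    (V : ∀ x : M, TangentSpace (𝓡 m) (f x)) (x₀ : M) (p : N) (y : E n) : E m :=
  toChart m p (f ((extChartAt (𝓡 n) x₀).symm y)) (V ((extChartAt (𝓡 n) x₀).symm y))

/-- The domain of `chartRep`. -/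
def chartDomain (n m : ℕ) {M : Type*} [TopologicalSpace M] [ChartedSpace (E n) M]
    {N : Type*} [TopologicalSpace N] [ChartedSpace (E m) N] (f : M → N) (x₀ : M) (p : N) :
    Set (E n) :=
  (extChartAt (𝓡 n) x₀).target ∩
    (extChartAt (𝓡 n) x₀).symm ⁻¹' (f ⁻¹' (extChartAt (𝓡 m) p).source)

variable {f : M → N} {x₀ x : M} {p : N}

theorem chartRep_apply (hx : x ∈ (extChartAt (𝓡 n) x₀).source) :
    chartRep n m f x₀ p (extChartAt (𝓡 n) x₀ x) = extChartAt (𝓡 m) p (f x) :=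
  congrArg (fun x => extChartAt (𝓡 m) p (f x)) ((extChartAt (𝓡 n) x₀).left_inv hx)

theorem fieldRep_apply (V : ∀ x : M, TangentSpace (𝓡 m) (f x))
    (hx : x ∈ (extChartAt (𝓡 n) x₀).source) :
    fieldRep n m f V x₀ p (extChartAt (𝓡 n) x₀ x) = toChart m p (f x) (V x) :=
  congrArg (fun x => (toChart m p (f x) (V x) : E m)) ((extChartAt (𝓡 n) x₀).left_inv hx)

theorem mem_chartDomain (hx : x ∈ (extChartAt (𝓡 n) x₀).source)
    (hp : f x ∈ (extChartAt (𝓡 m) p).source) : extChartAt (𝓡 n) x₀ x ∈ chartDomain n m f x₀ p := by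
  refine ⟨(extChartAt (𝓡 n) x₀).map_source hx, ?_⟩
  rw [Set.mem_preimage, (extChartAt (𝓡 n) x₀).left_inv hx]
  exact hp

theorem exists_of_mem_chartDomain {y : E n} (hy : y ∈ chartDomain n m f x₀ p) :
    ∃ x ∈ (extChartAt (𝓡 n) x₀).source, f x ∈ (extChartAt (𝓡 m) p).source ∧
      extChartAt (𝓡 n) x₀ x = y :=
  ⟨(extChartAt (𝓡 n) x₀).symm y, (extChartAt (𝓡 n) x₀).map_target hy.1, hy.2,
    (extChartAt (𝓡 n) x₀).right_inv hy.1⟩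

theorem isOpen_chartDomain (hf : Continuous f) : IsOpen (chartDomain n m f x₀ p) :=
  (continuousOn_extChartAt_symm x₀).isOpen_inter_preimage (isOpen_extChartAt_target x₀)
    ((isOpen_extChartAt_source p).preimage hf)

theorem contDiffOn_chartRep (hf : ContMDiff (𝓡 n) (𝓡 m) ∞ f) :
    ContDiffOn ℝ ∞ (chartRep n m f x₀ p) (chartDomain n m f x₀ p) := by
  rw [← contMDiffOn_iff_contDiffOn]
  refine (contMDiffOn_extChartAt (I := 𝓡 m) (x := p)).comp
    (hf.comp_contMDiffOn ((contMDiffOn_extChartAt_symm x₀).mono Set.inter_subset_left)) ?_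
  intro y hy
  have := hy.2
  simpa using this

theorem fderiv_chartRep (hf : ContMDiff (𝓡 n) (𝓡 m) ∞ f)
    (hx : x ∈ (extChartAt (𝓡 n) x₀).source) (hp : f x ∈ (extChartAt (𝓡 m) p).source)
    (u : TangentSpace (𝓡 n) x) :
    fderiv ℝ (chartRep n m f x₀ p) (extChartAt (𝓡 n) x₀ x) (toChart n x₀ x u) =
      toChart m p (f x) (diff n m f x u) := by
  have := IsManifold.of_le (I := 𝓡 m) (M := N) (m := 1) (n := ∞) (by simp)
  have hfd : MDifferentiableAt (𝓡 n) (𝓡 m) f x := (hf x).mdifferentiableAt (by simp)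
  have hψ : MDifferentiableAt (𝓡 m) 𝓘(ℝ, E m) (extChartAt (𝓡 m) p) (f x) :=
    mdifferentiableAt_extChartAt (by simpa using hp)
  have h1 := mfderiv_eq_fderiv_chart hx (hψ.comp x hfd) u
  refine h1.symm.trans ?_
  rw [mfderiv_comp x hψ hfd]
  rfl

theorem isImmersedOn_chartRep (g : Metric m N) (hf : IsSmoothImmersion n m f) (x₀ : M) (p : N) :
    IsImmersedOn (chartMetric g p) (extChartAt (𝓡 m) p).target (chartRep n m f x₀ p)
      (chartDomain n m f x₀ p) where
  metric := isMetricOn_chartMetric g p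
  isOpen := isOpen_chartDomain hf.1.continuous
  contDiffOn := contDiffOn_chartRep hf.1
  mapsTo y hy := (extChartAt (𝓡 m) p).map_source hy.2
  injective y hy := by
    obtain ⟨x, hx, hp, rfl⟩ := exists_of_mem_chartDomain hy
    intro u v huv
    obtain ⟨u, rfl⟩ := (toChart_isInvertible hx).surjective u
    obtain ⟨v, rfl⟩ := (toChart_isInvertible hx).surjective v
    have h1 := ((fderiv_chartRep hf.1 hx hp u).symm.trans huv).trans
      (fderiv_chartRep hf.1 hx hp v)
    rw [hf.2 x ((toChart_isInvertible hp).injective h1)]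

/-- The connection along `f` may be computed in every pair of charts. -/
theorem toChart_covAlong (g : Metric m N) (hf : ContMDiff (𝓡 n) (𝓡 m) ∞ f)
    (V : ∀ x : M, TangentSpace (𝓡 m) (f x)) (hx : x ∈ (extChartAt (𝓡 n) x₀).source)
    (hp : f x ∈ (extChartAt (𝓡 m) p).source)
    (hV : DifferentiableAt ℝ (fieldRep n m f V x₀ p) (extChartAt (𝓡 n) x₀ x))
    (u : TangentSpace (𝓡 n) x) :
    toChart m p (f x) (covAlong g f V x u) =
      covD (chartMetric g p) (chartRep n m f x₀ p) (fieldRep n m f V x₀ p)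
        (extChartAt (𝓡 n) x₀ x) (toChart n x₀ x u) := by
  set y := extChartAt (𝓡 n) x₀ x with hy
  have hfx : f x ∈ (extChartAt (𝓡 m) (f x)).source := mem_extChartAt_source (f x)
  let τ : E m → E m := fun z => extChartAt (𝓡 m) (f x) ((extChartAt (𝓡 m) p).symm z)
  have hF'y : chartRep n m f x₀ p y = extChartAt (𝓡 m) p (f x) := chartRep_apply hx
  have hdom : ∀ᶠ y' in 𝓝 y, y' ∈ chartDomain n m f x₀ p ∩ chartDomain n m f x₀ (f x) :=
    ((isOpen_chartDomain hf.continuous).inter (isOpen_chartDomain hf.continuous)).mem_nhds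
      ⟨mem_chartDomain hx hp, mem_chartDomain hx hfx⟩
  have hF : chartRep n m f x₀ (f x) =ᶠ[𝓝 y] fun y => τ (chartRep n m f x₀ p y) := by
    filter_upwards [hdom] with y' hy'
    exact congrArg (extChartAt (𝓡 m) (f x)) ((extChartAt (𝓡 m) p).left_inv hy'.1.2).symm
  have hW : fieldRep n m f V x₀ (f x) =ᶠ[𝓝 y] fun y =>
      fderiv ℝ τ (chartRep n m f x₀ p y) (fieldRep n m f V x₀ p y) := by
    filter_upwards [hdom] with y' hy'
    exact toChart_change hy'.1.2 hy'.2.2 _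
  have hτ : ContDiffAt ℝ ∞ τ (extChartAt (𝓡 m) p (f x)) := by
    rw [← contMDiffAt_iff_contDiffAt]
    refine ContMDiffAt.comp_of_eq (y := f x) ?_ (contMDiffAt_extChartAt_symm_apply hp)
      ((extChartAt (𝓡 m) p).left_inv hp)
    exact contMDiffAt_extChartAt
  have hsurj : Function.Surjective (fderiv ℝ τ (extChartAt (𝓡 m) p (f x))) := by
    intro w
    obtain ⟨v, rfl⟩ := (toChart_isInvertible hfx).surjective w
    exact ⟨_, (toChart_change hp hfx v).symm⟩
  have hGG : chartMetric g p =ᶠ[𝓝 (extChartAt (𝓡 m) p (f x))] fun z =>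
      pullbackForm (chartMetric g (f x) (τ z)) (fderiv ℝ τ z) := by
    have hopen : IsOpen ((extChartAt (𝓡 m) p).target ∩
        (extChartAt (𝓡 m) p).symm ⁻¹' (extChartAt (𝓡 m) (f x)).source) :=
      (continuousOn_extChartAt_symm p).isOpen_inter_preimage (isOpen_extChartAt_target p)
        (isOpen_extChartAt_source _)
    have hmem : extChartAt (𝓡 m) p (f x) ∈ (extChartAt (𝓡 m) p).target ∩
        (extChartAt (𝓡 m) p).symm ⁻¹' (extChartAt (𝓡 m) (f x)).source := by
      refine ⟨(extChartAt (𝓡 m) p).map_source hp, ?_⟩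
      rw [Set.mem_preimage, (extChartAt (𝓡 m) p).left_inv hp]
      exact hfx
    filter_upwards [hopen.mem_nhds hmem] with z hz
    obtain ⟨q, hq, rfl⟩ : ∃ q ∈ (extChartAt (𝓡 m) p).source, extChartAt (𝓡 m) p q = z :=
      ⟨_, (extChartAt (𝓡 m) p).map_target hz.1, (extChartAt (𝓡 m) p).right_inv hz.1⟩
    have hq' : q ∈ (extChartAt (𝓡 m) (f x)).source := by
      have := hz.2
      rwa [Set.mem_preimage, (extChartAt (𝓡 m) p).left_inv hq] at this
    have hτq : τ (extChartAt (𝓡 m) p q) = extChartAt (𝓡 m) (f x) q :=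
      congrArg (extChartAt (𝓡 m) (f x)) ((extChartAt (𝓡 m) p).left_inv hq)
    ext v w
    obtain ⟨v, rfl⟩ := (toChart_isInvertible hq).surjective v
    obtain ⟨w, rfl⟩ := (toChart_isInvertible hq).surjective w
    rw [pullbackForm_apply, hτq]
    refine (chartMetric_toChart g hq v w).trans ((chartMetric_toChart g hq' v w).symm.trans ?_)
    exact congrArg₂ (fun a b => chartMetric g (f x) (extChartAt (𝓡 m) (f x) q) a b)
      (toChart_change hq hq' v) (toChart_change hq hq' w)
  have hF'd : DifferentiableAt ℝ (chartRep n m f x₀ p) y :=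
    ((contDiffOn_chartRep hf).contDiffAt ((isOpen_chartDomain hf.continuous).mem_nhds
      (mem_chartDomain hx hp))).differentiableAt (by simp)
  have hchange := (isMetricOn_chartMetric g (f x)).covD_change (isMetricOn_chartMetric g p)
    (F := chartRep n m f x₀ (f x)) (F' := chartRep n m f x₀ p) (y := y) (τ := τ)
    (W := fieldRep n m f V x₀ (f x)) (W' := fieldRep n m f V x₀ p)
    (by rw [hF'y]; exact (extChartAt (𝓡 m) p).map_source hp)
    (by
      rw [hF'y]
      change extChartAt (𝓡 m) (f x) ((extChartAt (𝓡 m) p).symm _) ∈ _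
      rw [(extChartAt (𝓡 m) p).left_inv hp]
      exact (extChartAt (𝓡 m) (f x)).map_source hfx)
    (by rw [hF'y]; exact hτ) (by rw [hF'y]; exact hsurj) (by rw [hF'y]; exact hGG) hF'd hV hF hW
    (toChart n x₀ x u)
  have hWd : DifferentiableAt ℝ (fieldRep n m f V x₀ (f x)) y := by
    have h1 : DifferentiableAt ℝ (fderiv ℝ τ) (chartRep n m f x₀ p y) := by
      rw [hF'y]
      exact (hτ.fderiv_right (m := ∞) (by simp)).differentiableAt (by simp)
    exact ((h1.comp y hF'd).clm_apply hV).congr_of_eventuallyEq hW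
  -- In the charts around `x₀` and `f x` the formula is the definition of `covAlong`.
  have hdef : toChart m (f x) (f x) (covAlong g f V x u) =
      covD (chartMetric g (f x)) (chartRep n m f x₀ (f x)) (fieldRep n m f V x₀ (f x)) y
        (toChart n x₀ x u) := by
    let dV : TangentSpace (𝓡 n) x →L[ℝ] E m :=
      mfderiv (𝓡 n) 𝓘(ℝ, E m) (fun x' => toChart m (f x) (f x') (V x')) x
    have h1 : dV = _ := (hasMFDerivAt_of_chart hx
      (h := fun x' => (toChart m (f x) (f x') (V x') : E m)) hWd.hasFDerivAt).mfderiv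
    have h2 := (toChart_isInvertible hfx).self_apply_inverse (dV u +
      christoffel (chartMetric g (f x)) (extChartAt (𝓡 m) (f x) (f x))
        (toChart m (f x) (f x) (diff n m f x u)) (toChart m (f x) (f x) (V x)))
    refine h2.trans ?_
    rw [covD_apply, chartRep_apply hx, fieldRep_apply V hx, fderiv_chartRep hf hx hfx,
      christoffel_eq, h1]
    rfl
  rw [hF'y] at hchange
  obtain ⟨w, hw⟩ := (toChart_isInvertible hp).surjective (covD (chartMetric g p)
    (chartRep n m f x₀ p) (fieldRep n m f V x₀ p) y (toChart n x₀ x u))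
  rw [← hw] at hchange ⊢
  have h3 := hdef.trans (hchange.trans (toChart_change hp hfx w).symm)
  rw [(toChart_isInvertible hfx).injective h3]

end LocalRep

/-! ### Second fundamental forms in charts -/

section SecondFormInCharts

variable {n m : ℕ} {M : Type*} [TopologicalSpace M] [ChartedSpace (E n) M] [IsManifold (𝓡 n) ∞ M]
  {N : Type*} [TopologicalSpace N] [ChartedSpace (E m) N] [IsManifold (𝓡 m) ∞ N]
  {f : M → N} {x₀ x : M} {p : N}

/-- Differentiability of a vector field along `f` may be checked in charts. -/
theorem mdifferentiableAt_field_iff (hf : MDifferentiableAt (𝓡 n) (𝓡 m) f x)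
    (V : ∀ x : M, TangentSpace (𝓡 m) (f x)) (hx : x ∈ (extChartAt (𝓡 n) x₀).source)
    (hp : f x ∈ (extChartAt (𝓡 m) p).source) :
    MDifferentiableAt (𝓡 n) ((𝓡 m).prod 𝓘(ℝ, E m))
      (fun x => (⟨f x, V x⟩ : TangentBundle (𝓡 m) N)) x ↔
    DifferentiableAt ℝ (fieldRep n m f V x₀ p) (extChartAt (𝓡 n) x₀ x) := by
  have := IsManifold.of_le (I := 𝓡 m) (M := N) (m := 1) (n := ∞) (by simp)
  let e := trivializationAt (E m) (TangentSpace (𝓡 m) : N → Type _) p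
  have hp' : f x ∈ (chartAt (E m) p).source := by simpa using hp
  have hsrc : (⟨f x, V x⟩ : TangentBundle (𝓡 m) N) ∈ e.source := by
    rw [e.mem_source]
    exact hp'
  have h1 := e.mdifferentiableAt_totalSpace_iff (IB := 𝓡 m) (IM := 𝓡 n)
    (fun x => (⟨f x, V x⟩ : TangentBundle (𝓡 m) N)) (x₀ := x) hsrc
  have h2 : (fun x => (e (⟨f x, V x⟩ : TangentBundle (𝓡 m) N)).2) =ᶠ[𝓝 x]
      fun x => (toChart m p (f x) (V x) : E m) := by
    filter_upwards [hf.continuousAt.preimage_mem_nhds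
      ((isOpen_extChartAt_source (I := 𝓡 m) p).mem_nhds hp)] with x' hx'
    exact trivializationAt_eq_toChart hx' (V x')
  rw [h1, and_iff_right hf, h2.mdifferentiableAt_iff]
  exact ⟨differentiableAt_chart hx,
    fun h => (hasMFDerivAt_of_chart hx h.hasFDerivAt).mdifferentiableAt⟩

theorem firstForm_toChart (g : Metric m N) (hf : ContMDiff (𝓡 n) (𝓡 m) ∞ f)
    (hx : x ∈ (extChartAt (𝓡 n) x₀).source) (hp : f x ∈ (extChartAt (𝓡 m) p).source)
    (u v : TangentSpace (𝓡 n) x) :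
    firstForm (chartMetric g p) (chartRep n m f x₀ p) (extChartAt (𝓡 n) x₀ x)
      (toChart n x₀ x u) (toChart n x₀ x v) = inducedForm g f x u v := by
  unfold firstForm
  rw [pullbackForm_apply, fderiv_chartRep hf hx hp, fderiv_chartRep hf hx hp, chartRep_apply hx]
  exact chartMetric_toChart g hp _ _

theorem inducedForm_isInvertible (g : Metric m N) (hf : Function.Injective (diff n m f x)) :
    (inducedForm (n := n) g f x).IsInvertible := by
  refine isInvertible_of_pos (X := E n) (b := inducedForm (n := n) g f x) fun v hv => ?_
  exact g.pos (f x) (diff n m f x v) fun h => hv (hf (h.trans (map_zero (diff n m f x)).symm))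

theorem inner_tangentialPart (g : Metric m N) (hf : Function.Injective (diff n m f x))
    (w : TangentSpace (𝓡 m) (f x)) (u : TangentSpace (𝓡 n) x) :
    g.inner (f x) (tangentialPart (n := n) g f x w) (diff n m f x u) =
      g.inner (f x) w (diff n m f x u) := by
  have h := (inducedForm_isInvertible g hf).self_apply_inverse
    ((g.inner (f x) w).comp (diff n m f x))
  exact congrArg (fun L => L u) h

theorem toChart_normalPart (g : Metric m N) (hf : IsSmoothImmersion n m f)
    (hx : x ∈ (extChartAt (𝓡 n) x₀).source) (hp : f x ∈ (extChartAt (𝓡 m) p).source)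
    (w : TangentSpace (𝓡 m) (f x)) :
    toChart m p (f x) (normalPart (n := n) g f x w) =
      nor (chartMetric g p) (chartRep n m f x₀ p) (extChartAt (𝓡 n) x₀ x)
        (toChart m p (f x) w) := by
  have him := isImmersedOn_chartRep g hf x₀ p
  have hy : extChartAt (𝓡 n) x₀ x ∈ chartDomain n m f x₀ p := mem_chartDomain hx hp
  have hdec : toChart m p (f x) w =
      toChart m p (f x) (normalPart (n := n) g f x w) +
      toChart m p (f x) (tangentialPart (n := n) g f x w) := by
    rw [← map_add]
    unfold normalPart
    rw [sub_add_cancel]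
  have htan : nor (chartMetric g p) (chartRep n m f x₀ p) (extChartAt (𝓡 n) x₀ x)
      (toChart m p (f x) (tangentialPart (n := n) g f x w)) = 0 := by
    unfold tangentialPart
    rw [← fderiv_chartRep hf.1 hx hp]
    exact him.nor_tangent hy _
  rw [hdec, map_add, htan, add_zero]
  refine (him.nor_of_orth hy fun u => ?_).symm
  obtain ⟨u, rfl⟩ := (toChart_isInvertible hx).surjective u
  rw [fderiv_chartRep hf.1 hx hp, chartRep_apply hx]
  refine (chartMetric_toChart g hp _ _).trans ?_
  unfold normalPart
  rw [map_sub]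
  exact sub_eq_zero.2 (inner_tangentialPart g (hf.2 x) w u).symm

theorem toChart_secondFundamentalForm (g : Metric m N) (hf : IsSmoothImmersion n m f)
    (hx : x ∈ (extChartAt (𝓡 n) x₀).source) (hp : f x ∈ (extChartAt (𝓡 m) p).source)
    (u v : TangentSpace (𝓡 n) x) :
    toChart m p (f x) (secondFundamentalForm g f x u v) =
      secondForm (chartMetric g p) (chartRep n m f x₀ p) (extChartAt (𝓡 n) x₀ x)
        (toChart n x₀ x u) (toChart n x₀ x v) := by
  have := IsManifold.of_le (I := 𝓡 n) (M := M) (m := 1) (n := ∞) (by simp)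
  have him := isImmersedOn_chartRep g hf x₀ p
  have hy : extChartAt (𝓡 n) x₀ x ∈ chartDomain n m f x₀ p := mem_chartDomain hx hp
  let ξ : ∀ x' : M, TangentSpace (𝓡 n) x' := FiberBundle.extend (E n) v
  have hξx : ξ x = v := FiberBundle.extend_apply_self (E n) v
  -- The coordinate expression `θ` of the local extension `ξ` of `v`.
  let θ : E n → E n := fieldRep n n (id : M → M) ξ x₀ x₀
  have hθ : DifferentiableAt ℝ θ (extChartAt (𝓡 n) x₀ x) :=
    (mdifferentiableAt_field_iff (f := (id : M → M)) mdifferentiableAt_id ξ hx hx).1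
      (FiberBundle.mdifferentiableAt_extend (I := 𝓡 n) (F := E n) v)
  have hθx : θ (extChartAt (𝓡 n) x₀ x) = toChart n x₀ x v :=
    (fieldRep_apply (f := (id : M → M)) ξ hx).trans (congrArg (toChart n x₀ x) hξx)
  have hV : fieldRep n m f (fun x' => diff n m f x' (ξ x')) x₀ p =ᶠ[𝓝 (extChartAt (𝓡 n) x₀ x)]
      fun y => fderiv ℝ (chartRep n m f x₀ p) y (θ y) := by
    filter_upwards [him.isOpen.mem_nhds hy] with y' hy'
    obtain ⟨x', hx', hp', rfl⟩ := exists_of_mem_chartDomain hy'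
    rw [fieldRep_apply _ hx', ← fderiv_chartRep hf.1 hx' hp']
    exact congrArg _ (fieldRep_apply (f := (id : M → M)) ξ hx').symm
  have hVd : DifferentiableAt ℝ (fun y => fderiv ℝ (chartRep n m f x₀ p) y (θ y))
      (extChartAt (𝓡 n) x₀ x) := (him.differentiableAt_fderiv hy).clm_apply hθ
  unfold secondFundamentalForm
  rw [map_neg, toChart_normalPart g hf hx hp,
    toChart_covAlong g hf.1 _ hx hp (hVd.congr_of_eventuallyEq hV), covD_congr hV,
    him.covD_tangent hy hθ, map_add, him.nor_tangent hy, zero_add, hθx, secondForm_apply]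

theorem inner_secondFundamentalForm (g : Metric m N) (hf : IsSmoothImmersion n m f)
    (u v w : TangentSpace (𝓡 n) x) :
    g.inner (f x) (secondFundamentalForm g f x u v) (diff n m f x w) = 0 := by
  unfold secondFundamentalForm normalPart
  rw [map_neg, neg_apply, map_sub]
  exact neg_eq_zero.2 (sub_eq_zero.2 (inner_tangentialPart g (hf.2 x) _ w).symm)

end SecondFormInCharts

/-! ### Naturality of the contractions -/

section Naturality

variable {n : ℕ} {W W' : Type*} [AddCommGroup W] [Module ℝ W] [AddCommGroup W'] [Module ℝ W']

theorem contractT_pairMap_comp (h : W →ₗ[ℝ] W →ₗ[ℝ] ℝ) (h' : W' →ₗ[ℝ] W' →ₗ[ℝ] ℝ)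
    (L : W →ₗ[ℝ] W') (hL : ∀ v w, h' (L v) (L w) = h v w) (q : ℕ) (a : Fin n → Fin n → W)
    (s t : Fin n) :
    contractT (pairMap h' q) (fun i j => L (a i j)) s t = contractT (pairMap h q) a s t := by
  simp only [contractT, pairMap_apply, hL]

theorem contractT_oddPairMap_comp (h : W →ₗ[ℝ] W →ₗ[ℝ] ℝ) (h' : W' →ₗ[ℝ] W' →ₗ[ℝ] ℝ)
    (L : W →ₗ[ℝ] W') (hL : ∀ v w, h' (L v) (L w) = h v w) (q : ℕ) (a : Fin n → Fin n → W)
    (s t : Fin n) :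
    contractT (oddPairMap h' q) (fun i j => L (a i j)) s t =
      L (contractT (oddPairMap h q) a s t) := by
  simp only [contractT, oddPairMap_apply, pairMap_apply, hL, map_sum, map_smul]

theorem contractT_oddPairMap_mem (h : W →ₗ[ℝ] W →ₗ[ℝ] ℝ) {S : Submodule ℝ W} (q : ℕ)
    {a : Fin n → Fin n → W} (ha : ∀ i j, a i j ∈ S) (s t : Fin n) :
    contractT (oddPairMap h q) a s t ∈ S :=
  S.sum_mem fun _ _ => S.sum_mem fun _ _ => S.smul_mem _ (S.smul_mem _ (ha _ _))

end Naturality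

/-! ### Newton transformations proportional to the identity -/

section Parallel

variable {n m : ℕ} {M : Type*} [TopologicalSpace M] [ChartedSpace (E n) M] [IsManifold (𝓡 n) ∞ M]
  {N : Type*} [TopologicalSpace N] [ChartedSpace (E m) N] [IsManifold (𝓡 m) ∞ N]
  {f : M → N}

theorem isLocallyConstant_of_hasMFDerivAt_zero {H : M → ℝ}
    (hH : ∀ x, HasMFDerivAt (𝓡 n) 𝓘(ℝ, ℝ) H x 0) : IsLocallyConstant H := by
  refine (IsLocallyConstant.iff_eventually_eq H).2 fun x => ?_
  have hzero : ∀ y ∈ (extChartAt (𝓡 n) x).target,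
      HasFDerivAt (fun y => H ((extChartAt (𝓡 n) x).symm y)) (0 : E n →L[ℝ] ℝ) y := by
    intro y hy
    have h1 : MDifferentiableAt 𝓘(ℝ, E n) (𝓡 n) (extChartAt (𝓡 n) x).symm y :=
      ((contMDiffOn_extChartAt_symm (n := ∞) x).contMDiffAt
        ((isOpen_extChartAt_target x).mem_nhds hy)).mdifferentiableAt (by simp)
    have h2 := ((hH _).comp y h1.hasMFDerivAt).hasFDerivAt
    exact h2.congr_fderiv (ContinuousLinearMap.ext fun _ => rfl)
  obtain ⟨ε, hε, hball⟩ := Metric.isOpen_iff.1 (isOpen_extChartAt_target (I := 𝓡 n) x) _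
    (mem_extChartAt_target x)
  filter_upwards [(continuousAt_extChartAt (I := 𝓡 n) x).preimage_mem_nhds
    (Metric.ball_mem_nhds _ hε), (isOpen_extChartAt_source (I := 𝓡 n) x).mem_nhds
    (mem_extChartAt_source x)] with x' hx' hs
  have h := (convex_ball (extChartAt (𝓡 n) x x) ε).is_const_of_fderivWithin_eq_zero (𝕜 := ℝ)
    (f := fun y => H ((extChartAt (𝓡 n) x).symm y))
    (fun y hy => (hzero y (hball hy)).differentiableAt.differentiableWithinAt)
    (fun y hy => by
      rw [fderivWithin_of_isOpen Metric.isOpen_ball hy, (hzero y (hball hy)).fderiv])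
    hx' (Metric.mem_ball_self hε)
  simpa only [(extChartAt (𝓡 n) x).left_inv hs, extChartAt_to_inv] using h

theorem _root_.IsLocallyConstant.isParallelFunction {H : M → ℝ} (hH : IsLocallyConstant H) :
    IsParallelFunction n H :=
  ⟨fun x => (hasMFDerivAt_const (H x) x).congr_of_eventuallyEq
      ((IsLocallyConstant.iff_eventually_eq H).1 hH x),
    fun _ _ hy => hH.apply_eq_of_isPreconnected isPreconnected_connectedComponent
      mem_connectedComponent hy⟩

/-- The hypothesis on the curvature, at the image of a point and in terms of `curvatureL`. -/
theorem HasConstantCurvature.curvatureL_eq {g : Metric m N} {c : ℝ} (hg : HasConstantCurvature g c)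
    {p : N} {z : E m} (hz : z ∈ (extChartAt (𝓡 m) p).target) (u v : E m) :
    chartMetric g p z (curvatureL (chartMetric g p) z u v v) u =
      c * (chartMetric g p z u u * chartMetric g p z v v - chartMetric g p z u v ^ 2) := by
  rw [← (isMetricOn_chartMetric g p).curvature_eq hz]
  exact hg p z hz u v

/-- If the contraction defining the Newton transformation of even order `2q` is, in some orthonormal
frame at each point, `κ H` times the identity with `κ ≠ 0`, then `H` is parallel. -/
theorem isParallelFunction_of_contractT_eq {g : Metric m N} {c : ℝ} (hg : HasConstantCurvature g c)
    (hf : IsSmoothImmersion n m f) (hn0 : 0 < n) {q : ℕ} {κ : ℝ} (hκ : κ ≠ 0) {H : M → ℝ}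
    (hH : ∀ x, ∃ o : Fin n → TangentSpace (𝓡 n) x, IsOrthonormalFrame g f x o ∧
      ∀ s t, contractT (pairMap (g.inner (f x)).toLinearMap₁₂ q)
        (fun i j => secondFundamentalForm g f x (o i) (o j)) s t =
          if s = t then κ • H x else 0) : IsParallelFunction n H := by
  refine (isLocallyConstant_of_hasMFDerivAt_zero (n := n) fun x => ?_).isParallelFunction
  have him := isImmersedOn_chartRep g hf x (f x)
  have hx := mem_extChartAt_source (I := 𝓡 n) x
  have hy := mem_chartDomain hx (mem_extChartAt_source (I := 𝓡 m) (f x))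
  have h := him.hasFDerivAt_zero_of_even (n := n) (q := q) (κ := κ)
    (H := fun y => H ((extChartAt (𝓡 n) x).symm y)) hy finrank_euclideanSpace_fin hn0
    (hg.curvatureL_eq (him.mapsTo hy)) hκ ?_
  · exact hasMFDerivAt_of_chart hx h
  · filter_upwards [him.isOpen.mem_nhds hy] with y' hy'
    obtain ⟨x', hx', hp', rfl⟩ := exists_of_mem_chartDomain hy'
    obtain ⟨o, ho, hT⟩ := hH x'
    refine ⟨fun i => toChart n x x' (o i), fun i j => ?_, fun s t => ?_⟩
    · exact (firstForm_toChart g hf.1 hx' hp' _ _).trans (ho i j)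
    · have h1 := contractT_pairMap_comp (g.inner (f x')).toLinearMap₁₂
        (chartMetric g (f x) (extChartAt (𝓡 m) (f x) (f x'))).toLinearMap₁₂
        (toChart m (f x) (f x')).toLinearMap (fun v w => chartMetric_toChart g hp' v w) q
        (fun i j => secondFundamentalForm g f x' (o i) (o j)) s t
      rw [(extChartAt (𝓡 n) x).left_inv hx', ← hT s t, ← h1, chartRep_apply hx']
      congr 1
      funext i j
      exact (toChart_secondFundamentalForm g hf hx' hp' _ _).symm

/-- The analogue of `isParallelFunction_of_contractT_eq` in odd order `2q + 1`. -/
theorem isParallelNormalField_of_contractT_eq {g : Metric m N} {c : ℝ}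
    (hg : HasConstantCurvature g c)
    (hf : IsSmoothImmersion n m f) (hn0 : 0 < n) {q : ℕ} {κ : ℝ} (hκ : κ ≠ 0)
    {V : ∀ x : M, TangentSpace (𝓡 m) (f x)}
    (hV : ∀ x, ∃ o : Fin n → TangentSpace (𝓡 n) x, IsOrthonormalFrame g f x o ∧
      ∀ s t, contractT (oddPairMap (g.inner (f x)).toLinearMap₁₂ q)
        (fun i j => secondFundamentalForm g f x (o i) (o j)) s t =
          if s = t then κ • V x else 0) : IsParallelNormalField (n := n) g f V := by
  have key : ∀ x : M, DifferentiableAt ℝ (fieldRep n m f V x (f x)) (extChartAt (𝓡 n) x x) ∧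
      ∀ u, nor (chartMetric g (f x)) (chartRep n m f x (f x)) (extChartAt (𝓡 n) x x)
        (covD (chartMetric g (f x)) (chartRep n m f x (f x)) (fieldRep n m f V x (f x))
          (extChartAt (𝓡 n) x x) u) = 0 := by
    intro x
    have him := isImmersedOn_chartRep g hf x (f x)
    have hx := mem_extChartAt_source (I := 𝓡 n) x
    have hy := mem_chartDomain hx (mem_extChartAt_source (I := 𝓡 m) (f x))
    refine him.nor_covD_eq_zero_of_odd (n := n) (q := q) (κ := κ) hy finrank_euclideanSpace_fin hn0
      (hg.curvatureL_eq (him.mapsTo hy)) hκ ?_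
    filter_upwards [him.isOpen.mem_nhds hy] with y' hy'
    obtain ⟨x', hx', hp', rfl⟩ := exists_of_mem_chartDomain hy'
    obtain ⟨o, ho, hT⟩ := hV x'
    refine ⟨fun i => toChart n x x' (o i), fun i j => ?_, fun s t => ?_⟩
    · exact (firstForm_toChart g hf.1 hx' hp' _ _).trans (ho i j)
    · have h1 := contractT_oddPairMap_comp (g.inner (f x')).toLinearMap₁₂
        (chartMetric g (f x) (extChartAt (𝓡 m) (f x) (f x'))).toLinearMap₁₂
        (toChart m (f x) (f x')).toLinearMap (fun v w => chartMetric_toChart g hp' v w) q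
        (fun i j => secondFundamentalForm g f x' (o i) (o j)) s t
      rw [hT] at h1
      have h2 : (toChart m (f x) (f x')).toLinearMap (if s = t then κ • V x' else 0) =
          if s = t then κ • fieldRep n m f V x (f x) (extChartAt (𝓡 n) x x') else 0 := by
        rw [fieldRep_apply V hx']
        split_ifs
        · exact map_smul _ _ _
        · exact map_zero _
      rw [← h2, ← h1, chartRep_apply hx']
      congr 1
      funext i j
      exact (toChart_secondFundamentalForm g hf hx' hp' _ _).symm
  refine ⟨fun x u => ?_, fun x => ?_, fun x u => ?_⟩
  · obtain ⟨o, -, hT⟩ := hV x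
    have h1 := contractT_oddPairMap_mem (g.inner (f x)).toLinearMap₁₂ q
      (S := LinearMap.ker ((g.inner (f x)).toLinearMap₁₂.flip (diff n m f x u)))
      (a := fun i j => secondFundamentalForm g f x (o i) (o j))
      (fun i j => inner_secondFundamentalForm g hf _ _ _) ⟨0, hn0⟩ ⟨0, hn0⟩
    rw [hT, if_pos rfl, Submodule.smul_mem_iff _ hκ] at h1
    exact h1
  · exact (mdifferentiableAt_field_iff ((hf.1 x).mdifferentiableAt (by simp)) V
      (mem_extChartAt_source x) (mem_extChartAt_source (f x))).2 (key x).1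
  · have hp := mem_extChartAt_source (I := 𝓡 m) (f x)
    have hx := mem_extChartAt_source (I := 𝓡 n) x
    refine (toChart_isInvertible hp).injective ?_
    rw [toChart_normalPart g hf hx hp, toChart_covAlong g hf.1 V hx hp (key x).1, (key x).2]
    exact (map_zero _).symm

end Parallel

/-! ### Hypersurfaces -/

section Hypersurface

variable {n m : ℕ} {M : Type*} [TopologicalSpace M] [ChartedSpace (E n) M] [IsManifold (𝓡 n) ∞ M]
  {N : Type*} [TopologicalSpace N] [ChartedSpace (E m) N] [IsManifold (𝓡 m) ∞ N]
  {f : M → N} {g : Metric m N} {ν : ∀ x : M, TangentSpace (𝓡 m) (f x)}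

/-- The normal space of a hypersurface is spanned by a unit normal vector. -/
theorem eq_inner_smul_of_normal (hm : m = n + 1) {x : M}
    (hf : Function.Injective (diff n m f x)) (hν : IsUnitNormalField n g f ν)
    {w : TangentSpace (𝓡 m) (f x)} (hw : ∀ u, g.inner (f x) w (diff n m f x u) = 0) :
    w = g.inner (f x) w (ν x) • ν x := by
  let B : E m →L[ℝ] E m →L[ℝ] ℝ := g.inner (f x)
  let D : E n →L[ℝ] E m := diff n m f x
  let ξ : E m := ν x
  have hξ : B ξ ξ = 1 := hν.2.1 x
  have hξD : ∀ u, B ξ (D u) = 0 := hν.2.2 x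
  have hpos : ∀ v, v ≠ 0 → 0 < B v v := g.pos (f x)
  -- The tangent space and `ν` span, for reasons of dimension.
  let L : E n × ℝ →ₗ[ℝ] E m := D.toLinearMap.coprod (LinearMap.toSpanSingleton ℝ (E m) ξ)
  have hL : ∀ u t, L (u, t) = D u + t • ξ := fun u t => by simp [L]
  have hinj : Function.Injective L := by
    rw [← LinearMap.ker_eq_bot, LinearMap.ker_eq_bot']
    rintro ⟨u, t⟩ h0
    rw [hL] at h0
    have ht : t = 0 := by
      have h1 := congrArg (B ξ) h0
      simpa [hξD, hξ] using h1
    subst ht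
    rw [zero_smul, add_zero] at h0
    rw [hf (h0.trans (map_zero D).symm)]
    rfl
  have hdim : Module.finrank ℝ (E n × ℝ) = Module.finrank ℝ (E m) := by simp [hm]
  have hsurj := (LinearMap.injective_iff_surjective_of_finrank_eq_finrank hdim).1 hinj
  have key : ∀ w : E m, (∀ u, B w (D u) = 0) → w = B w ξ • ξ := by
    intro w hw
    obtain ⟨⟨u, t⟩, hut⟩ := hsurj (w - B w ξ • ξ)
    rw [hL] at hut
    have h1 : B (w - B w ξ • ξ) (w - B w ξ • ξ) = 0 := by
      nth_rewrite 2 [← hut]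
      simp only [map_sub, map_add, map_smul, sub_apply, smul_apply, hw, hξD, hξ, smul_eq_mul]
      ring
    by_contra hne
    exact (hpos _ (sub_ne_zero.2 hne)).ne' h1
  exact key w hw

/-- If `H ν` is a parallel normal field, then `H` is parallel: `H ^ 2` is the square of the length
of `H ν`, hence locally constant, and `H` is continuous. -/
theorem isParallelFunction_of_smul (hf : IsSmoothImmersion n m f) (hν : IsUnitNormalField n g f ν)
    {H : M → ℝ} (hV : IsParallelNormalField (n := n) g f fun x => H x • ν x) :
    IsParallelFunction n H := by
  set V : ∀ x : M, TangentSpace (𝓡 m) (f x) := fun x => H x • ν x with hVdef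
  have hsq : ∀ x, g.inner (f x) (V x) (V x) = H x ^ 2 := by
    intro x
    simp only [hVdef, map_smul, smul_apply, hν.2.1, smul_eq_mul]
    ring
  have hmul : ∀ x, g.inner (f x) (V x) (ν x) = H x := by
    intro x
    simp only [hVdef, map_smul, smul_apply, hν.2.1, smul_eq_mul, mul_one]
  have hcont : Continuous H := by
    rw [continuous_iff_continuousAt]
    intro x
    have hf' := hf.1.continuous.continuousAt (x := x)
    have hp := mem_extChartAt_source (I := 𝓡 m) (f x)
    have hnear : ∀ᶠ x' in 𝓝 x, f x' ∈ (extChartAt (𝓡 m) (f x)).source :=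
      hf'.preimage_mem_nhds ((isOpen_extChartAt_source (I := 𝓡 m) (f x)).mem_nhds hp)
    have hfield : ∀ W : ∀ x : M, TangentSpace (𝓡 m) (f x),
        ContinuousAt (fun x => (⟨f x, W x⟩ : TangentBundle (𝓡 m) N)) x →
        ContinuousAt (fun x' => (toChart m (f x) (f x') (W x') : E m)) x := by
      intro W hW
      let e := trivializationAt (E m) (TangentSpace (𝓡 m) : N → Type _) (f x)
      have hsrc : (⟨f x, W x⟩ : TangentBundle (𝓡 m) N) ∈ e.source := by
        rw [e.mem_source]
        exact mem_chart_source (E m) (f x)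
      have h1 := ((e.continuousAt hsrc).comp (f := fun x =>
        (⟨f x, W x⟩ : TangentBundle (𝓡 m) N)) hW).snd
      refine h1.congr ?_
      filter_upwards [hnear] with x' hx'
      exact trivializationAt_eq_toChart hx' (W x')
    have hG : ContinuousAt (fun x' => chartMetric g (f x) (extChartAt (𝓡 m) (f x) (f x'))) x := by
      have h1 := ((isMetricOn_chartMetric g (f x)).differentiableAt
        (mem_extChartAt_target (I := 𝓡 m) (f x))).continuousAt
      exact ContinuousAt.comp (f := fun x' => extChartAt (𝓡 m) (f x) (f x')) h1
        (ContinuousAt.comp (f := f) (continuousAt_extChartAt (I := 𝓡 m) (f x)) hf')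
    refine ((hG.clm_apply (hfield V (hV.2.1 x).continuousAt)).clm_apply
      (hfield ν hν.1.continuousAt)).congr ?_
    filter_upwards [hnear] with x' hx'
    exact (chartMetric_toChart g hx' _ _).trans (hmul x')
  have hsq_const : IsLocallyConstant fun x => H x ^ 2 := by
    refine isLocallyConstant_of_hasMFDerivAt_zero (n := n) fun x => ?_
    have him := isImmersedOn_chartRep g hf x (f x)
    have hx := mem_extChartAt_source (I := 𝓡 n) x
    have hp := mem_extChartAt_source (I := 𝓡 m) (f x)
    have hy := mem_chartDomain hx hp
    have hd := (mdifferentiableAt_field_iff ((hf.1 x).mdifferentiableAt (by simp)) V hx hp).1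
      (hV.2.1 x)
    have h0 : ∀ u, chartMetric g (f x) (chartRep n m f x (f x) (extChartAt (𝓡 n) x x))
        (covD (chartMetric g (f x)) (chartRep n m f x (f x)) (fieldRep n m f V x (f x))
          (extChartAt (𝓡 n) x x) u) (fieldRep n m f V x (f x) (extChartAt (𝓡 n) x x)) = 0 := by
      intro u
      obtain ⟨u, rfl⟩ := (toChart_isInvertible hx).surjective u
      rw [← him.nor_pair hy, ← toChart_covAlong g hf.1 V hx hp hd, ← toChart_normalPart g hf hx hp,
        hV.2.2 x u]
      · refine (congrArg (fun a : E m => chartMetric g (f x) _ a _)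
          (map_zero (toChart m (f x) (f x)))).trans ?_
        rw [map_zero, zero_apply]
      · intro v
        obtain ⟨v, rfl⟩ := (toChart_isInvertible hx).surjective v
        rw [fderiv_chartRep hf.1 hx hp, fieldRep_apply V hx, chartRep_apply hx]
        exact (chartMetric_toChart g hp _ _).trans (hV.1 x v)
    have h1 : HasFDerivAt (fun y => H ((extChartAt (𝓡 n) x).symm y) ^ 2) (0 : E n →L[ℝ] ℝ)
        (extChartAt (𝓡 n) x x) := by
      refine ((him.hasFDerivAt_metric hy hd hd).congr_fderiv ?_).congr_of_eventuallyEq ?_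
      · ext u
        have h2 := h0 u
        rw [add_apply, ContinuousLinearMap.comp_apply, ContinuousLinearMap.comp_apply,
          ContinuousLinearMap.flip_apply,
          him.symm hy (fieldRep n m f V x (f x) (extChartAt (𝓡 n) x x)), h2, add_zero, zero_apply]
      · filter_upwards [him.isOpen.mem_nhds hy] with y' hy'
        exact (hsq _).symm.trans (chartMetric_toChart g hy'.2 _ _).symm
    exact hasMFDerivAt_of_chart (h := fun x => H x ^ 2) hx h1
  refine ((IsLocallyConstant.iff_eventually_eq H).2 fun x => ?_).isParallelFunction
  have hloc := (IsLocallyConstant.iff_eventually_eq _).1 hsq_const x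
  by_cases h0 : H x = 0
  · filter_upwards [hloc] with x' hx'
    simpa [h0] using hx'
  · have hpos : ∀ᶠ x' in 𝓝 x, 0 < H x' * H x :=
      (hcont.mul continuous_const).continuousAt.eventually_const_lt (mul_self_pos.2 h0)
    filter_upwards [hloc, hpos] with x' hx' hpos'
    rcases sq_eq_sq_iff_eq_or_eq_neg.1 hx' with h | h
    · exact h
    · rw [h] at hpos'
      nlinarith [mul_self_nonneg (H x)]

/-- The contraction defining the Newton transformation of a hypersurface, in a frame of principal
directions. -/
theorem contractT_principalFrame (hm : m = n + 1) (hf : IsSmoothImmersion n m f)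
    (hν : IsUnitNormalField n g f ν) {x : M} {e : Fin n → TangentSpace (𝓡 n) x} {k : Fin n → ℝ}
    (he : IsPrincipalFrame g f ν x e k) {r : ℕ} {Z : Type*} [AddCommGroup Z] [Module ℝ Z]
    (Φ : MultilinearMap ℝ (fun _ : Fin r => TangentSpace (𝓡 m) (f x)) Z)
    {κ : ℝ} (hT : ∀ i, hyperT k r i = κ * hyperH k r) (s t : Fin n) :
    contractT Φ (fun i j => secondFundamentalForm g f x (e i) (e j)) s t =
      if s = t then (κ * (r.factorial : ℝ)) • hyperH k r • Φ fun _ => ν x else 0 := by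
  have hA : ∀ i j, secondFundamentalForm g f x (e i) (e j) = (if i = j then k i else 0) • ν x := by
    intro i j
    rw [← he.2 i j]
    exact eq_inner_smul_of_normal hm (hf.2 x) hν (inner_secondFundamentalForm g hf _ _)
  simp only [hA]
  rw [contractT_diagonal, hT]
  split_ifs
  · rw [smul_smul]
    congr 1
    ring
  · rw [zero_mul, zero_smul]

/-- The scalar Newton transformation of a hypersurface in order `r` is covered by the general case,
with `H` the function `hyperH` if `r` is even and the normal field `hyperH • ν` if `r` is odd. -/
theorem isParallelFunction_hyperH {c : ℝ} (hg : HasConstantCurvature g c)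
    (hm : m = n + 1) (hf : IsSmoothImmersion n m f) (hn0 : 0 < n)
    (hν : IsUnitNormalField n g f ν) {e : ∀ x : M, Fin n → TangentSpace (𝓡 n) x}
    {k : M → Fin n → ℝ} (he : ∀ x, IsPrincipalFrame g f ν x (e x) (k x)) {r : ℕ} {κ : ℝ}
    (hκ : κ ≠ 0) (hT : ∀ x i, hyperT (k x) r i = κ * hyperH (k x) r) :
    IsParallelFunction n fun x => hyperH (k x) r := by
  have hκ' : κ * (r.factorial : ℝ) ≠ 0 := mul_ne_zero hκ (by positivity)
  have hνν : ∀ x, (g.inner (f x)).toLinearMap₁₂ (ν x) (ν x) = 1 := hν.2.1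
  rcases Nat.even_or_odd' r with ⟨q, rfl | rfl⟩
  · refine isParallelFunction_of_contractT_eq hg hf hn0 (q := q) hκ' fun x =>
      ⟨e x, (he x).1, fun s t => ?_⟩
    rw [contractT_principalFrame hm hf hν (he x) _ (hT x)]
    simp only [pairMap_apply, hνν, Finset.prod_const_one, smul_eq_mul, mul_one]
  · refine isParallelFunction_of_smul hf hν (isParallelNormalField_of_contractT_eq hg hf hn0
      (q := q) hκ' fun x => ⟨e x, (he x).1, fun s t => ?_⟩)
    rw [contractT_principalFrame hm hf hν (he x) _ (hT x)]
    simp only [oddPairMap_apply, pairMap_apply, hνν, Finset.prod_const_one, one_smul]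

end Hypersurface

end ImmersedSubmanifold

/-! ### Parallel higher mean curvatures -/

theorem mainTheorem5 {n m : ℕ}
    {M : Type*} [TopologicalSpace M] [CompactSpace M] [ChartedSpace (E n) M]
    [IsManifold (𝓡 n) ∞ M]
    {N : Type*} [TopologicalSpace N] [ChartedSpace (E m) N] [IsManifold (𝓡 m) ∞ N]
    (g : Metric m N) (c : ℝ) (hg : HasConstantCurvature g c)
    (f : M → N) (hf : IsSmoothImmersion n m f)
    (r : ℕ) (hr : 1 ≤ r) (hrn : r ≤ n - 1) :
    -- even `r`: `H_r` is a function
    (∀ q : ℕ, r = 2 * q →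
      (∀ (x : M) (s t : Fin n), evenNewton g f q x s t =
        (((n : ℝ) - r) / n) * evenMeanCurvature (n := n) g f q x * (if s = t then 1 else 0)) →
      IsParallelFunction n (evenMeanCurvature (n := n) g f q)) ∧
    -- odd `r`: `H_r` is a normal vector field
    (∀ q : ℕ, r = 2 * q + 1 →
      (∀ (x : M) (s t : Fin n), oddNewton g f q x s t =
        (((n : ℝ) - r) / n * (if s = t then 1 else 0)) • oddMeanCurvature (n := n) g f q x) →
      IsParallelNormalField (n := n) g f (oddMeanCurvature (n := n) g f q)) ∧
    -- hypersurfaces with a unit normal field: `H_r` is a function for every `r`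
    (m = n + 1 → ∀ ν : ∀ x : M, TangentSpace (𝓡 m) (f x), IsUnitNormalField n g f ν →
      ∀ (e : ∀ x : M, Fin n → TangentSpace (𝓡 n) x) (k : M → Fin n → ℝ),
      (∀ x, IsPrincipalFrame g f ν x (e x) (k x)) →
      (∀ (x : M) (i : Fin n), hyperT (k x) r i = (((n : ℝ) - r) / n) * hyperH (k x) r) →
      IsParallelFunction n (fun x => hyperH (k x) r)) := by
  have hn : 0 < n := by omega
  have hn' : (0 : ℝ) < n := by exact_mod_cast hn
  have hnr : (r : ℝ) < n := by exact_mod_cast (by omega : r < n)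
  have hκ : ((n : ℝ) - r) / n ≠ 0 := (div_pos (sub_pos.2 hnr) hn').ne'
  refine ⟨?_, ?_, ?_⟩
  · rintro q rfl hT
    have hfac : ((2 * q).factorial : ℝ) ≠ 0 := by positivity
    refine isParallelFunction_of_contractT_eq hg hf hn (q := q) (mul_ne_zero hκ hfac) fun x =>
      ⟨orthoFrame g f x, orthoFrame_spec g f x (hf.2 x), fun s t => ?_⟩
    -- The definition of `evenNewton` unfolds to a multiple of `contractT`.
    have h1 : (1 / ((2 * q).factorial : ℝ)) • contractT (pairMap (g.inner (f x)).toLinearMap₁₂ q)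
        (secondFormComponents (n := n) g f x) s t = _ := hT x s t
    rw [one_div, smul_eq_mul, inv_mul_eq_iff_eq_mul₀ hfac] at h1
    refine h1.trans ?_
    split_ifs
    · rw [smul_eq_mul]
      ring
    · ring
  · rintro q rfl hT
    have hfac : ((2 * q + 1).factorial : ℝ) ≠ 0 := by positivity
    refine isParallelNormalField_of_contractT_eq hg hf hn (q := q) (mul_ne_zero hκ hfac) fun x =>
      ⟨orthoFrame g f x, orthoFrame_spec g f x (hf.2 x), fun s t => ?_⟩
    -- The definition of `oddNewton` unfolds to a multiple of `contractT`.
    have h1 : (1 / ((2 * q + 1).factorial : ℝ)) •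
        contractT (oddPairMap (g.inner (f x)).toLinearMap₁₂ q)
          (secondFormComponents (n := n) g f x) s t = _ := hT x s t
    rw [one_div, inv_smul_eq_iff₀ hfac] at h1
    refine h1.trans ?_
    split_ifs
    · rw [smul_smul, mul_one, mul_comm]
    · rw [mul_zero, zero_smul, smul_zero]
  · intro hm ν hν e k he hT
    exact isParallelFunction_hyperH hg hm hf hn hν he hκ hT
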